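/- **Setting.** A triangulation $\mathsf T$ is a simplicial complex (possibly infinite, locally finite) whose underlying space is a connected surface, possibly with boundary; $V$, $E$ are its sets of vertices and edges. A discrete metric is a function $\ell:E\to\mathbb R_{>0}$ satisfying the strict triangle inequalities in every triangle; the euclidean triangulation $(\mathsf T,\ell)$ is obtained by gluing euclidean triangles with these side lengths edge-to-edge. Two euclidean triangulations $(\mathsf T,\ell)$, $(\mathsf T,\tilde\ell)$ with the same combinatorics are *discretely conformally equivalent* if there is $u:V\to\mathbb R$ with $\tilde\ell_{ij}=e^{\frac12(u_i+u_j)}\ell_{ij}$ for all edges $ij$. A *discrete conformal map* $(\mathsf T,\ell)\to(\mathsf T,\tilde\ell)$ is a homeomorphism whose restriction to each triangle is the projective map onto the corresponding triangle that maps each vertex to the corresponding vertex and the circumcircle onto the circumcircle. Interpreting the open circumdisk of a euclidean triangle as the Klein model of the hyperbolic plane (curvature $-1$) gives a hyperbolic metric on the triangle minus its vertices; let $d_\ell$ be the metric on $\mathsf T\setminus V$ obtained by gluing these, i.e. $d_\ell(x,y)$ is the infimum of the lengths of finite chains of points from $x$ to $y$ in which consecutive points lie in a common triangle and contribute their hyperbolic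 distance in that triangle. **Theorem.** (1) For every euclidean triangulation $(\mathsf T,\ell)$, $d_\ell$ is a metric on $\mathsf T\setminus V$ that induces its topology, that agrees locally on each triangle with the hyperbolic metric of that triangle, and that is hyperbolic with cusps at the vertices: every interior point has a neighbourhood isometric to a disk in the hyperbolic plane $H^2$, every boundary point has a neighbourhood isometric to a half-disk in $H^2$, every interior vertex has a punctured neighbourhood that is the image of a horoball $\{\operatorname{Im} z>h\}$ modulo a translation $z\mapsto z+w$ ($w>0$) under an injective local isometry, with $\operatorname{Im}z\to\infty$ corresponding to the vertex, and every boundary vertex has a punctured neighbourhood that is likewise the image of $\{\operatorname{Im} z>h,\ 0\le \operatorname{Re} z\le w\}$ under an injective local isometry. (2) Let $(\mathsf T,\ell)$ and $(\mathsf T,\tilde\ell)$ be two euclidean triangulations with the same combinatorics. They are discretely conformally equivalent if and only if the induced hyperbolic metrics are isometric by an isometry that respects the triangulation, that is, if and only if there is a bijective isometry $(\mathsf T\setminus V,d_\ell)\to(\mathsf T\setminus V,d_{\tilde\ell})$ that maps every open edge and every open triangle onto the corresponding one. (3) A homeomorphism $F:\mathsf T\to\mathsf T$ is a discrete conformal map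 $(\mathsf T,\ell)\to(\mathsf T,\tilde\ell)$ if and only if it restricts to an isometry as in (2). Conversely, every isometry as in (2) extends to exactly one discrete conformal map. -/

import Mathlib

open Set Filter Topology
open scoped UpperHalfPlane

noncomputable section

/-! ### Triangulated surfaces -/

/-- A triangulation of a connected surface (possibly with boundary) which is a simplicial complex:
a pure two-dimensional connected simplicial complex in which every vertex link is a finite path or
a finite cycle, i.e. a finite connected graph all of whose vertices have degree at most two.
The vertex set is `V`; it need not be finite. -/
structure SurfaceTriangulation (V : Type*) [DecidableEq V] extends AbstractSimplicialComplex V where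
  pure : ∀ s ∈ faces, ∃ t ∈ faces, t.card = 3 ∧ s ⊆ t
  finite_link : ∀ i : V, {j : V | {i, j} ∈ faces}.Finite
  connected_link : ∀ i : V,
    (SimpleGraph.mk (V := {j : V // j ≠ i ∧ {i, j} ∈ faces})
      (fun j k => j ≠ k ∧ {i, j.1, k.1} ∈ faces)
      ⟨fun j k h => ⟨h.1.symm, by rw [Finset.pair_comm]; exact h.2⟩⟩
      ⟨fun _ h => h.1 rfl⟩).Connected
  degree_link : ∀ i j : V, i ≠ j → {k : V | k ≠ i ∧ k ≠ j ∧ {i, j, k} ∈ faces}.encard ≤ 2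
  connected : (SimpleGraph.mk (V := V) (fun i j => i ≠ j ∧ {i, j} ∈ faces)
      ⟨fun i j h => ⟨h.1.symm, by rw [Finset.pair_comm]; exact h.2⟩⟩
      ⟨fun _ h => h.1 rfl⟩).Connected

namespace SurfaceTriangulation

variable {V : Type*} [DecidableEq V] (T : SurfaceTriangulation V)

/-- `i` and `j` are the ends of an edge. -/
def IsEdge (i j : V) : Prop := i ≠ j ∧ {i, j} ∈ T.faces

/-- The set of triangles. -/
def triangles : Set (Finset V) := {t | t ∈ T.faces ∧ t.card = 3}

/-- `i` and `j` are the ends of a boundary edge: an edge that lies in exactly one triangle. -/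
def IsBoundaryEdge (i j : V) : Prop := i ≠ j ∧ ∃! k, k ≠ i ∧ k ≠ j ∧ {i, j, k} ∈ T.faces

/-- `i` is a boundary vertex. -/
def IsBoundaryVertex (i : V) : Prop := ∃ j, T.IsBoundaryEdge i j

/-- The closed simplex with vertex set `t`, in barycentric coordinates. -/
def simplex (t : Finset V) : Set (V → ℝ) :=
  {x | (∀ i, 0 ≤ x i) ∧ (∀ i, i ∉ t → x i = 0) ∧ ∑ i ∈ t, x i = 1}

/-- The underlying surface, in barycentric coordinates. As the complex is locally finite, its
topology is the one induced from the product `V → ℝ`. -/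
def space : Set (V → ℝ) := {x | ∃ t ∈ T.triangles, x ∈ simplex t}

/-- The point of the surface that is the vertex `i`. -/
def vertex (i : V) : V → ℝ := Pi.single i 1

/-- The closed simplex on `t` without its vertices. -/
def puncturedSimplex (t : Finset V) : Set (V → ℝ) := {x | x ∈ simplex t ∧ ∀ i, x ≠ vertex i}

/-- The surface without the vertices of the triangulation. -/
def punctured : Set (V → ℝ) := {x | x ∈ T.space ∧ ∀ i, x ≠ vertex i}

/-- `x` lies on a boundary edge. -/
def IsBoundaryPoint (x : V → ℝ) : Prop :=
  ∃ i j, T.IsBoundaryEdge i j ∧ x ∈ simplex {i, j}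

end SurfaceTriangulation

/-! ### Discrete metrics and discrete conformal equivalence -/

/-- A discrete metric: positive edge lengths satisfying the (strict) triangle inequalities in every
triangle. The values of `len` at pairs that are not edges are irrelevant. -/
structure DiscreteMetric {V : Type*} [DecidableEq V] (T : SurfaceTriangulation V) where
  len : Sym2 V → ℝ
  pos : ∀ i j, T.IsEdge i j → 0 < len s(i, j)
  triangle_lt : ∀ i j k, i ≠ j → j ≠ k → i ≠ k → {i, j, k} ∈ T.faces →
    len s(i, k) < len s(i, j) + len s(j, k)

/-- The euclidean plane. -/
abbrev Plane : Type := EuclideanSpace ℝ (Fin 2)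

namespace DiscreteMetric

variable {V : Type*} [DecidableEq V] {T : SurfaceTriangulation V}

/-- Discrete conformal equivalence of two discrete metrics on the same triangulation. -/
def ConformallyEquivalent (l l' : DiscreteMetric T) : Prop :=
  ∃ u : V → ℝ, ∀ i j, T.IsEdge i j →
    l'.len s(i, j) = Real.exp ((u i + u j) / 2) * l.len s(i, j)

/-- A euclidean triangle in the plane whose sides have the lengths prescribed by `l` on the triangle
`t` of the triangulation, together with its circumcircle. (It is unique up to congruence.) -/
structure Placement (l : DiscreteMetric T) (t : Finset V) where
  pt : V → Plane
  circ : EuclideanGeometry.Sphere Plane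
  dist_pt : ∀ i ∈ t, ∀ j ∈ t, i ≠ j → dist (pt i) (pt j) = l.len s(i, j)
  pt_mem : ∀ i ∈ t, pt i ∈ circ

theorem exists_placement (l : DiscreteMetric T) {t : Finset V} (ht : t ∈ T.triangles) :
    Nonempty (l.Placement t) := by
  obtain ⟨hf, hc⟩ := ht
  obtain ⟨i, j, k, hij, hik, hjk, rfl⟩ := Finset.card_eq_three.1 hc
  have ha := l.triangle_lt i j k hij hjk hik hf
  have hb := l.triangle_lt j i k hij.symm hik hjk (by rwa [Finset.insert_comm])
  have hd := l.triangle_lt i k j hik hjk.symm hij (by rwa [Finset.pair_comm k j])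
  rw [Sym2.eq_swap (a := j) (b := i)] at hb
  rw [Sym2.eq_swap (a := k) (b := j)] at hd
  set a := l.len s(j, k) with hadef
  set b := l.len s(i, k) with hbdef
  set c := l.len s(i, j) with hcdef
  have ha0 : 0 < a := by linarith
  have hb0 : 0 < b := by linarith
  have hc0 : 0 < c := by linarith
  obtain ⟨X, hX⟩ : ∃ X, X = (b ^ 2 + c ^ 2 - a ^ 2) / (2 * c) := ⟨_, rfl⟩
  have hX' : 2 * c * X = b ^ 2 + c ^ 2 - a ^ 2 := by rw [hX]; field_simp
  have hY : 0 < b ^ 2 - X ^ 2 := by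
    have h1 : 0 < (2 * c) ^ 2 * (b ^ 2 - X ^ 2) := by
      have : (2 * c) ^ 2 * (b ^ 2 - X ^ 2) =
          (a + b + c) * (b + c - a) * (a + b - c) * (a + c - b) := by
        have : (2 * c) ^ 2 * (b ^ 2 - X ^ 2) = (2 * b * c) ^ 2 - (2 * c * X) ^ 2 := by ring
        rw [this, hX']; ring
      rw [this]
      have h2 : 0 < b + c - a := by linarith
      have h3 : 0 < a + b - c := by linarith
      have h4 : 0 < a + c - b := by linarith
      positivity
    exact (mul_pos_iff_of_pos_left (by positivity)).1 h1
  obtain ⟨Y, hYdef⟩ : ∃ Y, Y = Real.sqrt (b ^ 2 - X ^ 2) := ⟨_, rfl⟩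
  have hY0 : 0 < Y := by rw [hYdef]; exact Real.sqrt_pos.2 hY
  have hYY : Y ^ 2 = b ^ 2 - X ^ 2 := by rw [hYdef]; exact Real.sq_sqrt hY.le
  obtain ⟨q, hq⟩ : ∃ q, q = (X ^ 2 + Y ^ 2 - c * X) / (2 * Y) := ⟨_, rfl⟩
  have hq' : 2 * Y * q = X ^ 2 + Y ^ 2 - c * X := by rw [hq]; field_simp
  have key : ∀ x y x' y' r : ℝ, 0 ≤ r → (x - x') ^ 2 + (y - y') ^ 2 = r ^ 2 →
      dist (!₂[x, y] : Plane) !₂[x', y'] = r := by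
    intro x y x' y' r hr h
    rw [EuclideanSpace.dist_eq, Fin.sum_univ_two]
    simp [Real.dist_eq, sq_abs, h, Real.sqrt_sq hr]
  have hR : Real.sqrt ((c / 2) ^ 2 + q ^ 2) ^ 2 = (c / 2) ^ 2 + q ^ 2 := Real.sq_sqrt (by positivity)
  have dij : dist (!₂[0, 0] : Plane) !₂[c, 0] = c := key _ _ _ _ _ hc0.le (by ring)
  have dik : dist (!₂[0, 0] : Plane) !₂[X, Y] = b := key _ _ _ _ _ hb0.le (by linarith)
  have djk : dist (!₂[c, 0] : Plane) !₂[X, Y] = a :=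
    key _ _ _ _ _ ha0.le (by linear_combination hYY - hX')
  refine ⟨⟨fun v => if v = i then !₂[0, 0] else if v = j then !₂[c, 0] else !₂[X, Y],
    ⟨!₂[c / 2, q], Real.sqrt ((c / 2) ^ 2 + q ^ 2)⟩, ?_, ?_⟩⟩
  · intro u hu v hv huv
    simp only [Finset.mem_insert, Finset.mem_singleton] at hu hv
    rcases hu with rfl | rfl | rfl <;> rcases hv with rfl | rfl | rfl
    · exact absurd rfl huv
    · simpa [hij.symm] using dij
    · simpa [hik.symm, hjk.symm] using dik
    · rw [Sym2.eq_swap, dist_comm]; simpa [hij.symm] using dij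
    · exact absurd rfl huv
    · simpa [hij.symm, hik.symm, hjk.symm] using djk
    · rw [Sym2.eq_swap, dist_comm]; simpa [hik.symm, hjk.symm] using dik
    · rw [Sym2.eq_swap, dist_comm]; simpa [hij.symm, hik.symm, hjk.symm] using djk
    · exact absurd rfl huv
  · intro v hv
    simp only [Finset.mem_insert, Finset.mem_singleton] at hv
    rw [EuclideanGeometry.mem_sphere]
    rcases hv with rfl | rfl | rfl
    · simpa using key 0 0 (c / 2) q _ (Real.sqrt_nonneg _) (by rw [hR]; ring)
    · simpa [hij.symm] using key c 0 (c / 2) q _ (Real.sqrt_nonneg _) (by rw [hR]; ring)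
    · simpa [hik.symm, hjk.symm] using key X Y (c / 2) q _ (Real.sqrt_nonneg _)
        (by rw [hR]; linear_combination -hq')

/-- A chosen euclidean triangle representing the triangle `t`. -/
def placement (l : DiscreteMetric T) {t : Finset V} (ht : t ∈ T.triangles) : l.Placement t :=
  Classical.choice (l.exists_placement ht)

/-- The point of the euclidean triangle with barycentric coordinates `x`. -/
def Placement.point {l : DiscreteMetric T} {t : Finset V} (P : l.Placement t) (x : V → ℝ) : Plane :=
  ∑ i ∈ t, x i • P.pt i

end DiscreteMetric

/-! ### The hyperbolic metric induced by the circumcircles -/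

/-- The hyperbolic distance (curvature `-1`) of two points of the open disk bounded by the circle `s`,
regarded as the Klein model of the hyperbolic plane. -/
def kleinDist (s : EuclideanGeometry.Sphere Plane) (p q : Plane) : ℝ :=
  Real.arcosh ((s.radius ^ 2 - inner ℝ (p - s.center) (q - s.center)) /
    (Real.sqrt (s.radius ^ 2 - ‖p - s.center‖ ^ 2) * Real.sqrt (s.radius ^ 2 - ‖q - s.center‖ ^ 2)))

namespace DiscreteMetric

variable {V : Type*} [DecidableEq V] {T : SurfaceTriangulation V}

/-- The hyperbolic distance of two points of a euclidean triangle (minus its vertices) in the Klein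
model bounded by the circumcircle of the triangle. -/
def triangleDist (l : DiscreteMetric T) {t : Finset V} (ht : t ∈ T.triangles) (x y : V → ℝ) : ℝ :=
  kleinDist (l.placement ht).circ ((l.placement ht).point x) ((l.placement ht).point y)

/-- The hyperbolic distance on the punctured surface obtained by gluing the hyperbolic metrics of the
triangles: the infimum of the lengths of chains of points in which any two consecutive points
lie in a common triangle and contribute their distance in that triangle. -/
def hypDist (l : DiscreteMetric T) (x y : V → ℝ) : ℝ :=
  sInf {L : ℝ | ∃ (n : ℕ) (p : ℕ → V → ℝ) (τ : ℕ → T.triangles),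
    p 0 = x ∧ p n = y ∧
    (∀ m < n, p m ∈ SurfaceTriangulation.puncturedSimplex (τ m).1 ∧
      p (m + 1) ∈ SurfaceTriangulation.puncturedSimplex (τ m).1) ∧
    L = ∑ m ∈ Finset.range n, l.triangleDist (τ m).2 (p m) (p (m + 1))}

end DiscreteMetric

/-! ### Hyperbolic metrics with cusps -/

/-- `φ`, restricted to the subset `D` of the hyperbolic plane, preserves distances locally. -/
def LocallyIsometricOn {X : Type*} (d : X → X → ℝ) (φ : ℍ → X) (D : Set ℍ) : Prop :=
  ∀ z ∈ D, ∃ r > 0, ∀ a ∈ D ∩ Metric.ball z r, ∀ b ∈ D ∩ Metric.ball z r, d (φ a) (φ b) = dist a b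

namespace SurfaceTriangulation

variable {V : Type*} [DecidableEq V] (T : SurfaceTriangulation V)

/-- `φ` maps the subset `D` of the hyperbolic plane, locally isometrically, onto a punctured
neighbourhood of the vertex `i`, and the point at infinity of `D` corresponds to `i`. -/
structure IsCuspChart (d : (V → ℝ) → (V → ℝ) → ℝ) (i : V) (D : Set ℍ) (φ : ℍ → V → ℝ) : Prop where
  mapsTo : MapsTo φ D T.punctured
  isometric : LocallyIsometricOn d φ D
  nhds : insert (vertex i) (φ '' D) ∈ 𝓝[T.space] (vertex i)
  tendsto : Tendsto φ (comap UpperHalfPlane.im atTop ⊓ 𝓟 D) (𝓝 (vertex i))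

/-- `d` is a hyperbolic metric (with geodesic boundary) on the punctured surface, with cusps at the
vertices. -/
structure IsHyperbolicCuspMetric (d : (V → ℝ) → (V → ℝ) → ℝ) : Prop where
  eq_zero_iff : ∀ x ∈ T.punctured, ∀ y ∈ T.punctured, d x y = 0 ↔ x = y
  symm : ∀ x ∈ T.punctured, ∀ y ∈ T.punctured, d x y = d y x
  triangle : ∀ x ∈ T.punctured, ∀ y ∈ T.punctured, ∀ z ∈ T.punctured, d x z ≤ d x y + d y z
  /-- The metric induces the topology of the surface. -/
  topology : ∀ x ∈ T.punctured,
    (𝓝[T.punctured] x).HasBasis (fun r : ℝ => 0 < r) (fun r => {y | y ∈ T.punctured ∧ d x y < r})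
  /-- Interior points have a neighbourhood isometric to a disk in the hyperbolic plane. -/
  interior : ∀ x ∈ T.punctured, ¬ T.IsBoundaryPoint x → ∃ r > 0, ∃ φ : ℍ → V → ℝ,
    φ UpperHalfPlane.I = x ∧ MapsTo φ (Metric.ball UpperHalfPlane.I r) T.punctured ∧
    φ '' Metric.ball UpperHalfPlane.I r ∈ 𝓝[T.punctured] x ∧
    ∀ a ∈ Metric.ball UpperHalfPlane.I r, ∀ b ∈ Metric.ball UpperHalfPlane.I r,
      d (φ a) (φ b) = dist a b
  /-- Boundary points have a neighbourhood isometric to a half-disk in the hyperbolic plane. -/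
  boundary : ∀ x ∈ T.punctured, T.IsBoundaryPoint x → ∃ r > 0, ∃ φ : ℍ → V → ℝ,
    φ UpperHalfPlane.I = x ∧
    MapsTo φ (Metric.ball UpperHalfPlane.I r ∩ {z | 0 ≤ z.re}) T.punctured ∧
    φ '' (Metric.ball UpperHalfPlane.I r ∩ {z | 0 ≤ z.re}) ∈ 𝓝[T.punctured] x ∧
    ∀ a ∈ Metric.ball UpperHalfPlane.I r ∩ {z | 0 ≤ z.re},
      ∀ b ∈ Metric.ball UpperHalfPlane.I r ∩ {z | 0 ≤ z.re}, d (φ a) (φ b) = dist a b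
  /-- An interior vertex has a punctured neighbourhood isometric to the quotient of a horoball
  by a parabolic translation. -/
  cusp : ∀ i, ¬ T.IsBoundaryVertex i → ∃ w > 0, ∃ h > 0, ∃ φ : ℍ → V → ℝ,
    T.IsCuspChart d i {z | h < z.im} φ ∧
    ∀ z z' : ℍ, h < z.im → h < z'.im → (φ z = φ z' ↔ ∃ n : ℤ, z' = ((n : ℝ) * w) +ᵥ z)
  /-- A boundary vertex has a punctured neighbourhood isometric to the part of a horoball that
  lies between two geodesics ending at its centre. -/
  boundary_cusp : ∀ i, T.IsBoundaryVertex i → ∃ w > 0, ∃ h > 0, ∃ φ : ℍ → V → ℝ,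
    T.IsCuspChart d i {z | h < z.im ∧ 0 ≤ z.re ∧ z.re ≤ w} φ ∧
    InjOn φ {z | h < z.im ∧ 0 ≤ z.re ∧ z.re ≤ w}

end SurfaceTriangulation

namespace DiscreteMetric

variable {V : Type*} [DecidableEq V] {T : SurfaceTriangulation V}

/-- The function `d` on the punctured surface restricts, locally, to the hyperbolic metric of each
individual triangle. -/
def RestrictsToTriangles (l : DiscreteMetric T) (d : (V → ℝ) → (V → ℝ) → ℝ) : Prop :=
  ∀ (t : Finset V) (ht : t ∈ T.triangles), ∀ x ∈ SurfaceTriangulation.puncturedSimplex t,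
    ∃ U ∈ 𝓝 x, ∀ y ∈ U ∩ SurfaceTriangulation.puncturedSimplex t,
      ∀ z ∈ U ∩ SurfaceTriangulation.puncturedSimplex t, d y z = l.triangleDist ht y z

/-- `g` is an isometry between the hyperbolic metrics induced by `l` and `l'` that respects the
triangulation, i.e. carries every (open) edge and triangle onto itself. -/
structure IsHyperbolicIsometry (l l' : DiscreteMetric T) (g : T.punctured ≃ T.punctured) : Prop where
  dist_eq : ∀ x y : T.punctured, l'.hypDist (g x) (g y) = l.hypDist x y
  support_eq : ∀ x : T.punctured, Function.support (g x : V → ℝ) = Function.support (x : V → ℝ)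

end DiscreteMetric

/-! ### Discrete conformal maps -/

/-- The plane as a subset of the projective plane. -/
def toProj (p : Plane) : Projectivization ℝ (Plane × ℝ) :=
  Projectivization.mk ℝ (p, 1) (fun h => one_ne_zero (congrArg Prod.snd h))

/-- The projective transformation induced by an invertible linear map of homogeneous coordinates. -/
def projMap (A : (Plane × ℝ) ≃ₗ[ℝ] (Plane × ℝ)) :
    Projectivization ℝ (Plane × ℝ) → Projectivization ℝ (Plane × ℝ) :=
  Projectivization.map A.toLinearMap A.injective

namespace DiscreteMetric

variable {V : Type*} [DecidableEq V] {T : SurfaceTriangulation V}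

/-- A discrete conformal map: a homeomorphism whose restriction to every triangle is the projective
map onto the corresponding triangle that maps each vertex to the corresponding vertex and the
circumcircle onto the circumcircle. -/
def IsDiscreteConformalMap (l l' : DiscreteMetric T) (F : T.space ≃ₜ T.space) : Prop :=
  ∀ (t : Finset V) (ht : t ∈ T.triangles), ∃ A : (Plane × ℝ) ≃ₗ[ℝ] (Plane × ℝ),
    (∀ i ∈ t, projMap A (toProj ((l.placement ht).pt i)) = toProj ((l'.placement ht).pt i)) ∧
    (fun p => projMap A (toProj p)) '' {p | p ∈ (l.placement ht).circ} =
      toProj '' {p | p ∈ (l'.placement ht).circ} ∧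
    ∀ x : T.space, (x : V → ℝ) ∈ SurfaceTriangulation.simplex t →
      (F x : V → ℝ) ∈ SurfaceTriangulation.simplex t ∧
      projMap A (toProj ((l.placement ht).point x)) = toProj ((l'.placement ht).point (F x))

/-- `F` extends the map `g` of the punctured surface. -/
def Extends (F : T.space ≃ₜ T.space) (g : T.punctured ≃ T.punctured) : Prop :=
  ∀ x : T.punctured, (F ⟨x.1, x.2.1⟩ : V → ℝ) = g x

end DiscreteMetric

end

/-!
On the triangle `t`, the power of a point with respect to the circumcircle is, in homogeneous
barycentric coordinates, the quadratic form `∑ x_k x_m l_km ^ 2 / 2` (`form_eq_inner`), so that the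
Klein distance of the circumdisk depends only on this form (`triangleDist_eq`). All three parts follow
from this description.

*The glued metric.* At a vertex `i`, the form of each triangle is the determinant of a sum of positive
semidefinite rank one matrices. This develops the star of `i` into the upper half-plane with `i` at
infinity (`dev`), isometrically on each triangle (`triangleDist_eq_dist_dev`), where the triangles
become parts of vertical strips. The glued distance is bounded above by chains in the strips, as a
geodesic of the half-plane crosses the side between two strips (`exists_dist_add_dist_of_re`), and
below by a truncated developed distance, which is `1`-Lipschitz on every triangle
(`exists_dist_dev_le`). Hence the inverse of the developing map along a walk around `i` is a local
isometry (`isLocalChart_strips`). The walk is either periodic or bounces between the two ends of the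
link; this gives the charts at interior and boundary points, and the cusps (`exists_cusp`,
`exists_boundary_cusp`).

*Isometries.* An isometry that respects the triangulation preserves the distance of each triangle,
since a segment can be subdivided into pieces on which the glued distance is that of the triangle
(`IsHyperbolicIsometry.triangleDist_eq`). It therefore lifts to a map between the cones over the
triangle that preserves the form. Nondegeneracy of the form makes the lift linear, and preservation of
the faces makes it diagonal (`exists_diagonal`). The diagonal entries agree between triangles because
links are connected, and they are weights `d` with `d_i d_j l'_ij ^ 2 = l_ij ^ 2`
(`IsHyperbolicIsometry.exists_weights`), which is discrete conformal equivalence.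

*Discrete conformal maps.* A projective map between triangles that respects the vertices scales the
homogeneous barycentric coordinates; it respects the circumcircles if and only if it carries the forms
to multiples of each other (`exists_projMap`, `exists_proportional`). Thus discrete conformal maps and
isometries that respect the triangulation are given by the same formula, and the extension to the
vertices is unique as the punctured surface is dense (`dense_punctured`).
-/

noncomputable section

/-! ### Simplices and the cones over them -/

namespace SurfaceTriangulation

variable {V : Type*} [DecidableEq V] {T : SurfaceTriangulation V}

theorem mem_simplex_of_support {s t : Finset V} {x : V → ℝ} (hx : x ∈ simplex s)
    (h : ∀ i, x i ≠ 0 → i ∈ t) : x ∈ simplex t := by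
  refine ⟨hx.1, fun i hi => by_contra fun h0 => hi (h i h0), ?_⟩
  rw [← hx.2.2, ← Finset.sum_subset (Finset.inter_subset_left (s₁ := t) (s₂ := s)),
    ← Finset.sum_subset (Finset.inter_subset_right (s₁ := t) (s₂ := s))]
  · intro i hi hi'
    by_contra h0
    exact hi' (Finset.mem_inter.2 ⟨h i h0, hi⟩)
  · intro i hi hi'
    exact hx.2.1 i fun h => hi' (Finset.mem_inter.2 ⟨hi, h⟩)

theorem mem_of_mem_simplex {t : Finset V} {x : V → ℝ} (hx : x ∈ simplex t) {i : V}
    (hi : x i ≠ 0) : i ∈ t := by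
  by_contra h
  exact hi (hx.2.1 i h)

theorem vertex_mem_simplex {t : Finset V} {i : V} (hi : i ∈ t) : vertex i ∈ simplex t := by
  refine ⟨fun j => ?_, fun j hj => ?_, ?_⟩
  · by_cases h : j = i <;> simp [vertex, h]
  · have : j ≠ i := by rintro rfl; exact hj hi
    simp [vertex, this]
  · simp [vertex, Pi.single_apply, hi]

/-- A triangle with a marked vertex, with names for the other two vertices. -/
theorem exists_triangle_eq {t : Finset V} (ht : t ∈ T.triangles) {i : V} (hi : i ∈ t) :
    ∃ j k, i ≠ j ∧ i ≠ k ∧ j ≠ k ∧ t = {i, j, k} := by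
  have h : (t.erase i).card = 2 := by rw [Finset.card_erase_of_mem hi, ht.2]
  obtain ⟨j, k, hjk, h⟩ := Finset.card_eq_two.1 h
  have hj : j ∈ t.erase i := by simp [h]
  have hk : k ∈ t.erase i := by simp [h]
  refine ⟨j, k, (Finset.ne_of_mem_erase hj).symm, (Finset.ne_of_mem_erase hk).symm, hjk, ?_⟩
  rw [← Finset.insert_erase hi, h]

/-- A triangle with two marked vertices, with a name for the third. -/
theorem exists_triangle_eq₂ {t : Finset V} (ht : t ∈ T.triangles) {i j : V} (hi : i ∈ t)
    (hj : j ∈ t) (hij : i ≠ j) : ∃ k, i ≠ k ∧ j ≠ k ∧ t = {i, j, k} := by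
  obtain ⟨a, b, ha, hb, hab, rfl⟩ := exists_triangle_eq ht hi
  simp only [Finset.mem_insert, Finset.mem_singleton] at hj
  rcases hj with rfl | rfl | rfl
  · exact absurd rfl hij
  · exact ⟨b, hb, hab, rfl⟩
  · exact ⟨a, ha, hab.symm, by rw [Finset.pair_comm]⟩

theorem triple_mem_triangles {i j k : V} (hij : i ≠ j) (hik : i ≠ k) (hjk : j ≠ k) :
    {i, j, k} ∈ T.triangles ↔ {i, j, k} ∈ T.faces :=
  ⟨fun h => h.1, fun h => ⟨h, Finset.card_eq_three.2 ⟨i, j, k, hij, hik, hjk, rfl⟩⟩⟩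

theorem face_of_subset {s t : Finset V} (ht : t ∈ T.faces) (hs : s ⊆ t) (h : s.Nonempty) :
    s ∈ T.faces :=
  (T.isRelLowerSet_faces ht).2 hs h

theorem pair_mem_faces {t : Finset V} (ht : t ∈ T.triangles) {i j : V} (hi : i ∈ t) (hj : j ∈ t) :
    {i, j} ∈ T.faces := by
  refine face_of_subset ht.1 ?_ ⟨i, by simp⟩
  intro x hx
  simp only [Finset.mem_insert, Finset.mem_singleton] at hx
  rcases hx with rfl | rfl <;> assumption

/-- The cone over the simplex on `t` without its vertices: the non-negative vectors supported on
`t` with at least two positive coordinates. -/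
def cone (t : Finset V) : Set (V → ℝ) :=
  {x | (∀ i, 0 ≤ x i) ∧ (∀ i, i ∉ t → x i = 0) ∧ ∃ i j, i ≠ j ∧ 0 < x i ∧ 0 < x j}

theorem mem_of_mem_cone {t : Finset V} {x : V → ℝ} (hx : x ∈ cone t) {i : V}
    (hi : 0 < x i) : i ∈ t := by
  by_contra h
  exact hi.ne' (hx.2.1 i h)

theorem mem_puncturedSimplex_iff {t : Finset V} {x : V → ℝ} :
    x ∈ puncturedSimplex t ↔ x ∈ cone t ∧ ∑ i ∈ t, x i = 1 := by
  constructor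
  · rintro ⟨⟨h0, h1, h2⟩, h3⟩
    refine ⟨⟨h0, h1, ?_⟩, h2⟩
    obtain ⟨i, hi, hxi⟩ := Finset.exists_ne_zero_of_sum_ne_zero (h2.trans_ne one_ne_zero)
    have hxi : 0 < x i := lt_of_le_of_ne (h0 i) hxi.symm
    by_contra! hno
    have hz : ∀ j, j ≠ i → x j = 0 := fun j hj =>
      le_antisymm (hno i j hj.symm hxi) (h0 j)
    refine h3 i (funext fun j => ?_)
    by_cases hj : j = i
    · subst hj
      rw [Finset.sum_eq_single j (fun k _ hk => hz k hk) (fun h => absurd hi h)] at h2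
      simp [vertex, h2]
    · simp [vertex, hj, hz j hj]
  · rintro ⟨⟨h0, h1, i, j, hij, hi, hj⟩, h2⟩
    refine ⟨⟨h0, h1, h2⟩, fun k hk => ?_⟩
    have hik : i = k := by
      by_contra h
      rw [hk] at hi
      simp [vertex, h] at hi
    have hjk : j = k := by
      by_contra h
      rw [hk] at hj
      simp [vertex, h] at hj
    exact hij (hik.trans hjk.symm)

theorem sum_pos_of_mem_cone {t : Finset V} {x : V → ℝ} (hx : x ∈ cone t) : 0 < ∑ i ∈ t, x i := by
  obtain ⟨i, j, -, hi, -⟩ := hx.2.2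
  exact Finset.sum_pos' (fun i _ => hx.1 i) ⟨i, mem_of_mem_cone hx hi, hi⟩

theorem smul_mem_cone {t : Finset V} {x : V → ℝ} (hx : x ∈ cone t) {c : ℝ} (hc : 0 < c) :
    c • x ∈ cone t := by
  obtain ⟨h0, h1, i, j, hij, hi, hj⟩ := hx
  exact ⟨fun k => mul_nonneg hc.le (h0 k), fun k hk => by simp [h1 k hk],
    i, j, hij, mul_pos hc hi, mul_pos hc hj⟩

theorem add_mem_cone {t : Finset V} {x y : V → ℝ} (hx : x ∈ cone t) (hy : y ∈ cone t) :
    x + y ∈ cone t := by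
  obtain ⟨h0, h1, i, j, hij, hi, hj⟩ := hx
  exact ⟨fun k => add_nonneg (h0 k) (hy.1 k), fun k hk => by simp [h1 k hk, hy.2.1 k hk],
    i, j, hij, add_pos_of_pos_of_nonneg hi (hy.1 i), add_pos_of_pos_of_nonneg hj (hy.1 j)⟩

/-- The radial projection of a finitely supported vector to the hyperplane on which the
coordinates sum to one. -/
def radialProj (x : V → ℝ) : V → ℝ := (∑ᶠ i, x i)⁻¹ • x

theorem finsum_eq_of_cone {t : Finset V} {x : V → ℝ} (h : ∀ i, i ∉ t → x i = 0) :
    ∑ᶠ i, x i = ∑ i ∈ t, x i :=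
  finsum_eq_sum_of_support_subset _ fun i hi => by_contra fun h' => hi (h i h')

theorem radialProj_mem {t : Finset V} {x : V → ℝ} (hx : x ∈ cone t) :
    radialProj x ∈ puncturedSimplex t := by
  have hs := sum_pos_of_mem_cone hx
  rw [radialProj, finsum_eq_of_cone hx.2.1, mem_puncturedSimplex_iff]
  refine ⟨smul_mem_cone hx (inv_pos.2 hs), ?_⟩
  simp only [Pi.smul_apply, smul_eq_mul, ← Finset.mul_sum]
  exact inv_mul_cancel₀ hs.ne'

theorem radialProj_eq_self {t : Finset V} {x : V → ℝ} (hx : x ∈ simplex t) :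
    radialProj x = x := by
  rw [radialProj, finsum_eq_of_cone hx.2.1, hx.2.2, inv_one, one_smul]

theorem radialProj_smul {c : ℝ} (hc : c ≠ 0) (x : V → ℝ) : radialProj (c • x) = radialProj x := by
  have : ∑ᶠ i, (c • x) i = c * ∑ᶠ i, x i := by
    rw [← smul_eq_mul, smul_finsum]
    rfl
  rw [radialProj, this, radialProj, smul_smul, mul_inv, mul_comm c⁻¹, mul_assoc,
    inv_mul_cancel₀ hc, mul_one]

theorem support_radialProj {t : Finset V} {x : V → ℝ} (hx : x ∈ cone t) :
    Function.support (radialProj x) = Function.support x := by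
  have hs := sum_pos_of_mem_cone hx
  rw [radialProj, finsum_eq_of_cone hx.2.1]
  ext i
  simp [hs.ne']

theorem mem_punctured_iff {x : V → ℝ} :
    x ∈ T.punctured ↔ ∃ t ∈ T.triangles, x ∈ puncturedSimplex t :=
  ⟨fun ⟨⟨t, ht, hx⟩, h⟩ => ⟨t, ht, hx, h⟩, fun ⟨t, ht, hx, h⟩ => ⟨⟨t, ht, hx⟩, h⟩⟩

theorem mem_punctured {x : V → ℝ} {t : Finset V} (ht : t ∈ T.triangles)
    (hx : x ∈ puncturedSimplex t) : x ∈ T.punctured := mem_punctured_iff.2 ⟨t, ht, hx⟩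

/-- A point of the punctured surface has two positive coordinates. -/
theorem exists_pos_of_mem_punctured {x : V → ℝ} (hx : x ∈ T.punctured) :
    ∃ i j, i ≠ j ∧ 0 < x i ∧ 0 < x j := by
  obtain ⟨t, -, hx⟩ := mem_punctured_iff.1 hx
  exact (mem_puncturedSimplex_iff.1 hx).1.2.2

/-- The closed star of a vertex, as a finite set of vertices. -/
def star (T : SurfaceTriangulation V) (i : V) : Finset V := (T.finite_link i).toFinset

@[simp] theorem mem_star {i j : V} : j ∈ T.star i ↔ {i, j} ∈ T.faces := by simp [star]

theorem subset_star {t : Finset V} (ht : t ∈ T.triangles) {i : V} (hi : i ∈ t) : t ⊆ T.star i :=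
  fun _ hj => mem_star.2 (pair_mem_faces ht hi hj)

/-- Near a point `x` of the surface there are only triangles that contain `x`. -/
theorem eventually_mem_simplex {x : V → ℝ} (hx : x ∈ T.space) :
    ∀ᶠ p in 𝓝 x, ∀ t : Finset V, p ∈ simplex t → x ∈ simplex t := by
  obtain ⟨s, hs, hx⟩ := hx
  have h : ∀ᶠ p : V → ℝ in 𝓝 x, ∀ i ∈ s, x i ≠ 0 → p i ≠ 0 := by
    rw [Filter.eventually_all_finset]
    intro i _
    by_cases h : x i = 0
    · simp [h]
    · filter_upwards [(continuous_apply i).continuousAt.eventually_ne h] with p hp _ using hp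
  filter_upwards [h] with p hp t hpt
  refine mem_simplex_of_support hx fun i hi => mem_of_mem_simplex hpt (hp i ?_ hi)
  exact mem_of_mem_simplex hx hi

end SurfaceTriangulation

namespace DiscreteMetric

open SurfaceTriangulation

variable {V : Type*} [DecidableEq V] {T : SurfaceTriangulation V} (l l' : DiscreteMetric T)

/-! ### The quadratic form of a triangle -/

/-- The squared length of the edge between `k` and `m`, or zero if these vertices coincide. -/
def sqLen (k m : V) : ℝ := if k = m then 0 else l.len s(k, m) ^ 2

theorem sqLen_comm (k m : V) : l.sqLen k m = l.sqLen m k := by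
  simp only [sqLen, eq_comm (a := k), Sym2.eq_swap (a := k)]

@[simp] theorem sqLen_self (k : V) : l.sqLen k k = 0 := by simp [sqLen]

theorem sqLen_nonneg (k m : V) : 0 ≤ l.sqLen k m := by
  rw [sqLen]; split_ifs <;> positivity

theorem sqLen_pos {k m : V} (h : T.IsEdge k m) : 0 < l.sqLen k m := by
  rw [sqLen, if_neg h.1]
  exact pow_pos (l.pos k m h) 2

theorem sqLen_pos_of_mem {t : Finset V} (ht : t ∈ T.triangles) {k m : V} (hk : k ∈ t) (hm : m ∈ t)
    (h : k ≠ m) : 0 < l.sqLen k m :=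
  l.sqLen_pos ⟨h, pair_mem_faces ht hk hm⟩

/-- The symmetric bilinear form, in homogeneous barycentric coordinates on the triangle `t`, whose
quadratic form is positive inside the circumcircle and vanishes on it. -/
def form (t : Finset V) (x y : V → ℝ) : ℝ :=
  (∑ k ∈ t, ∑ m ∈ t, x k * y m * l.sqLen k m) / 2

theorem form_comm (t : Finset V) (x y : V → ℝ) : l.form t x y = l.form t y x := by
  rw [form, form, Finset.sum_comm]
  congr 1
  refine Finset.sum_congr rfl fun k _ => Finset.sum_congr rfl fun m _ => ?_
  rw [l.sqLen_comm m k]; ring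

theorem form_add_left (t : Finset V) (x y z : V → ℝ) :
    l.form t (x + y) z = l.form t x z + l.form t y z := by
  simp only [form, Pi.add_apply, add_mul, Finset.sum_add_distrib, add_div]

theorem form_smul_left (t : Finset V) (c : ℝ) (x y : V → ℝ) :
    l.form t (c • x) y = c * l.form t x y := by
  simp only [form, Pi.smul_apply, smul_eq_mul, mul_assoc, ← Finset.mul_sum, mul_div_assoc]

theorem form_add_right (t : Finset V) (x y z : V → ℝ) :
    l.form t z (x + y) = l.form t z x + l.form t z y := by
  rw [form_comm, form_add_left, form_comm l t x, form_comm l t y]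

theorem form_smul_right (t : Finset V) (c : ℝ) (x y : V → ℝ) :
    l.form t x (c • y) = c * l.form t x y := by
  rw [form_comm, form_smul_left, form_comm]

theorem form_sub_left (t : Finset V) (x y z : V → ℝ) :
    l.form t (x - y) z = l.form t x z - l.form t y z := by
  have := l.form_add_left t (x - y) y z
  rw [sub_add_cancel] at this
  linarith

/-- The form of a triangle written out. -/
theorem form_triple {i j k : V} (hij : i ≠ j) (hik : i ≠ k) (hjk : j ≠ k) (x y : V → ℝ) :
    l.form {i, j, k} x y = ((x i * y j + x j * y i) * l.sqLen i j +
      (x i * y k + x k * y i) * l.sqLen i k + (x j * y k + x k * y j) * l.sqLen j k) / 2 := by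
  rw [form]
  simp only [Finset.sum_insert, Finset.mem_insert, Finset.mem_singleton, hij, hik, hjk, or_self,
    not_false_eq_true, Finset.sum_singleton, sqLen_self, l.sqLen_comm j i, l.sqLen_comm k i,
    l.sqLen_comm k j]
  ring

theorem form_pos {t : Finset V} (ht : t ∈ T.triangles) {x y : V → ℝ} (hx : x ∈ cone t)
    (hy : y ∈ cone t) : 0 < l.form t x y := by
  obtain ⟨i, j, hij, hi, hj⟩ := hx.2.2
  have hit := mem_of_mem_cone hx hi
  have hjt := mem_of_mem_cone hx hj
  obtain ⟨k, hik, hjk, rfl⟩ := exists_triangle_eq₂ ht hit hjt hij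
  have hij' := l.sqLen_pos_of_mem ht hit hjt hij
  have hik' := l.sqLen_pos_of_mem ht hit (by simp : k ∈ _) hik
  have hjk' := l.sqLen_pos_of_mem ht hjt (by simp : k ∈ _) hjk
  rw [l.form_triple hij hik hjk]
  have hxk := hx.1 k
  have hyi := hy.1 i
  have hyj := hy.1 j
  have hyk := hy.1 k
  obtain ⟨a, b, hab, ha, hb⟩ := hy.2.2
  have h1 : 0 ≤ x k * y i * l.sqLen i k := by positivity
  have h2 : 0 ≤ x i * y k * l.sqLen i k := by positivity
  have h3 : 0 ≤ x j * y k * l.sqLen j k := by positivity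
  have h4 : 0 ≤ x k * y j * l.sqLen j k := by positivity
  have h5 : 0 ≤ x i * y j * l.sqLen i j := by positivity
  have h6 : 0 ≤ x j * y i * l.sqLen i j := by positivity
  have : 0 < y i ∨ 0 < y j := by
    have hat := mem_of_mem_cone hy ha
    have hbt := mem_of_mem_cone hy hb
    simp only [Finset.mem_insert, Finset.mem_singleton] at hat hbt
    rcases hat with rfl | rfl | rfl <;> rcases hbt with rfl | rfl | rfl <;> tauto
  rcases this with h | h
  · have : 0 < x j * y i * l.sqLen i j := by positivity
    linarith
  · have : 0 < x i * y j * l.sqLen i j := by positivity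
    linarith

/-- The form of a triangle is nondegenerate: a vector that is orthogonal to all points of the cone
vanishes. -/
theorem eq_zero_of_form_eq_zero {t : Finset V} (ht : t ∈ T.triangles) {x : V → ℝ}
    (hx : ∀ i, i ∉ t → x i = 0) (h : ∀ y ∈ cone t, l.form t x y = 0) : x = 0 := by
  obtain ⟨i, j, k, hij, hik, hjk, rfl⟩ := Finset.card_eq_three.1 ht.2
  have hij' := l.sqLen_pos_of_mem ht (by simp : i ∈ _) (by simp : j ∈ _) hij
  have hik' := l.sqLen_pos_of_mem ht (by simp : i ∈ _) (by simp : k ∈ _) hik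
  have hjk' := l.sqLen_pos_of_mem ht (by simp : j ∈ _) (by simp : k ∈ _) hjk
  have key : ∀ a b c : ℝ, 0 ≤ a → 0 ≤ b → 0 ≤ c → 0 < a * b + b * c + a * c →
      (x i * b + x j * a) * l.sqLen i j + (x i * c + x k * a) * l.sqLen i k +
        (x j * c + x k * b) * l.sqLen j k = 0 := by
    intro a b c ha hb hc habc
    have hy : (Pi.single i a + Pi.single j b + Pi.single k c : V → ℝ) ∈ cone {i, j, k} := by
      refine ⟨fun m => ?_, fun m hm => ?_, ?_⟩
      · simp only [Pi.add_apply, Pi.single_apply]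
        split_ifs <;> positivity
      · simp only [Finset.mem_insert, Finset.mem_singleton, not_or] at hm
        simp [hm.1, hm.2.1, hm.2.2]
      · rcases ha.eq_or_lt with rfl | ha
        · refine ⟨j, k, hjk, ?_, ?_⟩
          · simp only [Pi.add_apply, Pi.single_apply, hij.symm, hjk, if_false, if_true]
            by_contra h0
            have : b = 0 := by linarith
            simp [this] at habc
          · simp only [Pi.add_apply, Pi.single_apply, hik.symm, hjk.symm, if_false, if_true]
            by_contra h0
            have : c = 0 := by linarith
            simp [this] at habc
        · rcases hb.eq_or_lt with rfl | hb
          · refine ⟨i, k, hik, ?_, ?_⟩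
            · simp [hik, ha]
            · simp only [Pi.add_apply, Pi.single_apply, hik.symm, hjk.symm, if_false, if_true]
              by_contra h0
              have : c = 0 := by linarith
              simp [this] at habc
          · refine ⟨i, j, hij, ?_, ?_⟩ <;> simp [hik, hjk, hij.symm, *]
    have := h _ hy
    rw [l.form_triple hij hik hjk] at this
    simp only [Pi.add_apply, Pi.single_apply, hij, hik, hjk, hij.symm, hik.symm, hjk.symm,
      if_false, if_true, add_zero, zero_add] at this
    linarith
  have h1 := key 1 1 0 (by norm_num) (by norm_num) le_rfl (by norm_num)
  have h2 := key 1 0 1 (by norm_num) le_rfl (by norm_num) (by norm_num)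
  have h3 := key 0 1 1 le_rfl (by norm_num) (by norm_num) (by norm_num)
  have e1 : x j * l.sqLen i j + x k * l.sqLen i k = 0 := by linarith
  have e2 : x i * l.sqLen i j + x k * l.sqLen j k = 0 := by linarith
  have e3 : x i * l.sqLen i k + x j * l.sqLen j k = 0 := by linarith
  have hi : x i = 0 := by
    have : x i * (2 * l.sqLen i j * l.sqLen i k) = 0 := by
      linear_combination l.sqLen i k * e2 + l.sqLen i j * e3 - l.sqLen j k * e1
    simpa [hij'.ne', hik'.ne'] using this
  have hk : x k = 0 := by simpa [hi, hjk'.ne'] using e2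
  have hj : x j = 0 := by simpa [hi, hjk'.ne'] using e3
  funext m
  by_cases hm : m ∈ ({i, j, k} : Finset V)
  · simp only [Finset.mem_insert, Finset.mem_singleton] at hm
    rcases hm with rfl | rfl | rfl <;> simpa
  · exact hx m hm

/-- The hyperbolic distance of two points of a triangle in homogeneous barycentric coordinates. -/
def formDist (t : Finset V) (x y : V → ℝ) : ℝ :=
  Real.arcosh (l.form t x y / (√(l.form t x x) * √(l.form t y y)))

theorem formDist_comm (t : Finset V) (x y : V → ℝ) : l.formDist t x y = l.formDist t y x := by
  rw [formDist, formDist, form_comm, mul_comm (√_)]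

theorem formDist_smul_left (t : Finset V) {c : ℝ} (hc : 0 < c) (x y : V → ℝ) :
    l.formDist t (c • x) y = l.formDist t x y := by
  rw [formDist, formDist]
  simp only [form_smul_left, form_smul_right]
  rw [← mul_assoc, Real.sqrt_mul (by positivity), Real.sqrt_mul_self hc.le, mul_assoc,
    mul_div_mul_left _ _ hc.ne']

theorem formDist_smul_right (t : Finset V) {c : ℝ} (hc : 0 < c) (x y : V → ℝ) :
    l.formDist t x (c • y) = l.formDist t x y := by
  rw [formDist_comm, formDist_smul_left _ _ hc, formDist_comm]

/-- The circumcircle in barycentric coordinates: polarising the power of a point with respect to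
the circumcircle gives the form of the triangle. -/
theorem form_eq_inner {t : Finset V} (ht : t ∈ T.triangles) (x y : V → ℝ) :
    l.form t x y = (l.placement ht).circ.radius ^ 2 * ((∑ i ∈ t, x i) * ∑ i ∈ t, y i) -
      inner ℝ (∑ i ∈ t, x i • ((l.placement ht).pt i - (l.placement ht).circ.center))
        (∑ i ∈ t, y i • ((l.placement ht).pt i - (l.placement ht).circ.center)) := by
  set P := l.placement ht
  have hL : ∀ k ∈ t, ∀ m ∈ t, l.sqLen k m = 2 * (P.circ.radius ^ 2 -
      inner ℝ (P.pt k - P.circ.center) (P.pt m - P.circ.center)) := by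
    intro k hk m hm
    have hk' : ‖P.pt k - P.circ.center‖ = P.circ.radius := by
      rw [← dist_eq_norm]; exact P.pt_mem k hk
    have hm' : ‖P.pt m - P.circ.center‖ = P.circ.radius := by
      rw [← dist_eq_norm]; exact P.pt_mem m hm
    have h := norm_sub_sq_real (P.pt k - P.circ.center) (P.pt m - P.circ.center)
    rw [sub_sub_sub_cancel_right, hk', hm', ← dist_eq_norm] at h
    by_cases hkm : k = m
    · subst hkm
      rw [sqLen_self, real_inner_self_eq_norm_sq, hk']; ring
    · rw [sqLen, if_neg hkm, ← P.dist_pt k hk m hm hkm, h]; ring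
  rw [form, Finset.sum_mul_sum, sum_inner, Finset.mul_sum, ← Finset.sum_sub_distrib, Finset.sum_div]
  refine Finset.sum_congr rfl fun k hk => ?_
  rw [inner_sum, Finset.mul_sum, ← Finset.sum_sub_distrib, Finset.sum_div]
  refine Finset.sum_congr rfl fun m hm => ?_
  rw [hL k hk m hm, real_inner_smul_left, real_inner_smul_right]
  ring

theorem point_sub_center {t : Finset V} (ht : t ∈ T.triangles) {x : V → ℝ} (hx : ∑ i ∈ t, x i = 1) :
    (l.placement ht).point x - (l.placement ht).circ.center =
      ∑ i ∈ t, x i • ((l.placement ht).pt i - (l.placement ht).circ.center) := by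
  simp only [smul_sub, Finset.sum_sub_distrib, ← Finset.sum_smul, hx, one_smul]
  rfl

theorem triangleDist_eq {t : Finset V} (ht : t ∈ T.triangles) {x y : V → ℝ} (hx : x ∈ simplex t)
    (hy : y ∈ simplex t) : l.triangleDist ht x y = l.formDist t x y := by
  rw [triangleDist, kleinDist, formDist, form_eq_inner l ht, form_eq_inner l ht, form_eq_inner l ht,
    point_sub_center l ht hx.2.2, point_sub_center l ht hy.2.2, hx.2.2, hy.2.2]
  simp only [real_inner_self_eq_norm_sq, mul_one]

end DiscreteMetric

/-! ### The hyperbolic plane as a space of positive definite binary forms -/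

/-- The point of the upper half-plane that represents the positive definite symmetric matrix with
diagonal entries `A`, `C` and off-diagonal entry `B`, up to scale. -/
def halfPlanePt (A B C : ℝ) : ℍ :=
  if h : 0 < C ∧ 0 < A * C - B ^ 2 then
    ⟨⟨B / C, √(A * C - B ^ 2) / C⟩, div_pos (Real.sqrt_pos.2 h.2) h.1⟩
  else UpperHalfPlane.I

section halfPlanePt

variable {A B C A' B' C' : ℝ}

theorem halfPlanePt_re (hC : 0 < C) (hD : 0 < A * C - B ^ 2) : (halfPlanePt A B C).re = B / C := by
  rw [halfPlanePt, dif_pos ⟨hC, hD⟩, UpperHalfPlane.mk_re]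

theorem halfPlanePt_im (hC : 0 < C) (hD : 0 < A * C - B ^ 2) :
    (halfPlanePt A B C).im = √(A * C - B ^ 2) / C := by
  rw [halfPlanePt, dif_pos ⟨hC, hD⟩, UpperHalfPlane.mk_im]

theorem cosh_dist_eq (z w : ℍ) : Real.cosh (dist z w) =
    ((z.re ^ 2 + z.im ^ 2) + (w.re ^ 2 + w.im ^ 2) - 2 * z.re * w.re) / (2 * z.im * w.im) := by
  have hz := z.im_pos
  have hw := w.im_pos
  rw [UpperHalfPlane.cosh_dist, Complex.dist_eq, ← Complex.normSq_eq_norm_sq, Complex.normSq_apply]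
  simp only [Complex.sub_re, Complex.sub_im, UpperHalfPlane.coe_re, UpperHalfPlane.coe_im]
  field_simp
  ring

theorem dist_halfPlanePt (hC : 0 < C) (hD : 0 < A * C - B ^ 2) (hC' : 0 < C')
    (hD' : 0 < A' * C' - B' ^ 2) : dist (halfPlanePt A B C) (halfPlanePt A' B' C') =
      Real.arcosh ((A * C' + A' * C - 2 * B * B') / 2 /
        (√(A * C - B ^ 2) * √(A' * C' - B' ^ 2))) := by
  rw [← Real.arcosh_cosh (dist_nonneg (x := halfPlanePt A B C)), cosh_dist_eq,
    halfPlanePt_re hC hD, halfPlanePt_im hC hD, halfPlanePt_re hC' hD', halfPlanePt_im hC' hD']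
  congr 1
  have h := Real.sqrt_pos.2 hD
  have h' := Real.sqrt_pos.2 hD'
  rw [div_pow, div_pow, div_pow, div_pow, Real.sq_sqrt hD.le, Real.sq_sqrt hD'.le]
  field_simp
  ring

theorem halfPlanePt_smul {c : ℝ} (hc : 0 < c) (hC : 0 < C) (hD : 0 < A * C - B ^ 2) :
    halfPlanePt (c * A) (c * B) (c * C) = halfPlanePt A B C := by
  have h : c * A * (c * C) - (c * B) ^ 2 = c ^ 2 * (A * C - B ^ 2) := by ring
  have hC' : 0 < c * C := mul_pos hc hC
  have hD' : 0 < c * A * (c * C) - (c * B) ^ 2 := by rw [h]; positivity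
  apply UpperHalfPlane.ext_re_im
  · rw [halfPlanePt_re hC' hD', halfPlanePt_re hC hD, mul_div_mul_left _ _ hc.ne']
  · rw [halfPlanePt_im hC' hD', halfPlanePt_im hC hD, h, Real.sqrt_mul (by positivity),
      Real.sqrt_sq hc.le, mul_div_mul_left _ _ hc.ne']

theorem halfPlanePt_of_point (z : ℍ) : halfPlanePt (z.re ^ 2 + z.im ^ 2) z.re 1 = z := by
  have h : (z.re ^ 2 + z.im ^ 2) * 1 - z.re ^ 2 = z.im ^ 2 := by ring
  have hz := z.im_pos
  have hD : 0 < (z.re ^ 2 + z.im ^ 2) * 1 - z.re ^ 2 := by rw [h]; positivity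
  apply UpperHalfPlane.ext_re_im
  · rw [halfPlanePt_re one_pos hD, div_one]
  · rw [halfPlanePt_im one_pos hD, h, Real.sqrt_sq hz.le, div_one]

theorem continuousAt_halfPlanePt {X : Type*} [TopologicalSpace X] {A B C : X → ℝ} {x : X}
    (hA : ContinuousAt A x) (hB : ContinuousAt B x) (hC : ContinuousAt C x) (h0 : 0 < C x)
    (hD : 0 < A x * C x - B x ^ 2) : ContinuousAt (fun p => halfPlanePt (A p) (B p) (C p)) x := by
  have hcD : ContinuousAt (fun p => A p * C p - B p ^ 2) x := (hA.mul hC).sub (hB.pow 2)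
  rw [ContinuousAt, UpperHalfPlane.isEmbedding_coe.isInducing.tendsto_nhds_iff]
  have h1 : Tendsto (fun p => (⟨B p / C p, √(A p * C p - B p ^ 2) / C p⟩ : ℂ)) (𝓝 x)
      (𝓝 ⟨B x / C x, √(A x * C x - B x ^ 2) / C x⟩) := by
    have e : ∀ p, (⟨B p / C p, √(A p * C p - B p ^ 2) / C p⟩ : ℂ) =
        ((B p / C p : ℝ) : ℂ) + ((√(A p * C p - B p ^ 2) / C p : ℝ) : ℂ) * Complex.I := by
      intro p
      rw [Complex.mk_eq_add_mul_I]
    simp only [e]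
    have c1 : ContinuousAt (fun p => B p / C p) x := hB.div hC h0.ne'
    have c2 : ContinuousAt (fun p => √(A p * C p - B p ^ 2) / C p) x := hcD.sqrt.div hC h0.ne'
    exact ((Complex.continuous_ofReal.continuousAt.comp c1).add
      ((Complex.continuous_ofReal.continuousAt.comp c2).mul continuousAt_const))
  have h2 : ∀ {p}, 0 < C p → 0 < A p * C p - B p ^ 2 →
      ((halfPlanePt (A p) (B p) (C p) : ℍ) : ℂ) = ⟨B p / C p, √(A p * C p - B p ^ 2) / C p⟩ := by
    intro p hp hp'
    rw [halfPlanePt, dif_pos ⟨hp, hp'⟩]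
  rw [h2 h0 hD]
  refine h1.congr' ?_
  filter_upwards [hC.eventually_const_lt h0, hcD.eventually_const_lt hD] with p hp hp'
  exact (h2 hp hp').symm

end halfPlanePt

/-- The reverse triangle inequality for a Lorentzian form is an equality on segments, expressed in
terms of the values `qa`, `qb`, `b` of the form on two vectors and on the pair of them: the
combination with coefficients `α`, `β` lies on the hyperbolic segment between the two points. -/
theorem arcosh_add_arcosh {qa qb b α β : ℝ} (ha : 0 < qa) (hb : 0 < qb) (h0 : 0 < b)
    (hab : qa * qb ≤ b ^ 2) (hα : 0 ≤ α) (hβ : 0 ≤ β) {q : ℝ}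
    (hq : q = α ^ 2 * qa + 2 * (α * β) * b + β ^ 2 * qb) (hq0 : 0 < q) :
    Real.arcosh ((α * qa + β * b) / (√qa * √q)) + Real.arcosh ((α * b + β * qb) / (√q * √qb)) =
      Real.arcosh (b / (√qa * √qb)) := by
  have sa := Real.sqrt_pos.2 ha
  have sb := Real.sqrt_pos.2 hb
  have sq := Real.sqrt_pos.2 hq0
  have ea := Real.sq_sqrt ha.le
  have eb := Real.sq_sqrt hb.le
  have eq := Real.sq_sqrt hq0.le
  have hS0 : 0 ≤ b ^ 2 - qa * qb := by linarith
  have eS := Real.sq_sqrt hS0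
  have sS := Real.sqrt_nonneg (b ^ 2 - qa * qb)
  set xa := √qa
  set xb := √qb
  set xq := √q
  set S := √(b ^ 2 - qa * qb)
  have x1 : 0 ≤ (α * qa + β * b) / (xa * xq) := by positivity
  have x2 : 0 ≤ (α * b + β * qb) / (xq * xb) := by positivity
  have x3 : 0 ≤ b / (xa * xb) := by positivity
  have d1 : ((α * qa + β * b) / (xa * xq)) ^ 2 - 1 = (β * S / (xa * xq)) ^ 2 := by
    rw [div_pow, div_pow, mul_pow, mul_pow, ea, eq, eS, eq_div_iff (by positivity), sub_mul,
      div_mul_cancel₀ _ (by positivity), hq]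
    ring
  have d2 : ((α * b + β * qb) / (xq * xb)) ^ 2 - 1 = (α * S / (xq * xb)) ^ 2 := by
    rw [div_pow, div_pow, mul_pow, mul_pow, eb, eq, eS, eq_div_iff (by positivity), sub_mul,
      div_mul_cancel₀ _ (by positivity), hq]
    ring
  have d3 : (b / (xa * xb)) ^ 2 - 1 = (S / (xa * xb)) ^ 2 := by
    rw [div_pow, div_pow, mul_pow, ea, eb, eS, eq_div_iff (by positivity), sub_mul,
      div_mul_cancel₀ _ (by positivity)]
    ring
  have o1 : 1 ≤ (α * qa + β * b) / (xa * xq) := by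
    rw [← one_le_sq_iff₀ x1, ← sub_nonneg, d1]; positivity
  have o2 : 1 ≤ (α * b + β * qb) / (xq * xb) := by
    rw [← one_le_sq_iff₀ x2, ← sub_nonneg, d2]; positivity
  have o3 : 1 ≤ b / (xa * xb) := by
    rw [← one_le_sq_iff₀ x3, ← sub_nonneg, d3]; positivity
  rw [← Real.arcosh_cosh (add_nonneg (Real.arcosh_nonneg o1) (Real.arcosh_nonneg o2)),
    Real.cosh_add, Real.cosh_arcosh o1, Real.cosh_arcosh o2, Real.sinh_arcosh o1,
    Real.sinh_arcosh o2, d1, d2, Real.sqrt_sq (by positivity), Real.sqrt_sq (by positivity)]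
  congr 1
  rw [div_mul_div_comm, div_mul_div_comm, ← add_div, div_eq_div_iff (by positivity) (by positivity)]
  have : xa * xq * (xq * xb) = q * (xa * xb) := by rw [← eq]; ring
  rw [this, hq]
  linear_combination (α * β * xa * xb) * eS

/-- A geodesic of the hyperbolic plane that joins two points on different sides of a vertical line
crosses this line. -/
theorem exists_dist_add_dist_of_re {z w : ℍ} {a : ℝ} (hz : z.re ≤ a) (hw : a ≤ w.re) :
    ∃ c : ℍ, c.re = a ∧ dist z c + dist c w = dist z w := by
  rcases hz.eq_or_lt with h | h
  · exact ⟨z, h, by simp⟩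
  have hzw : 0 < w.re - z.re := by linarith
  have hz0 := z.im_pos
  have hw0 := w.im_pos
  -- The matrix of the crossing point is the convex combination of the two normalised matrices.
  obtain ⟨τ, hτ⟩ : ∃ τ, τ = (a - z.re) / (w.re - z.re) := ⟨_, rfl⟩
  have hτ0 : 0 < τ := hτ ▸ div_pos (by linarith) hzw
  have hτ1 : 0 ≤ 1 - τ := by rw [sub_nonneg, hτ, div_le_one hzw]; linarith
  have ha : a = z.re + τ * (w.re - z.re) := by rw [hτ]; field_simp; ring
  obtain ⟨b, hb⟩ : ∃ b, b = (z.re ^ 2 + z.im ^ 2 + (w.re ^ 2 + w.im ^ 2) - 2 * z.re * w.re) / 2 :=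
    ⟨_, rfl⟩
  have hb' : b = (z.im ^ 2 + w.im ^ 2 + (w.re - z.re) ^ 2) / 2 := by rw [hb]; ring
  have hb0 : 0 < b := by rw [hb']; positivity
  obtain ⟨q, hq⟩ : ∃ q, q = (1 - τ) ^ 2 * z.im ^ 2 + 2 * ((1 - τ) * τ) * b + τ ^ 2 * w.im ^ 2 :=
    ⟨_, rfl⟩
  have hq0 : 0 < q := by
    rw [hq]
    have : 0 < τ ^ 2 * w.im ^ 2 := by positivity
    positivity
  have hab : z.im ^ 2 * w.im ^ 2 ≤ b ^ 2 := by
    rw [← mul_pow]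
    refine pow_le_pow_left₀ (by positivity) ?_ 2
    rw [hb']
    nlinarith [sq_nonneg (z.im - w.im), sq_nonneg (w.re - z.re)]
  have key := arcosh_add_arcosh (by positivity) (by positivity) hb0 hab hτ1 hτ0.le hq hq0
  have hs := Real.sqrt_pos.2 hq0
  have hsq := Real.sq_sqrt hq0.le
  rw [Real.sqrt_sq hz0.le, Real.sqrt_sq hw0.le] at key
  refine ⟨⟨⟨a, √q⟩, hs⟩, rfl, ?_⟩
  set c : ℍ := ⟨⟨a, √q⟩, hs⟩ with hc
  have hcre : c.re = a := rfl
  have hcim : c.im = √q := rfl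
  rw [← Real.arcosh_cosh (dist_nonneg (x := z) (y := c)),
    ← Real.arcosh_cosh (dist_nonneg (x := c) (y := w)),
    ← Real.arcosh_cosh (dist_nonneg (x := z) (y := w)), cosh_dist_eq, cosh_dist_eq, cosh_dist_eq,
    hcre, hcim, hsq]
  have e1 : (z.re ^ 2 + z.im ^ 2 + (a ^ 2 + q) - 2 * z.re * a) / (2 * z.im * √q) =
      ((1 - τ) * z.im ^ 2 + τ * b) / (z.im * √q) := by
    rw [mul_assoc 2, ← div_div, hq, hb', ha]; ring
  have e2 : (a ^ 2 + q + (w.re ^ 2 + w.im ^ 2) - 2 * a * w.re) / (2 * √q * w.im) =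
      ((1 - τ) * b + τ * w.im ^ 2) / (√q * w.im) := by
    rw [mul_assoc 2, ← div_div, hq, hb', ha]; ring
  have e3 : (z.re ^ 2 + z.im ^ 2 + (w.re ^ 2 + w.im ^ 2) - 2 * z.re * w.re) / (2 * z.im * w.im) =
      b / (z.im * w.im) := by
    rw [mul_assoc 2 z.im, ← div_div, hb]
  rw [e1, e2, e3, key]

namespace DiscreteMetric

open SurfaceTriangulation

variable {V : Type*} [DecidableEq V] {T : SurfaceTriangulation V} (l l' : DiscreteMetric T)

/-! ### Developing the star of a vertex -/

/-- The developing map of the star of the vertex `i` into the upper half-plane. It sends `i` to the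
point at infinity and every neighbour `k` of `i` to the boundary point `s k`: the point with
homogeneous barycentric coordinates `p` is represented by the sum of the matrices `p k • a_k a_kᵀ`,
where `a_i = (1, 0)` and `a_k = l_ik • (s k, 1)`. -/
def dev (i : V) (s : V → ℝ) (p : V → ℝ) : ℍ :=
  halfPlanePt (p i + ∑ k ∈ T.star i, p k * (l.sqLen i k * s k ^ 2))
    (∑ k ∈ T.star i, p k * (l.sqLen i k * s k)) (∑ k ∈ T.star i, p k * l.sqLen i k)

/-- The horocyclic length of the angle at `i` of the triangle `ijk`, squared. -/
def gapSq (i j k : V) : ℝ := l.sqLen j k / (l.sqLen i j * l.sqLen i k)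

theorem gapSq_comm (i j k : V) : l.gapSq i j k = l.gapSq i k j := by
  rw [gapSq, gapSq, l.sqLen_comm j k, mul_comm (l.sqLen i j)]

/-- The boundary points `s k` have the distances that make the developing map at `i` isometric on
the triangle `t`. -/
def Spread (i : V) (s : V → ℝ) (t : Finset V) : Prop :=
  ∀ j ∈ t, ∀ k ∈ t, i ≠ j → i ≠ k → j ≠ k → (s j - s k) ^ 2 = l.gapSq i j k

theorem sum_star {i j k : V} (hij : i ≠ j) (hik : i ≠ k) (hjk : j ≠ k)
    (ht : {i, j, k} ∈ T.triangles) {p : V → ℝ} (hp : ∀ m, m ∉ ({i, j, k} : Finset V) → p m = 0)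
    (f : V → ℝ) : ∑ m ∈ T.star i, p m * f m = p i * f i + p j * f j + p k * f k := by
  rw [← Finset.sum_subset (subset_star ht (by simp : i ∈ _))]
  · rw [Finset.sum_insert (by simp [hij, hik]), Finset.sum_pair hjk, add_assoc]
  · intro m _ hm
    rw [hp m hm, zero_mul]

variable {l}

theorem dev_triple {i j k : V} (hij : i ≠ j) (hik : i ≠ k) (hjk : j ≠ k)
    (ht : {i, j, k} ∈ T.triangles) {p : V → ℝ} (hp : ∀ m, m ∉ ({i, j, k} : Finset V) → p m = 0)
    (s : V → ℝ) : l.dev i s p = halfPlanePt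
      (p i + (p j * (l.sqLen i j * s j ^ 2) + p k * (l.sqLen i k * s k ^ 2)))
      (p j * (l.sqLen i j * s j) + p k * (l.sqLen i k * s k))
      (p j * l.sqLen i j + p k * l.sqLen i k) := by
  rw [dev, sum_star hij hik hjk ht hp, sum_star hij hik hjk ht hp, sum_star hij hik hjk ht hp]
  simp

theorem moment_pos {i j k : V} (hij : i ≠ j) (hik : i ≠ k)
    (ht : {i, j, k} ∈ T.triangles) {p : V → ℝ} (hp : p ∈ cone {i, j, k}) :
    0 < p j * l.sqLen i j + p k * l.sqLen i k := by
  have hij' := l.sqLen_pos_of_mem ht (by simp : i ∈ _) (by simp : j ∈ _) hij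
  have hik' := l.sqLen_pos_of_mem ht (by simp : i ∈ _) (by simp : k ∈ _) hik
  have hj := hp.1 j
  have hk := hp.1 k
  have h : 0 < p j ∨ 0 < p k := by
    obtain ⟨a, b, hab, ha, hb⟩ := hp.2.2
    have hat := mem_of_mem_cone hp ha
    have hbt := mem_of_mem_cone hp hb
    simp only [Finset.mem_insert, Finset.mem_singleton] at hat hbt
    rcases hat with rfl | rfl | rfl <;> rcases hbt with rfl | rfl | rfl <;> tauto
  rcases h with h | h <;> positivity

/-- The polarised determinant of the matrices of the developing map is the form of the triangle. -/
theorem moment_form {i j k : V} (hij : i ≠ j) (hik : i ≠ k) (hjk : j ≠ k)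
    (ht : {i, j, k} ∈ T.triangles) {s : V → ℝ} (hs : (s j - s k) ^ 2 = l.gapSq i j k)
    (p q : V → ℝ) :
    ((p i + (p j * (l.sqLen i j * s j ^ 2) + p k * (l.sqLen i k * s k ^ 2))) *
        (q j * l.sqLen i j + q k * l.sqLen i k) +
      (q i + (q j * (l.sqLen i j * s j ^ 2) + q k * (l.sqLen i k * s k ^ 2))) *
        (p j * l.sqLen i j + p k * l.sqLen i k) -
      2 * (p j * (l.sqLen i j * s j) + p k * (l.sqLen i k * s k)) *
        (q j * (l.sqLen i j * s j) + q k * (l.sqLen i k * s k))) / 2 =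
      l.form {i, j, k} p q := by
  have hij' := l.sqLen_pos_of_mem ht (by simp : i ∈ _) (by simp : j ∈ _) hij
  have hik' := l.sqLen_pos_of_mem ht (by simp : i ∈ _) (by simp : k ∈ _) hik
  rw [gapSq, eq_div_iff (by positivity)] at hs
  rw [l.form_triple hij hik hjk, ← hs]
  ring

theorem moment_det {i j k : V} (hij : i ≠ j) (hik : i ≠ k) (hjk : j ≠ k)
    (ht : {i, j, k} ∈ T.triangles) {s : V → ℝ} (hs : (s j - s k) ^ 2 = l.gapSq i j k)
    (p : V → ℝ) :
    (p i + (p j * (l.sqLen i j * s j ^ 2) + p k * (l.sqLen i k * s k ^ 2))) *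
        (p j * l.sqLen i j + p k * l.sqLen i k) -
      (p j * (l.sqLen i j * s j) + p k * (l.sqLen i k * s k)) ^ 2 =
      l.form {i, j, k} p p := by
  rw [← moment_form hij hik hjk ht hs]; ring

/-- The developing map is isometric on every triangle of the star. -/
theorem formDist_eq_dist_dev {t : Finset V} (ht : t ∈ T.triangles) {i : V} (hi : i ∈ t) {s : V → ℝ}
    (hs : l.Spread i s t) {p q : V → ℝ} (hp : p ∈ cone t) (hq : q ∈ cone t) :
    l.formDist t p q = dist (l.dev i s p) (l.dev i s q) := by
  obtain ⟨j, k, hij, hik, hjk, rfl⟩ := exists_triangle_eq ht hi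
  have hs := hs j (by simp) k (by simp) hij hik hjk
  rw [dev_triple hij hik hjk ht hp.2.1, dev_triple hij hik hjk ht hq.2.1,
    dist_halfPlanePt (moment_pos hij hik ht hp) ?_ (moment_pos hij hik ht hq),
    moment_det hij hik hjk ht hs, moment_det hij hik hjk ht hs, moment_form hij hik hjk ht hs,
    formDist]
  · rw [moment_det hij hik hjk ht hs]; exact l.form_pos ht hq hq
  · rw [moment_det hij hik hjk ht hs]; exact l.form_pos ht hp hp

theorem triangleDist_eq_dist_dev {t : Finset V} (ht : t ∈ T.triangles) {i : V} (hi : i ∈ t)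
    {s : V → ℝ} (hs : l.Spread i s t) {p q : V → ℝ} (hp : p ∈ puncturedSimplex t)
    (hq : q ∈ puncturedSimplex t) :
    l.triangleDist ht p q = dist (l.dev i s p) (l.dev i s q) := by
  rw [l.triangleDist_eq ht hp.1 hq.1, formDist_eq_dist_dev ht hi hs
    (mem_puncturedSimplex_iff.1 hp).1 (mem_puncturedSimplex_iff.1 hq).1]

theorem dev_smul {t : Finset V} (ht : t ∈ T.triangles) {i : V} (hi : i ∈ t) {s : V → ℝ}
    (hs : l.Spread i s t) {p : V → ℝ} (hp : p ∈ cone t) {c : ℝ} (hc : 0 < c) :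
    l.dev i s (c • p) = l.dev i s p := by
  obtain ⟨j, k, hij, hik, hjk, rfl⟩ := exists_triangle_eq ht hi
  have hs := hs j (by simp) k (by simp) hij hik hjk
  rw [dev_triple hij hik hjk ht hp.2.1, dev_triple hij hik hjk ht (smul_mem_cone hp hc).2.1,
    ← halfPlanePt_smul hc (moment_pos hij hik ht hp)]
  · simp only [Pi.smul_apply, smul_eq_mul]
    congr 1 <;> ring
  · rw [moment_det hij hik hjk ht hs]; exact l.form_pos ht hp hp

theorem continuousAt_dev {t : Finset V} (ht : t ∈ T.triangles) {i : V} (hi : i ∈ t)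
    {s : V → ℝ} (hs : l.Spread i s t) {p : V → ℝ} (hp : p ∈ cone t) :
    ContinuousAt (l.dev i s) p := by
  obtain ⟨j, k, hij, hik, hjk, rfl⟩ := exists_triangle_eq ht hi
  have hs := hs j (by simp) k (by simp) hij hik hjk
  unfold dev
  have hcont : ∀ f : V → ℝ, Continuous fun p : V → ℝ => ∑ k ∈ T.star i, p k * f k := fun f =>
    continuous_finsetSum _ fun k _ => (continuous_apply k).mul continuous_const
  apply continuousAt_halfPlanePt
  · exact ((continuous_apply i).add (hcont _)).continuousAt
  · exact (hcont _).continuousAt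
  · exact (hcont _).continuousAt
  · have := moment_pos (l := l) hij hik ht hp
    rw [sum_star hij hik hjk ht hp.2.1]
    simpa using this
  · rw [sum_star hij hik hjk ht hp.2.1, sum_star hij hik hjk ht hp.2.1,
      sum_star hij hik hjk ht hp.2.1]
    have := moment_det hij hik hjk ht hs p
    have h := l.form_pos ht hp hp
    rw [← this] at h
    simpa using h

/-- Boundary points that develop all triangles at the edge `ij` onto one triangle. -/
theorem exists_spread (l : DiscreteMetric T) {i j : V} (hij : i ≠ j) :
    ∃ s : V → ℝ, ∀ t ∈ T.triangles, i ∈ t → j ∈ t → l.Spread i s t := by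
  refine ⟨fun k => if k = j then 0 else √(l.gapSq i j k), fun t ht hi hj => ?_⟩
  obtain ⟨k, hik, hjk, rfl⟩ := exists_triangle_eq₂ ht hi hj hij
  have h0 : 0 ≤ l.gapSq i j k := div_nonneg (l.sqLen_nonneg _ _)
    (mul_nonneg (l.sqLen_nonneg _ _) (l.sqLen_nonneg _ _))
  intro a ha b hb hia hib hab
  simp only [Finset.mem_insert, Finset.mem_singleton] at ha hb
  rcases ha with rfl | rfl | rfl <;> rcases hb with rfl | rfl | rfl <;> try contradiction
  · simp [hjk.symm, Real.sq_sqrt h0]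
  · simp only [hjk.symm, if_true, if_false, sub_zero, Real.sq_sqrt h0]
    exact l.gapSq_comm _ _ _

theorem exists_spread_of_mem (l : DiscreteMetric T) {t : Finset V} (ht : t ∈ T.triangles) :
    ∃ i ∈ t, ∃ s : V → ℝ, l.Spread i s t := by
  obtain ⟨i, j, k, hij, -, -, rfl⟩ := Finset.card_eq_three.1 ht.2
  obtain ⟨s, hs⟩ := l.exists_spread hij
  exact ⟨i, by simp, s, hs _ ht (by simp) (by simp)⟩

theorem formDist_triangle {t : Finset V} (ht : t ∈ T.triangles) {p q r : V → ℝ} (hp : p ∈ cone t)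
    (hq : q ∈ cone t) (hr : r ∈ cone t) :
    l.formDist t p r ≤ l.formDist t p q + l.formDist t q r := by
  obtain ⟨i, hi, s, hs⟩ := l.exists_spread_of_mem ht
  rw [formDist_eq_dist_dev ht hi hs hp hr, formDist_eq_dist_dev ht hi hs hp hq,
    formDist_eq_dist_dev ht hi hs hq hr]
  exact dist_triangle _ _ _

theorem one_le_form_div {t : Finset V} (ht : t ∈ T.triangles) {p q : V → ℝ} (hp : p ∈ cone t)
    (hq : q ∈ cone t) : 1 ≤ l.form t p q / (√(l.form t p p) * √(l.form t q q)) := by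
  have hp' := l.form_pos ht hp hp
  have hq' := l.form_pos ht hq hq
  have hpq := l.form_pos ht hp hq
  obtain ⟨i, hi, s, hs⟩ := l.exists_spread_of_mem ht
  have h := formDist_eq_dist_dev ht hi hs hp hq
  rw [formDist] at h
  have h0 : 0 < l.form t p q / (√(l.form t p p) * √(l.form t q q)) := by positivity
  rw [← Real.arcosh_le_arcosh one_pos h0, Real.arcosh_zero, h]
  exact dist_nonneg

theorem cosh_formDist {t : Finset V} (ht : t ∈ T.triangles) {p q : V → ℝ} (hp : p ∈ cone t)
    (hq : q ∈ cone t) :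
    Real.cosh (l.formDist t p q) = l.form t p q / (√(l.form t p p) * √(l.form t q q)) :=
  Real.cosh_arcosh (one_le_form_div ht hp hq)

theorem formDist_nonneg {t : Finset V} (ht : t ∈ T.triangles) {p q : V → ℝ} (hp : p ∈ cone t)
    (hq : q ∈ cone t) : 0 ≤ l.formDist t p q :=
  Real.arcosh_nonneg (one_le_form_div ht hp hq)

theorem formDist_self {t : Finset V} (ht : t ∈ T.triangles) {p : V → ℝ} (hp : p ∈ cone t) :
    l.formDist t p p = 0 := by
  have hp' := l.form_pos ht hp hp
  rw [formDist, Real.mul_self_sqrt hp'.le, div_self hp'.ne', Real.arcosh_zero]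

/-- Straight segments are geodesics of the Klein model. -/
theorem formDist_add_formDist {t : Finset V} (ht : t ∈ T.triangles) {p q : V → ℝ} (hp : p ∈ cone t)
    (hq : q ∈ cone t) {α β : ℝ} (hα : 0 ≤ α) (hβ : 0 ≤ β) (hr : α • p + β • q ∈ cone t) :
    l.formDist t p (α • p + β • q) + l.formDist t (α • p + β • q) q = l.formDist t p q := by
  have hp' := l.form_pos ht hp hp
  have hq' := l.form_pos ht hq hq
  have hpq := l.form_pos ht hp hq
  have hr' := l.form_pos ht hr hr
  have e : l.form t (α • p + β • q) (α • p + β • q) =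
      α ^ 2 * l.form t p p + 2 * (α * β) * l.form t p q + β ^ 2 * l.form t q q := by
    simp only [form_add_left, form_add_right, form_smul_left, form_smul_right, l.form_comm t q p]
    ring
  have h1 := one_le_form_div (l := l) ht hp hq
  rw [one_le_div (by positivity), ← sq_le_sq₀ (by positivity) hpq.le, mul_pow,
    Real.sq_sqrt hp'.le, Real.sq_sqrt hq'.le] at h1
  have := arcosh_add_arcosh hp' hq' hpq h1 hα hβ e hr'
  rw [formDist, formDist, formDist, ← this]
  simp only [form_add_left, form_add_right, form_smul_left, form_smul_right]

/-! ### The inverse of the developing map -/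

variable (l)

/-- Homogeneous barycentric coordinates of the point of the triangle `ijk` that is developed to `z`
when `i`, `j`, `k` are developed to the ideal points `∞`, `a`, `b`. -/
def stripVec (i j k : V) (a b : ℝ) (z : ℍ) : V → ℝ :=
  Pi.single i ((z.re - a) * (z.re - b) + z.im ^ 2) +
    Pi.single j ((b - z.re) / (b - a) / l.sqLen i j) +
    Pi.single k ((z.re - a) / (b - a) / l.sqLen i k)

/-- The point of the triangle `ijk` that is developed to `z` when `i`, `j`, `k` are developed to the
ideal points `∞`, `a`, `b`. -/
def stripPt (i j k : V) (a b : ℝ) (z : ℍ) : V → ℝ := radialProj (l.stripVec i j k a b z)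

variable {l}

section strip

variable {i j k : V} {a b : ℝ} {z : ℍ}

theorem stripVec_apply_left (hij : i ≠ j) (hik : i ≠ k) :
    l.stripVec i j k a b z i = (z.re - a) * (z.re - b) + z.im ^ 2 := by
  simp [stripVec, hij, hik]

theorem stripVec_apply_mid (hij : i ≠ j) (hjk : j ≠ k) :
    l.stripVec i j k a b z j = (b - z.re) / (b - a) / l.sqLen i j := by
  simp [stripVec, hij.symm, hjk]

theorem stripVec_apply_right (hik : i ≠ k) (hjk : j ≠ k) :
    l.stripVec i j k a b z k = (z.re - a) / (b - a) / l.sqLen i k := by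
  simp [stripVec, hik.symm, hjk.symm]

theorem stripVec_apply_of_notMem {m : V} (hm : m ∉ ({i, j, k} : Finset V)) :
    l.stripVec i j k a b z m = 0 := by
  simp only [Finset.mem_insert, Finset.mem_singleton, not_or] at hm
  simp [stripVec, hm.1, hm.2.1, hm.2.2]

theorem stripVec_mem_cone (hij : i ≠ j) (hik : i ≠ k) (hjk : j ≠ k) (ht : {i, j, k} ∈ T.triangles)
    (hab : a < b) (ha : a ≤ z.re) (hb : z.re ≤ b) (hz : 0 < (z.re - a) * (z.re - b) + z.im ^ 2) :
    l.stripVec i j k a b z ∈ cone {i, j, k} := by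
  have hij' := l.sqLen_pos_of_mem ht (by simp : i ∈ _) (by simp : j ∈ _) hij
  have hik' := l.sqLen_pos_of_mem ht (by simp : i ∈ _) (by simp : k ∈ _) hik
  have hab' := sub_pos.2 hab
  have hi := stripVec_apply_left (l := l) (a := a) (b := b) (z := z) hij hik
  have hj := stripVec_apply_mid (l := l) (a := a) (b := b) (z := z) hij hjk
  have hk := stripVec_apply_right (l := l) (a := a) (b := b) (z := z) hik hjk
  have hj0 : 0 ≤ l.stripVec i j k a b z j := by
    rw [hj]; exact div_nonneg (div_nonneg (by linarith) hab'.le) hij'.le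
  have hk0 : 0 ≤ l.stripVec i j k a b z k := by
    rw [hk]; exact div_nonneg (div_nonneg (by linarith) hab'.le) hik'.le
  refine ⟨fun m => ?_, fun m hm => stripVec_apply_of_notMem hm, ?_⟩
  · by_cases hm : m ∈ ({i, j, k} : Finset V)
    · simp only [Finset.mem_insert, Finset.mem_singleton] at hm
      rcases hm with rfl | rfl | rfl
      · rw [hi]; exact hz.le
      · exact hj0
      · exact hk0
    · exact (stripVec_apply_of_notMem hm).ge
  · rcases hb.lt_or_eq with h | h
    · refine ⟨i, j, hij, hi ▸ hz, ?_⟩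
      rw [hj]; exact div_pos (div_pos (by linarith) hab') hij'
    · refine ⟨i, k, hik, hi ▸ hz, ?_⟩
      rw [hk]; exact div_pos (div_pos (by linarith) hab') hik'

theorem stripPt_mem (hij : i ≠ j) (hik : i ≠ k) (hjk : j ≠ k) (ht : {i, j, k} ∈ T.triangles)
    (hab : a < b) (ha : a ≤ z.re) (hb : z.re ≤ b) (hz : 0 < (z.re - a) * (z.re - b) + z.im ^ 2) :
    l.stripPt i j k a b z ∈ puncturedSimplex {i, j, k} :=
  radialProj_mem (stripVec_mem_cone hij hik hjk ht hab ha hb hz)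

theorem spread_triple {s : V → ℝ} (hs : (s j - s k) ^ 2 = l.gapSq i j k) :
    l.Spread i s {i, j, k} := by
  intro x hx y hy hix hiy hxy
  simp only [Finset.mem_insert, Finset.mem_singleton] at hx hy
  rcases hx with rfl | rfl | rfl <;> rcases hy with rfl | rfl | rfl <;> try contradiction
  · exact hs
  · rw [gapSq_comm, ← hs]; ring

theorem dev_stripPt (hij : i ≠ j) (hik : i ≠ k) (hjk : j ≠ k) (ht : {i, j, k} ∈ T.triangles)
    (hab : a < b) (ha : a ≤ z.re) (hb : z.re ≤ b) (hz : 0 < (z.re - a) * (z.re - b) + z.im ^ 2)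
    {s : V → ℝ} (hs : (s j - s k) ^ 2 = l.gapSq i j k) (hsj : s j = a) (hsk : s k = b) :
    l.dev i s (l.stripPt i j k a b z) = z := by
  have hc := stripVec_mem_cone (l := l) hij hik hjk ht hab ha hb hz
  have hsum := sum_pos_of_mem_cone hc
  have hij' := l.sqLen_pos_of_mem ht (by simp : i ∈ _) (by simp : j ∈ _) hij
  have hik' := l.sqLen_pos_of_mem ht (by simp : i ∈ _) (by simp : k ∈ _) hik
  have hab' := sub_pos.2 hab
  rw [stripPt, radialProj, finsum_eq_of_cone hc.2.1,
    dev_smul ht (by simp) (spread_triple hs) hc (inv_pos.2 hsum), dev_triple hij hik hjk ht hc.2.1,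
    stripVec_apply_left hij hik, stripVec_apply_mid hij hjk, stripVec_apply_right hik hjk, hsj, hsk]
  conv_rhs => rw [← halfPlanePt_of_point z]
  congr 1 <;> field_simp <;> ring

theorem stripVec_dev (hij : i ≠ j) (hik : i ≠ k) (hjk : j ≠ k) (ht : {i, j, k} ∈ T.triangles)
    {s : V → ℝ} (hab : s j ≠ s k) (hs : (s j - s k) ^ 2 = l.gapSq i j k) {p : V → ℝ}
    (hp : p ∈ puncturedSimplex {i, j, k}) :
    l.stripVec i j k (s j) (s k) (l.dev i s p) = (p j * l.sqLen i j + p k * l.sqLen i k)⁻¹ • p := by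
  have hc := (mem_puncturedSimplex_iff.1 hp).1
  have hC := moment_pos (l := l) hij hik ht hc
  have hD := l.form_pos ht hc hc
  rw [← moment_det hij hik hjk ht hs] at hD
  have hij' := l.sqLen_pos_of_mem ht (by simp : i ∈ _) (by simp : j ∈ _) hij
  have hik' := l.sqLen_pos_of_mem ht (by simp : i ∈ _) (by simp : k ∈ _) hik
  have hab' : s k - s j ≠ 0 := sub_ne_zero.2 hab.symm
  have hre := halfPlanePt_re hC hD
  have him := halfPlanePt_im hC hD
  rw [← dev_triple hij hik hjk ht hc.2.1] at hre him
  funext m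
  by_cases hm : m ∈ ({i, j, k} : Finset V)
  · simp only [Finset.mem_insert, Finset.mem_singleton] at hm
    rcases hm with rfl | rfl | rfl
    · rw [stripVec_apply_left hij hik, hre, him, div_pow, Real.sq_sqrt hD.le, Pi.smul_apply,
        smul_eq_mul]
      field_simp
      ring
    · rw [stripVec_apply_mid hij hjk, hre, Pi.smul_apply, smul_eq_mul]
      field_simp
      ring
    · rw [stripVec_apply_right hik hjk, hre, Pi.smul_apply, smul_eq_mul]
      field_simp
      ring
  · rw [stripVec_apply_of_notMem hm, Pi.smul_apply, hc.2.1 m hm, smul_zero]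

theorem stripPt_dev (hij : i ≠ j) (hik : i ≠ k) (hjk : j ≠ k) (ht : {i, j, k} ∈ T.triangles)
    {s : V → ℝ} (hab : s j ≠ s k) (hs : (s j - s k) ^ 2 = l.gapSq i j k) {p : V → ℝ}
    (hp : p ∈ puncturedSimplex {i, j, k}) :
    l.stripPt i j k (s j) (s k) (l.dev i s p) = p := by
  have hC := moment_pos (l := l) hij hik ht (mem_puncturedSimplex_iff.1 hp).1
  rw [stripPt, stripVec_dev hij hik hjk ht hab hs hp, radialProj_smul (inv_pos.2 hC).ne',
    radialProj_eq_self hp.1]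

/-- A triangle is developed into the region above the geodesic that joins the two finite ideal
points. -/
theorem dev_mem_strip (hij : i ≠ j) (hik : i ≠ k) (hjk : j ≠ k) (ht : {i, j, k} ∈ T.triangles)
    {s : V → ℝ} (hab : s j < s k) (hs : (s j - s k) ^ 2 = l.gapSq i j k) {p : V → ℝ}
    (hp : p ∈ puncturedSimplex {i, j, k}) :
    s j ≤ (l.dev i s p).re ∧ (l.dev i s p).re ≤ s k ∧ (0 < p i →
      0 < ((l.dev i s p).re - s j) * ((l.dev i s p).re - s k) + (l.dev i s p).im ^ 2) := by
  have hc := (mem_puncturedSimplex_iff.1 hp).1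
  have hC := moment_pos (l := l) hij hik ht hc
  have hD := l.form_pos ht hc hc
  rw [← moment_det hij hik hjk ht hs] at hD
  have hij' := l.sqLen_pos_of_mem ht (by simp : i ∈ _) (by simp : j ∈ _) hij
  have hik' := l.sqLen_pos_of_mem ht (by simp : i ∈ _) (by simp : k ∈ _) hik
  have hab' := sub_pos.2 hab
  have hre := halfPlanePt_re hC hD
  have him := halfPlanePt_im hC hD
  rw [← dev_triple hij hik hjk ht hc.2.1] at hre him
  have hj := hc.1 j
  have hk := hc.1 k
  refine ⟨?_, ?_, fun hi => ?_⟩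
  · rw [hre, le_div_iff₀ hC]
    have : 0 ≤ p k * l.sqLen i k * (s k - s j) := by positivity
    nlinarith
  · rw [hre, div_le_iff₀ hC]
    have : 0 ≤ p j * l.sqLen i j * (s k - s j) := by positivity
    nlinarith
  · have : ((l.dev i s p).re - s j) * ((l.dev i s p).re - s k) + (l.dev i s p).im ^ 2 =
        p i / (p j * l.sqLen i j + p k * l.sqLen i k) := by
      rw [hre, him, div_pow, Real.sq_sqrt hD.le]
      field_simp
      ring
    rw [this]
    positivity

/-- The parametrisation of a triangle by the upper half-plane is continuous. -/
theorem continuousAt_stripPt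
    (hz : l.stripVec i j k a b z ∈ cone {i, j, k}) :
    ContinuousAt (l.stripPt i j k a b) z := by
  have hcont : Continuous (l.stripVec i j k a b) := by
    have hre := UpperHalfPlane.continuous_re
    have him := UpperHalfPlane.continuous_im
    unfold stripVec
    refine continuous_pi fun m => ?_
    simp only [Pi.add_apply, Pi.single_apply]
    refine (Continuous.add ?_ ?_).add ?_ <;> split_ifs <;> fun_prop
  have e : l.stripPt i j k a b = fun w =>
      (∑ m ∈ ({i, j, k} : Finset V), l.stripVec i j k a b w m)⁻¹ • l.stripVec i j k a b w := by
    funext w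
    rw [stripPt, radialProj, finsum_eq_of_cone fun m hm => stripVec_apply_of_notMem hm]
  rw [e]
  refine continuousAt_pi.2 fun m => ContinuousAt.mul
    (ContinuousAt.inv₀ ?_ (sum_pos_of_mem_cone hz).ne') ((continuous_apply m).comp hcont).continuousAt
  exact (continuous_finsetSum _ fun m _ => (continuous_apply m).comp hcont).continuousAt

end strip

end DiscreteMetric

/-! ### Chains and the glued distance -/

theorem SimpleGraph.Connected.induction_on {α : Type*} {G : SimpleGraph α} (hG : G.Connected)
    {P : α → Prop} (h : ∀ a b, G.Adj a b → P a → P b) {a : α} (ha : P a) (b : α) : P b := by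
  obtain ⟨w⟩ := hG.preconnected a b
  induction w with
  | nil => exact ha
  | cons hadj _ ih => exact ih (h _ _ hadj ha)

namespace DiscreteMetric

open SurfaceTriangulation

variable {V : Type*} [DecidableEq V] {T : SurfaceTriangulation V} {l l' : DiscreteMetric T}

theorem triangleDist_comm (l : DiscreteMetric T) {t : Finset V} (ht : t ∈ T.triangles)
    {x y : V → ℝ} (hx : x ∈ puncturedSimplex t) (hy : y ∈ puncturedSimplex t) :
    l.triangleDist ht x y = l.triangleDist ht y x := by
  rw [l.triangleDist_eq ht hx.1 hy.1, l.triangleDist_eq ht hy.1 hx.1, formDist_comm]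

theorem triangleDist_nonneg {t : Finset V} (ht : t ∈ T.triangles)
    {x y : V → ℝ} (hx : x ∈ puncturedSimplex t) (hy : y ∈ puncturedSimplex t) :
    0 ≤ l.triangleDist ht x y := by
  rw [l.triangleDist_eq ht hx.1 hy.1]
  exact formDist_nonneg ht (mem_puncturedSimplex_iff.1 hx).1 (mem_puncturedSimplex_iff.1 hy).1

theorem triangleDist_self {t : Finset V} (ht : t ∈ T.triangles)
    {x : V → ℝ} (hx : x ∈ puncturedSimplex t) : l.triangleDist ht x x = 0 := by
  rw [l.triangleDist_eq ht hx.1 hx.1]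
  exact formDist_self ht (mem_puncturedSimplex_iff.1 hx).1

/-- There is a chain of length `L` from `x` to `y`. -/
inductive Chain (l : DiscreteMetric T) : (V → ℝ) → (V → ℝ) → ℝ → Prop
  | nil (x : V → ℝ) : Chain l x x 0
  | snoc {x y z : V → ℝ} {L : ℝ} {t : Finset V} (ht : t ∈ T.triangles) (h : Chain l x y L)
      (hy : y ∈ puncturedSimplex t) (hz : z ∈ puncturedSimplex t) :
      Chain l x z (L + l.triangleDist ht y z)

namespace Chain

variable {x y z : V → ℝ} {L L' : ℝ}

theorem single {t : Finset V} (ht : t ∈ T.triangles) (hx : x ∈ puncturedSimplex t)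
    (hy : y ∈ puncturedSimplex t) : l.Chain x y (l.triangleDist ht x y) := by
  simpa using (nil (l := l) x).snoc ht hx hy

theorem trans (h : l.Chain x y L) (h' : l.Chain y z L') : l.Chain x z (L + L') := by
  induction h' with
  | nil => simpa using h
  | snoc ht _ hy hz ih => rw [← add_assoc]; exact ih.snoc ht hy hz

theorem symm (h : l.Chain x y L) : l.Chain y x L := by
  induction h with
  | nil => exact nil _
  | snoc ht _ hy hz ih =>
    rw [add_comm, l.triangleDist_comm ht hy hz]
    exact (single ht hz hy).trans ih

theorem nonneg (h : l.Chain x y L) : 0 ≤ L := by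
  induction h with
  | nil => exact le_rfl
  | snoc ht _ hy hz ih => exact add_nonneg ih (triangleDist_nonneg ht hy hz)

/-- A function that is `1`-Lipschitz on every triangle increases along a chain at most by the length
of the chain. -/
theorem sub_le {f : (V → ℝ) → ℝ} (hf : ∀ (t : Finset V) (ht : t ∈ T.triangles),
    ∀ p ∈ puncturedSimplex t, ∀ q ∈ puncturedSimplex t, f q - f p ≤ l.triangleDist ht p q)
    (h : l.Chain x y L) : f y - f x ≤ L := by
  induction h with
  | nil => simp
  | snoc ht _ hy hz ih => linarith [hf _ ht _ hy _ hz]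

end Chain

theorem _root_.SurfaceTriangulation.triangles_nonempty (T : SurfaceTriangulation V) :
    T.triangles.Nonempty := by
  obtain ⟨i⟩ := T.connected.nonempty
  obtain ⟨t, ht, h, -⟩ := T.pure _ (T.singleton_mem i)
  exact ⟨t, ht, h⟩

theorem chain_iff {x y : V → ℝ} {L : ℝ} : l.Chain x y L ↔
    ∃ (n : ℕ) (p : ℕ → V → ℝ) (τ : ℕ → T.triangles), p 0 = x ∧ p n = y ∧
      (∀ m < n, p m ∈ puncturedSimplex (τ m).1 ∧ p (m + 1) ∈ puncturedSimplex (τ m).1) ∧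
      L = ∑ m ∈ Finset.range n, l.triangleDist (τ m).2 (p m) (p (m + 1)) := by
  constructor
  · intro h
    induction h with
    | nil =>
      obtain ⟨t, ht⟩ := T.triangles_nonempty
      exact ⟨0, fun _ => x, fun _ => ⟨t, ht⟩, rfl, rfl, by simp, by simp⟩
    | @snoc y z L t ht _ hy hz ih =>
      obtain ⟨n, p, τ, h0, hn, hp, hL⟩ := ih
      refine ⟨n + 1, fun m => if m ≤ n then p m else z, fun m => if m < n then τ m else ⟨t, ht⟩,
        by simpa using h0, by simp, fun m hm => ?_, ?_⟩
      · rcases (Nat.lt_succ_iff.1 hm).lt_or_eq with h | h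
        · simpa [h, h.le, Nat.succ_le_of_lt h] using hp m h
        · subst h
          simpa [hn] using ⟨hy, hz⟩
      · rw [Finset.sum_range_succ, hL]
        congr 1
        · refine Finset.sum_congr rfl fun m hm => ?_
          have h := Finset.mem_range.1 hm
          simp only [h, h.le, Nat.succ_le_of_lt h, if_true]
        · simp [hn]
  · rintro ⟨n, p, τ, rfl, rfl, hp, rfl⟩
    induction n with
    | zero => simpa using Chain.nil (l := l) (p 0)
    | succ n ih =>
      rw [Finset.sum_range_succ]
      exact (ih fun m hm => hp m (hm.trans n.lt_succ_self)).snoc _ (hp n n.lt_succ_self).1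
        (hp n n.lt_succ_self).2

theorem hypDist_eq_sInf (x y : V → ℝ) : l.hypDist x y = sInf {L | l.Chain x y L} := by
  rw [hypDist]
  congr 1
  ext L
  exact chain_iff.symm

theorem bddBelow_chain (x y : V → ℝ) : BddBelow {L | l.Chain x y L} :=
  ⟨0, fun _ h => Chain.nonneg h⟩

theorem hypDist_le_of_chain {x y : V → ℝ} {L : ℝ} (h : l.Chain x y L) : l.hypDist x y ≤ L := by
  rw [hypDist_eq_sInf]
  exact csInf_le (bddBelow_chain x y) h

theorem hypDist_le_triangleDist {t : Finset V} (ht : t ∈ T.triangles) {x y : V → ℝ}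
    (hx : x ∈ puncturedSimplex t) (hy : y ∈ puncturedSimplex t) :
    l.hypDist x y ≤ l.triangleDist ht x y :=
  hypDist_le_of_chain (Chain.single ht hx hy)

/-- The midpoint of an edge. -/
def midpt (i j : V) : V → ℝ := Pi.single i (1 / 2) + Pi.single j (1 / 2)

theorem midpt_mem {t : Finset V} {i j : V} (hi : i ∈ t) (hj : j ∈ t) (hij : i ≠ j) :
    midpt i j ∈ puncturedSimplex t := by
  rw [mem_puncturedSimplex_iff]
  refine ⟨⟨fun k => ?_, fun k hk => ?_, i, j, hij, ?_, ?_⟩, ?_⟩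
  · simp only [midpt, Pi.add_apply, Pi.single_apply]
    split_ifs <;> positivity
  · have h1 : k ≠ i := by rintro rfl; exact hk hi
    have h2 : k ≠ j := by rintro rfl; exact hk hj
    simp [midpt, h1, h2]
  · simp [midpt, hij]
  · simp [midpt, hij.symm]
  · simp only [midpt, Pi.add_apply, Finset.sum_add_distrib, Pi.single_apply, Finset.sum_ite_eq',
      hi, hj, if_true]
    norm_num

variable (l) in
/-- The punctured surface is connected by chains, since the surface and all links are connected. -/
theorem exists_chain {x y : V → ℝ} (hx : x ∈ T.punctured) (hy : y ∈ T.punctured) :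
    ∃ L, l.Chain x y L := by
  have link : ∀ i j k, T.IsEdge i j → T.IsEdge i k → ∃ L, l.Chain (midpt i j) (midpt i k) L := by
    intro i j k hj hk
    refine SimpleGraph.Connected.induction_on (T.connected_link i)
      (P := fun a => ∃ L, l.Chain (midpt i j) (midpt i a.1) L) ?_ (a := ⟨j, hj.1.symm, hj.2⟩)
      ⟨0, Chain.nil _⟩ ⟨k, hk.1.symm, hk.2⟩
    rintro ⟨a, ha, ha'⟩ ⟨b, hb, hb'⟩ ⟨hab, hf⟩ ⟨L, hL⟩
    have hab : a ≠ b := fun h => hab (Subtype.ext h)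
    have ht := (triple_mem_triangles ha.symm hb.symm hab).2 hf
    exact ⟨_, hL.snoc ht (midpt_mem (by simp) (by simp) ha.symm)
      (midpt_mem (by simp) (by simp) hb.symm)⟩
  have edges : ∀ i j, T.IsEdge i j → ∀ a b, T.IsEdge a b →
      ∃ L, l.Chain (midpt i j) (midpt a b) L := by
    intro i j hij a
    refine SimpleGraph.Connected.induction_on T.connected
      (P := fun a => ∀ b, T.IsEdge a b → ∃ L, l.Chain (midpt i j) (midpt a b) L) ?_
      (fun b hb => link i j b hij hb) a
    intro a b hab ih c hc
    obtain ⟨L, hL⟩ := ih b hab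
    obtain ⟨L', hL'⟩ := link b a c ⟨hab.1.symm, by rw [Finset.pair_comm]; exact hab.2⟩ hc
    refine ⟨_, hL.trans (?_ : l.Chain (midpt a b) _ L')⟩
    rwa [show midpt a b = midpt b a from add_comm _ _]
  have point : ∀ x ∈ T.punctured, ∃ i j L, T.IsEdge i j ∧ l.Chain x (midpt i j) L := by
    intro x hx
    obtain ⟨t, ht, hx⟩ := mem_punctured_iff.1 hx
    obtain ⟨i, j, k, hij, -, -, rfl⟩ := Finset.card_eq_three.1 ht.2
    exact ⟨i, j, _, ⟨hij, pair_mem_faces ht (by simp) (by simp)⟩,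
      Chain.single ht hx (midpt_mem (by simp) (by simp) hij)⟩
  obtain ⟨i, j, L, hij, hL⟩ := point x hx
  obtain ⟨a, b, L', hab, hL'⟩ := point y hy
  obtain ⟨L'', hL''⟩ := edges i j hij a b hab
  exact ⟨_, (hL.trans hL'').trans hL'.symm⟩

theorem sub_le_hypDist {f : (V → ℝ) → ℝ} (hf : ∀ (t : Finset V) (ht : t ∈ T.triangles),
    ∀ p ∈ puncturedSimplex t, ∀ q ∈ puncturedSimplex t, f q - f p ≤ l.triangleDist ht p q)
    {x y : V → ℝ} (hx : x ∈ T.punctured) (hy : y ∈ T.punctured) : f y - f x ≤ l.hypDist x y := by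
  rw [hypDist_eq_sInf]
  exact le_csInf (l.exists_chain hx hy) fun L hL => hL.sub_le hf

theorem hypDist_nonneg (x y : V → ℝ) : 0 ≤ l.hypDist x y := by
  rw [hypDist_eq_sInf]
  exact Real.sInf_nonneg fun L hL => Chain.nonneg hL

theorem hypDist_self (x : V → ℝ) : l.hypDist x x = 0 :=
  le_antisymm (hypDist_le_of_chain (Chain.nil x)) (hypDist_nonneg x x)

theorem hypDist_comm (x y : V → ℝ) : l.hypDist x y = l.hypDist y x := by
  rw [hypDist_eq_sInf, hypDist_eq_sInf]
  congr 1
  ext L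
  exact ⟨Chain.symm, Chain.symm⟩

theorem hypDist_triangle {x y z : V → ℝ} (hx : x ∈ T.punctured) (hy : y ∈ T.punctured)
    (hz : z ∈ T.punctured) : l.hypDist x z ≤ l.hypDist x y + l.hypDist y z := by
  rw [hypDist_eq_sInf y z, ← sub_le_iff_le_add']
  refine le_csInf (l.exists_chain hy hz) fun L hL => ?_
  rw [sub_le_iff_le_add', ← sub_le_iff_le_add, hypDist_eq_sInf x y]
  refine le_csInf (l.exists_chain hx hy) fun L' hL' => ?_
  linarith [hypDist_le_of_chain (hL'.trans hL)]

/-! ### The glued distance near a point -/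

/-- The points of a triangle at which some barycentric coordinate vanishes stay away from every
point at which it does not. -/
theorem exists_le_formDist {t : Finset V} (ht : t ∈ T.triangles) {x : V → ℝ} (hx : x ∈ cone t)
    {i : V} (hi : 0 < x i) :
    ∃ ρ > 0, ∀ q ∈ cone t, q i = 0 → ρ ≤ l.formDist t x q := by
  obtain ⟨j, k, hij, hik, hjk, rfl⟩ := exists_triangle_eq ht (mem_of_mem_cone hx hi)
  have hij' := l.sqLen_pos_of_mem ht (by simp : i ∈ _) (by simp : j ∈ _) hij
  have hik' := l.sqLen_pos_of_mem ht (by simp : i ∈ _) (by simp : k ∈ _) hik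
  have hjk' := l.sqLen_pos_of_mem ht (by simp : j ∈ _) (by simp : k ∈ _) hjk
  have hQ := l.form_pos ht hx hx
  obtain ⟨κ, hκ⟩ : ∃ κ, κ = x i ^ 2 * l.sqLen i j * l.sqLen i k /
    (l.sqLen j k * l.form {i, j, k} x x) := ⟨_, rfl⟩
  have hκ0 : 0 < κ := by rw [hκ]; positivity
  have h1 : 1 < √(1 + κ) := by rw [Real.lt_sqrt] <;> linarith
  refine ⟨Real.arcosh √(1 + κ), Real.arcosh_pos h1, fun q hq hqi => ?_⟩
  have hq0 := l.form_pos ht hq hq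
  have hxq := l.form_pos ht hx hq
  rw [formDist, Real.arcosh_le_arcosh (by linarith) (by positivity)]
  refine Real.sqrt_le_iff.2 ⟨by positivity, ?_⟩
  rw [div_pow, mul_pow, Real.sq_sqrt hQ.le, Real.sq_sqrt hq0.le, le_div_iff₀ (by positivity)]
  have eκ : κ * (l.sqLen j k * l.form {i, j, k} x x) = x i ^ 2 * l.sqLen i j * l.sqLen i k := by
    rw [hκ]; field_simp
  have e1 : l.form {i, j, k} q q = q j * q k * l.sqLen j k := by
    rw [l.form_triple hij hik hjk, hqi]; ring
  have e2 : l.form {i, j, k} x q = (q j * (x i * l.sqLen i j + x k * l.sqLen j k) +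
      q k * (x i * l.sqLen i k + x j * l.sqLen j k)) / 2 := by
    rw [l.form_triple hij hik hjk, hqi]; ring
  have e3 : (1 + κ) * (l.form {i, j, k} x x * (q j * q k * l.sqLen j k)) =
      q j * q k * ((x i * l.sqLen i j + x k * l.sqLen j k) *
        (x i * l.sqLen i k + x j * l.sqLen j k)) := by
    have : (1 + κ) * (l.form {i, j, k} x x * (q j * q k * l.sqLen j k)) =
      q j * q k * (l.form {i, j, k} x x * l.sqLen j k +
        κ * (l.sqLen j k * l.form {i, j, k} x x)) := by ring
    rw [this, eκ, l.form_triple hij hik hjk]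
    ring
  rw [e1, e2, e3]
  -- This is the inequality between the geometric and the arithmetic mean.
  linarith [sq_nonneg ((q j * (x i * l.sqLen i j + x k * l.sqLen j k) -
      q k * (x i * l.sqLen i k + x j * l.sqLen j k)) / 2)]

/-- The point `p` lies in a triangle that contains `x`. -/
def InStar (T : SurfaceTriangulation V) (x p : V → ℝ) : Prop :=
  ∃ t ∈ T.triangles, x ∈ simplex t ∧ p ∈ puncturedSimplex t

variable (l) in
/-- A point has a positive distance from all sides that do not contain it of the finitely many triangles
around it. -/
theorem exists_le_triangleDist {x : V → ℝ} (hx : x ∈ T.punctured) :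
    ∃ ρ > 0, ∀ (t : Finset V) (ht : t ∈ T.triangles), x ∈ simplex t → ∀ q ∈ puncturedSimplex t,
      (∃ i, 0 < x i ∧ q i = 0) → ρ ≤ l.triangleDist ht x q := by
  obtain ⟨a, -, -, ha, -⟩ := exists_pos_of_mem_punctured hx
  have h : ∀ᶠ ρ : ℝ in 𝓝[>] 0, ∀ t ∈ (T.star a).powerset, ∀ i ∈ T.star a,
      ∀ (ht : t ∈ T.triangles), x ∈ simplex t → ∀ q ∈ puncturedSimplex t,
        0 < x i → q i = 0 → ρ ≤ l.triangleDist ht x q := by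
    rw [Filter.eventually_all_finset]
    intro t _
    rw [Filter.eventually_all_finset]
    intro i _
    by_cases h : t ∈ T.triangles ∧ x ∈ simplex t ∧ 0 < x i
    · obtain ⟨ht, hxt, hi⟩ := h
      have hxp : x ∈ puncturedSimplex t := ⟨hxt, hx.2⟩
      obtain ⟨ρ, hρ, hq⟩ := exists_le_formDist (l := l) ht (mem_puncturedSimplex_iff.1 hxp).1 hi
      filter_upwards [Ioc_mem_nhdsGT hρ] with ρ' hρ' _ _ q hqt _ hqi
      rw [l.triangleDist_eq ht hxt hqt.1]
      exact hρ'.2.trans (hq q (mem_puncturedSimplex_iff.1 hqt).1 hqi)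
    · exact Eventually.of_forall fun ρ ht hxt _ _ hi => absurd ⟨ht, hxt, hi⟩ h
  obtain ⟨ρ, hρ, hρ0⟩ := (h.and self_mem_nhdsWithin).exists
  refine ⟨ρ, hρ0, fun t ht hxt q hq ⟨i, hi, hqi⟩ => ?_⟩
  have hsub := subset_star ht (mem_of_mem_simplex hxt ha.ne')
  exact hρ t (Finset.mem_powerset.2 hsub) i (hsub (mem_of_mem_simplex hxt hi.ne')) ht hxt q hq hi hqi

/-- Near `x`, developing the star of `x` does not increase distances. The developed distance,
truncated at a small height and extended by a constant outside of the star of `x`, is a function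
that is `1`-Lipschitz on every triangle. -/
theorem exists_dist_dev_le {x : V → ℝ} (hx : x ∈ T.punctured) {i : V} (hi : 0 < x i) {s : V → ℝ}
    (hs : ∀ t ∈ T.triangles, x ∈ simplex t → l.Spread i s t) :
    ∃ ρ > 0, ∀ p, InStar T x p → dist (l.dev i s p) (l.dev i s x) < ρ →
      (∀ q, InStar T x q → min ρ (dist (l.dev i s p) (l.dev i s q)) ≤ l.hypDist p q) ∧
      (∀ q ∈ T.punctured, ¬ InStar T x q → ρ ≤ l.hypDist p q) := by
  obtain ⟨ρ, hρ, hgap⟩ := l.exists_le_triangleDist hx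
  refine ⟨ρ / 2, half_pos hρ, fun p hp hpx => ?_⟩
  classical
  obtain ⟨f, hf⟩ : ∃ f : (V → ℝ) → ℝ, ∀ q, f q = if InStar T x q then
    min (ρ / 2) (dist (l.dev i s p) (l.dev i s q)) else ρ / 2 := ⟨_, fun _ => rfl⟩
  have hp' : p ∈ T.punctured := by
    obtain ⟨t, ht, -, hp⟩ := hp
    exact mem_punctured ht hp
  have hfp : f p = 0 := by rw [hf, if_pos hp, dist_self, min_eq_right (half_pos hρ).le]
  have hlip : ∀ (t : Finset V) (ht : t ∈ T.triangles),
      ∀ a ∈ puncturedSimplex t, ∀ b ∈ puncturedSimplex t, f b - f a ≤ l.triangleDist ht a b := by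
    intro t ht a ha b hb
    by_cases hxt : x ∈ simplex t
    · have hit := mem_of_mem_simplex hxt hi.ne'
      rw [hf, hf, if_pos ⟨t, ht, hxt, hb⟩, if_pos ⟨t, ht, hxt, ha⟩,
        triangleDist_eq_dist_dev ht hit (hs t ht hxt) ha hb]
      have h1 := dist_triangle (l.dev i s p) (l.dev i s a) (l.dev i s b)
      have h2 := dist_nonneg (x := l.dev i s a) (y := l.dev i s b)
      rcases le_total (ρ / 2) (dist (l.dev i s p) (l.dev i s a)) with h | h
      · rw [min_eq_left h]
        linarith [min_le_left (ρ / 2) (dist (l.dev i s p) (l.dev i s b))]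
      · rw [min_eq_right h]
        linarith [min_le_right (ρ / 2) (dist (l.dev i s p) (l.dev i s b))]
    · have hconst : ∀ q ∈ puncturedSimplex t, f q = ρ / 2 := by
        intro q hq
        rw [hf]
        split_ifs with hstar
        · obtain ⟨t', ht', hxt', hqt'⟩ := hstar
          have hit := mem_of_mem_simplex hxt' hi.ne'
          have hne : ∃ m, 0 < x m ∧ q m = 0 := by
            by_contra! hno
            exact hxt (mem_simplex_of_support hxt' fun m hm =>
              mem_of_mem_simplex hq.1 (hno m (lt_of_le_of_ne (hxt'.1 m) hm.symm)))
          have h1 := hgap t' ht' hxt' q hqt' hne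
          rw [triangleDist_eq_dist_dev ht' hit (hs t' ht' hxt') ⟨hxt', hx.2⟩ hqt'] at h1
          have h2 := dist_triangle (l.dev i s x) (l.dev i s p) (l.dev i s q)
          rw [dist_comm (l.dev i s x) (l.dev i s p)] at h2
          exact min_eq_left (by linarith)
        · rfl
      rw [hconst a ha, hconst b hb, sub_self]
      exact triangleDist_nonneg ht ha hb
  refine ⟨fun q hq => ?_, fun q hq hq' => ?_⟩
  · have hq' : q ∈ T.punctured := by
      obtain ⟨t, ht, -, hq⟩ := hq
      exact mem_punctured ht hq
    have := sub_le_hypDist hlip hp' hq'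
    rwa [hfp, hf, if_pos hq, sub_zero] at this
  · have := sub_le_hypDist hlip hp' hq
    rwa [hfp, hf, if_neg hq', sub_zero] at this

theorem gapSq_pos {i j k : V} (hij : i ≠ j) (hik : i ≠ k) (hjk : j ≠ k)
    (ht : {i, j, k} ∈ T.triangles) : 0 < l.gapSq i j k :=
  div_pos (l.sqLen_pos_of_mem ht (by simp) (by simp) hjk)
    (mul_pos (l.sqLen_pos_of_mem ht (by simp) (by simp) hij)
      (l.sqLen_pos_of_mem ht (by simp) (by simp) hik))

/-- The inverse of the developing map on a triangle is continuous. -/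
theorem exists_dist_dev_lt {t : Finset V} (ht : t ∈ T.triangles) {i : V} (hi : i ∈ t) {s : V → ℝ}
    (hs : l.Spread i s t) {x : V → ℝ} (hx : x ∈ puncturedSimplex t) {U : Set (V → ℝ)}
    (hU : U ∈ 𝓝 x) :
    ∃ ε > 0, ∀ y ∈ puncturedSimplex t, dist (l.dev i s x) (l.dev i s y) < ε → y ∈ U := by
  obtain ⟨j, k, hij, hik, hjk, rfl⟩ := exists_triangle_eq ht hi
  have hs := hs j (by simp) k (by simp) hij hik hjk
  have hne : s j ≠ s k := fun h => (gapSq_pos (l := l) hij hik hjk ht).ne' (by rw [← hs, h]; ring)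
  have hc := (mem_puncturedSimplex_iff.1 hx).1
  have hcont : ContinuousAt (l.stripPt i j k (s j) (s k)) (l.dev i s x) := by
    apply continuousAt_stripPt
    rw [stripVec_dev hij hik hjk ht hne hs hx]
    exact smul_mem_cone hc (inv_pos.2 (moment_pos hij hik ht hc))
  rw [ContinuousAt, stripPt_dev hij hik hjk ht hne hs hx] at hcont
  obtain ⟨ε, hε, h⟩ := Metric.mem_nhds_iff.1 (hcont hU)
  refine ⟨ε, hε, fun y hy hd => ?_⟩
  have : l.dev i s y ∈ Metric.ball (l.dev i s x) ε := by rwa [Metric.mem_ball, dist_comm]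
  have := h this
  rwa [mem_preimage, stripPt_dev hij hik hjk ht hne hs hy] at this

/-- Small balls of the glued distance are small in the topology of the surface. -/
theorem exists_hypDist_lt {x : V → ℝ} (hx : x ∈ T.punctured) {U : Set (V → ℝ)} (hU : U ∈ 𝓝 x) :
    ∃ ε > 0, ∀ y ∈ T.punctured, l.hypDist x y < ε → y ∈ U := by
  obtain ⟨i, j, hij, hi, hj⟩ := exists_pos_of_mem_punctured hx
  obtain ⟨s, hs⟩ := l.exists_spread hij
  have hs' : ∀ t ∈ T.triangles, x ∈ simplex t → l.Spread i s t := fun t ht hxt =>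
    hs t ht (mem_of_mem_simplex hxt hi.ne') (mem_of_mem_simplex hxt hj.ne')
  obtain ⟨ρ, hρ, hlow⟩ := exists_dist_dev_le hx hi hs'
  have h : ∀ᶠ ε : ℝ in 𝓝[>] 0, ∀ t ∈ (T.star i).powerset, t ∈ T.triangles → x ∈ simplex t →
      ∀ y ∈ puncturedSimplex t, dist (l.dev i s x) (l.dev i s y) < ε → y ∈ U := by
    rw [Filter.eventually_all_finset]
    intro t _
    by_cases h : t ∈ T.triangles ∧ x ∈ simplex t
    · obtain ⟨ht, hxt⟩ := h
      obtain ⟨ε, hε, h⟩ := exists_dist_dev_lt ht (mem_of_mem_simplex hxt hi.ne') (hs' t ht hxt)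
        ⟨hxt, hx.2⟩ hU
      filter_upwards [Ioc_mem_nhdsGT hε] with ε' hε' _ _ y hy hd using h y hy (hd.trans_le hε'.2)
    · exact Eventually.of_forall fun _ ht hxt => absurd ⟨ht, hxt⟩ h
  obtain ⟨ε, hε, hε0, hερ⟩ := (h.and (Ioc_mem_nhdsGT hρ)).exists
  obtain ⟨t₀, ht₀, hxt₀⟩ := mem_punctured_iff.1 hx
  obtain ⟨h1, h2⟩ := hlow x ⟨t₀, ht₀, hxt₀.1, hxt₀⟩ (by rwa [dist_self])
  refine ⟨ε, hε0, fun y hy hd => ?_⟩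
  by_cases hstar : InStar T x y
  · have h3 := h1 y hstar
    obtain ⟨t, ht, hxt, hyt⟩ := hstar
    refine hε t (Finset.mem_powerset.2 (subset_star ht (mem_of_mem_simplex hxt hi.ne'))) ht hxt y
      hyt ?_
    rcases min_le_iff.1 h3 with h | h <;> linarith
  · linarith [h2 y hy hstar]

theorem eq_of_hypDist_eq_zero {x y : V → ℝ} (hx : x ∈ T.punctured) (hy : y ∈ T.punctured)
    (h : l.hypDist x y = 0) : x = y := by
  by_contra hne
  obtain ⟨ε, hε, hU⟩ := exists_hypDist_lt (l := l) hx (isOpen_ne.mem_nhds hne)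
  exact hU y hy (by rwa [h]) rfl

theorem eventually_inStar {x : V → ℝ} (hx : x ∈ T.punctured) :
    ∀ᶠ p in 𝓝[T.punctured] x, InStar T x p := by
  filter_upwards [(eventually_mem_simplex hx.1).filter_mono nhdsWithin_le_nhds,
    self_mem_nhdsWithin] with p hp hp'
  obtain ⟨t, ht, hpt⟩ := mem_punctured_iff.1 hp'
  exact ⟨t, ht, hp t hpt.1, hpt⟩

/-- Small neighbourhoods in the topology of the surface are small for the glued distance. -/
theorem eventually_hypDist_lt {x : V → ℝ} (hx : x ∈ T.punctured) {r : ℝ} (hr : 0 < r) :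
    ∀ᶠ y in 𝓝[T.punctured] x, l.hypDist x y < r := by
  obtain ⟨i, j, hij, hi, hj⟩ := exists_pos_of_mem_punctured hx
  obtain ⟨s, hs⟩ := l.exists_spread hij
  have hs' : ∀ t ∈ T.triangles, x ∈ simplex t → l.Spread i s t := fun t ht hxt =>
    hs t ht (mem_of_mem_simplex hxt hi.ne') (mem_of_mem_simplex hxt hj.ne')
  obtain ⟨t₀, ht₀, hxt₀⟩ := mem_punctured_iff.1 hx
  have hcont := continuousAt_dev ht₀ (mem_of_mem_simplex hxt₀.1 hi.ne') (hs' t₀ ht₀ hxt₀.1)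
    (mem_puncturedSimplex_iff.1 hxt₀).1
  filter_upwards [eventually_inStar hx,
    nhdsWithin_le_nhds (hcont (Metric.ball_mem_nhds _ hr))] with y ⟨t, ht, hxt, hyt⟩ hd
  refine (hypDist_le_triangleDist ht ⟨hxt, hx.2⟩ hyt).trans_lt ?_
  rw [triangleDist_eq_dist_dev ht (mem_of_mem_simplex hxt hi.ne') (hs' t ht hxt) ⟨hxt, hx.2⟩ hyt,
    dist_comm]
  exact hd

theorem hasBasis_hypDist {x : V → ℝ} (hx : x ∈ T.punctured) :
    (𝓝[T.punctured] x).HasBasis (fun r : ℝ => 0 < r)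
      (fun r => {y | y ∈ T.punctured ∧ l.hypDist x y < r}) := by
  refine ⟨fun U => ⟨fun hU => ?_, fun ⟨r, hr, hU⟩ => ?_⟩⟩
  · obtain ⟨W, hW, hWU⟩ := mem_nhdsWithin_iff_exists_mem_nhds_inter.1 hU
    obtain ⟨ε, hε, h⟩ := exists_hypDist_lt (l := l) hx hW
    exact ⟨ε, hε, fun y hy => hWU ⟨h y hy.1 hy.2, hy.1⟩⟩
  · refine mem_of_superset ?_ hU
    filter_upwards [self_mem_nhdsWithin, eventually_hypDist_lt hx hr] with y h1 h2 using ⟨h1, h2⟩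

variable (l) in
theorem restrictsToTriangles : l.RestrictsToTriangles l.hypDist := by
  intro t ht x hx
  have hxp := mem_punctured ht hx
  obtain ⟨i, j, hij, hi, hj⟩ := exists_pos_of_mem_punctured hxp
  obtain ⟨s, hs⟩ := l.exists_spread hij
  have hs' : ∀ t ∈ T.triangles, x ∈ simplex t → l.Spread i s t := fun t ht hxt =>
    hs t ht (mem_of_mem_simplex hxt hi.ne') (mem_of_mem_simplex hxt hj.ne')
  have hit := mem_of_mem_simplex hx.1 hi.ne'
  obtain ⟨ρ, hρ, hlow⟩ := exists_dist_dev_le hxp hi hs'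
  have hcont := continuousAt_dev ht hit (hs' t ht hx.1) (mem_puncturedSimplex_iff.1 hx).1
  refine ⟨_, hcont (Metric.ball_mem_nhds _ (half_pos hρ)), fun y hy z hz => ?_⟩
  have hy1 : dist (l.dev i s y) (l.dev i s x) < ρ / 2 := hy.1
  have hz1 : dist (l.dev i s z) (l.dev i s x) < ρ / 2 := hz.1
  refine le_antisymm (hypDist_le_triangleDist ht hy.2 hz.2) ?_
  have h := (hlow y ⟨t, ht, hx.1, hy.2⟩ (by linarith)).1 z ⟨t, ht, hx.1, hz.2⟩
  rw [triangleDist_eq_dist_dev ht hit (hs' t ht hx.1) hy.2 hz.2]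
  rwa [min_eq_right] at h
  linarith [dist_triangle_right (l.dev i s y) (l.dev i s z) (l.dev i s x)]

end DiscreteMetric

/-! ### Walking around a vertex -/

namespace SurfaceTriangulation

variable {V : Type*} [DecidableEq V] {T : SurfaceTriangulation V}

/-- `iab` is a triangle. -/
def Tri (T : SurfaceTriangulation V) (i a b : V) : Prop :=
  i ≠ a ∧ i ≠ b ∧ a ≠ b ∧ {i, a, b} ∈ T.triangles

theorem Tri.swap {i a b : V} (h : T.Tri i a b) : T.Tri i b a :=
  ⟨h.2.1, h.1, h.2.2.1.symm, by rw [Finset.pair_comm]; exact h.2.2.2⟩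

theorem tri_iff {i a b : V} (hia : i ≠ a) :
    T.Tri i a b ↔ b ≠ i ∧ b ≠ a ∧ {i, a, b} ∈ T.faces := by
  constructor
  · rintro ⟨h1, h2, h3, h4⟩
    exact ⟨h2.symm, h3.symm, h4.1⟩
  · rintro ⟨h2, h3, h4⟩
    exact ⟨hia, h2.symm, h3.symm, (triple_mem_triangles hia h2.symm h3.symm).2 h4⟩

theorem Tri.isEdge {i a b : V} (h : T.Tri i a b) : T.IsEdge i a :=
  ⟨h.1, pair_mem_faces h.2.2.2 (by simp) (by simp)⟩

/-- An edge lies in at most two triangles. -/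
theorem Tri.eq_of_ne {i b a c d : V} (ha : T.Tri i b a) (hc : T.Tri i b c) (hd : T.Tri i b d)
    (hca : c ≠ a) (hda : d ≠ a) : c = d := by
  by_contra hcd
  have h := T.degree_link i b ha.1
  have hsub : ({a, c, d} : Set V) ⊆ {k | k ≠ i ∧ k ≠ b ∧ {i, b, k} ∈ T.faces} := by
    rintro x (rfl | rfl | rfl)
    exacts [(tri_iff ha.1).1 ha, (tri_iff ha.1).1 hc, (tri_iff ha.1).1 hd]
  have h3 : ({a, c, d} : Set V).encard = 3 := by
    rw [Set.encard_eq_three]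
    exact ⟨a, c, d, hca.symm, hda.symm, hcd, rfl⟩
  have := (Set.encard_le_encard hsub).trans h
  rw [h3] at this
  exact absurd this (by decide)

theorem isBoundaryEdge_iff {i b : V} :
    T.IsBoundaryEdge i b ↔ ∃ a, T.Tri i b a ∧ ∀ c, T.Tri i b c → c = a := by
  constructor
  · rintro ⟨hib, a, ha, h⟩
    exact ⟨a, (tri_iff hib).2 ha, fun c hc => h c ((tri_iff hib).1 hc)⟩
  · rintro ⟨a, ha, h⟩
    exact ⟨ha.1, a, (tri_iff ha.1).1 ha, fun c hc => h c ((tri_iff ha.1).2 hc)⟩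

open Classical in
/-- The neighbour of `i` that comes after `b` on a walk around `i` that reaches `b` from `a`. At the
end of the link of a boundary vertex the walk turns around. -/
def next (T : SurfaceTriangulation V) (i a b : V) : V :=
  if h : ∃ c, c ≠ a ∧ T.Tri i b c then h.choose else a

theorem next_spec {i a b : V} (h : T.Tri i a b) : T.Tri i b (T.next i a b) := by
  rw [next]
  split_ifs with h'
  · exact h'.choose_spec.2
  · exact h.swap

theorem eq_or_eq_next {i a b c : V} (h : T.Tri i a b) (hc : T.Tri i b c) :
    c = a ∨ c = T.next i a b := by
  by_cases hca : c = a
  · exact Or.inl hca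
  · have h' : ∃ c, c ≠ a ∧ T.Tri i b c := ⟨c, hca, hc⟩
    rw [next, dif_pos h']
    exact Or.inr (h.swap.eq_of_ne hc h'.choose_spec.2 hca h'.choose_spec.1)

theorem next_next {i a b : V} (h : T.Tri i a b) : T.next i (T.next i a b) b = a := by
  have h1 := next_spec h
  have h2 := next_spec h1.swap
  rcases eq_or_eq_next h1.swap h.swap with h3 | h3
  · -- The walk turns around at `b`.
    rw [← h3]
    rcases eq_or_eq_next h h2 with h4 | h4
    · rwa [← h3] at h4
    · rw [← h3] at h4; exact h4
  · exact h3.symm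

/-- The oriented edges of the link of `i`. -/
abbrev Dart (T : SurfaceTriangulation V) (i : V) : Type _ := {d : V × V // T.Tri i d.1 d.2}

/-- One step of the walk around `i`. -/
def walk (T : SurfaceTriangulation V) (i : V) : Equiv.Perm (T.Dart i) where
  toFun d := ⟨(d.1.2, T.next i d.1.1 d.1.2), next_spec d.2⟩
  invFun d := ⟨(T.next i d.1.2 d.1.1, d.1.1), (next_spec d.2.swap).swap⟩
  left_inv d := Subtype.ext (Prod.ext (next_next d.2) rfl)
  right_inv d := Subtype.ext (Prod.ext rfl (next_next d.2.swap))

instance (i : V) : Finite (T.Dart i) := by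
  have h : {d : V × V | T.Tri i d.1 d.2} ⊆ (T.star i : Set V) ×ˢ (T.star i : Set V) := by
    intro d hd
    exact ⟨subset_star hd.2.2.2 (by simp) (by simp), subset_star hd.2.2.2 (by simp) (by simp)⟩
  exact ((T.star i).finite_toSet.prod (T.star i).finite_toSet).subset h

/-- A walk around the vertex `i`: an enumeration of its neighbours by the integers in which
consecutive neighbours span a triangle with `i`, and which goes round and round if the link of `i`
is a cycle, and back and forth if it is a path. The number `N` is its least period. -/
structure Fan (T : SurfaceTriangulation V) (i : V) where
  j : ℤ → V
  tri : ∀ m, T.Tri i (j m) (j (m + 1))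
  step : ∀ m, j (m + 2) = T.next i (j m) (j (m + 1))
  N : ℕ
  N_pos : 0 < N
  periodic : ∀ m, j (m + N) = j m
  dvd : ∀ a b, j a = j b → j (a + 1) = j (b + 1) → (N : ℤ) ∣ b - a

theorem exists_fan {i a b : V} (h : T.Tri i a b) : ∃ F : T.Fan i, F.j 0 = a ∧ F.j 1 = b := by
  set d₀ : T.Dart i := ⟨(a, b), h⟩
  set d : ℤ → T.Dart i := fun m => (T.walk i ^ m) d₀ with hd
  have hsucc : ∀ m, d (m + 1) = T.walk i (d m) := by
    intro m
    simp only [hd]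
    rw [add_comm, zpow_one_add, Equiv.Perm.mul_apply]
  have hj : ∀ m, (d (m + 1)).1.1 = (d m).1.2 := fun m => by rw [hsucc]; rfl
  have hper : 0 < MulAction.period (T.walk i) d₀ :=
    MulAction.period_pos_of_orderOf_pos (orderOf_pos (T.walk i)) d₀
  refine ⟨⟨fun m => (d m).1.1, fun m => ?_, fun m => ?_, MulAction.period (T.walk i) d₀, hper,
    fun m => ?_, fun p q hp hq => ?_⟩, ?_, ?_⟩
  · simp only [hj]; exact (d m).2
  · have : m + 2 = m + 1 + 1 := by ring
    simp only [this, hj]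
    rw [hsucc]; rfl
  · have h1 : (T.walk i ^ (MulAction.period (T.walk i) d₀ : ℤ)) d₀ = d₀ := by
      rw [zpow_natCast]
      exact MulAction.pow_period_smul (T.walk i) d₀
    simp only [hd]
    rw [zpow_add, Equiv.Perm.mul_apply, h1]
  · rw [hj, hj] at hq
    have h1 : d p = d q := Subtype.ext (Prod.ext hp hq)
    have h2 : (T.walk i ^ (q - p)) • d₀ = d₀ := by
      rw [Equiv.Perm.smul_def, sub_eq_neg_add, zpow_add, Equiv.Perm.mul_apply]
      change (T.walk i ^ (-p)) (d q) = d₀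
      rw [← h1]
      change (T.walk i ^ (-p)) ((T.walk i ^ p) d₀) = d₀
      rw [← Equiv.Perm.mul_apply, ← zpow_add, neg_add_cancel, zpow_zero, Equiv.Perm.one_apply]
    exact MulAction.zpow_smul_eq_iff_period_dvd.1 h2
  · simp [hd, d₀]
  · have := hj 0
    simp only [zero_add] at this
    simp only [this]
    simp [hd, d₀]

namespace Fan

variable {i : V} (F : T.Fan i)

theorem prev (m : ℤ) : F.j m = T.next i (F.j (m + 2)) (F.j (m + 1)) := by
  rw [F.step, next_next (F.tri m)]

theorem tri' (m : ℤ) : T.Tri i (F.j (m - 1)) (F.j m) := by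
  have := F.tri (m - 1)
  rwa [sub_add_cancel] at this

/-- The neighbours of a vertex of the link come before and after it in the walk. -/
theorem nbr {m : ℤ} {c : V} (h : T.Tri i (F.j m) c) : c = F.j (m - 1) ∨ c = F.j (m + 1) := by
  have h1 := F.step (m - 1)
  rw [sub_add_cancel, show m - 1 + 2 = m + 1 by ring] at h1
  rw [h1]
  exact eq_or_eq_next (F.tri' m) h

theorem surj {c : V} (h : T.IsEdge i c) : ∃ m, F.j m = c := by
  refine SimpleGraph.Connected.induction_on (T.connected_link i)
    (P := fun a => ∃ m, F.j m = a.1) ?_ (a := ⟨F.j 0, (F.tri 0).1.symm, (F.tri 0).isEdge.2⟩)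
    ⟨0, rfl⟩ ⟨c, h.1.symm, h.2⟩
  rintro ⟨a, ha, ha'⟩ ⟨b, hb, hb'⟩ ⟨hab, hf⟩ ⟨m, hm⟩
  have hab : b ≠ a := fun h => hab (Subtype.ext h.symm)
  have hm : F.j m = a := hm
  have : T.Tri i (F.j m) b := by
    rw [hm]
    exact (tri_iff ha.symm).2 ⟨hb, hab, hf⟩
  rcases F.nbr this with h | h
  exacts [⟨_, h.symm⟩, ⟨_, h.symm⟩]

/-- Every triangle at `i` occurs in the walk. -/
theorem exists_eq {t : Finset V} (ht : t ∈ T.triangles) (hi : i ∈ t) :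
    ∃ m, t = {i, F.j m, F.j (m + 1)} := by
  obtain ⟨a, b, hia, hib, hab, rfl⟩ := exists_triangle_eq ht hi
  obtain ⟨m, rfl⟩ := F.surj ⟨hia, pair_mem_faces ht (by simp) (by simp)⟩
  rcases F.nbr ⟨hia, hib, hab, ht⟩ with rfl | rfl
  · exact ⟨m - 1, by rw [sub_add_cancel, Finset.pair_comm]⟩
  · exact ⟨m, rfl⟩

theorem periodic_zmul (k m : ℤ) : F.j (m + k * F.N) = F.j m := by
  induction k using Int.induction_on generalizing m with
  | zero => simp
  | succ k ih => rw [← ih m, ← F.periodic (m + k * F.N)]; congr 1; ring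
  | pred k ih =>
    rw [← ih m, ← F.periodic]; congr 1; ring

/-- If the walk passes through the same edge of the link in opposite directions, then it turns around
in between. -/
theorem exists_turn {a b : ℤ} (hab : a ≤ b) (h : F.j a = F.j b) (h' : F.j (a + 1) = F.j (b - 1)) :
    ∃ m, 2 * m = a + b ∧ F.j (m - 1) = F.j (m + 1) := by
  have key : ∀ n : ℕ, F.j (a + n) = F.j (b - n) ∧ F.j (a + n + 1) = F.j (b - n - 1) := by
    intro n
    induction n with
    | zero => simpa using ⟨h, h'⟩
    | succ n ih =>
      push_cast
      refine ⟨by rw [← add_assoc, ← sub_sub]; exact ih.2, ?_⟩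
      have h1 := F.step (a + n)
      have h2 := F.prev (b - n - 2)
      rw [show b - n - 2 + 2 = b - n by ring, show b - (n : ℤ) - 2 + 1 = b - n - 1 by ring] at h2
      rw [show a + ((n : ℤ) + 1) + 1 = a + n + 2 by ring,
        show b - ((n : ℤ) + 1) - 1 = b - n - 2 by ring, h1, h2, ih.1, ih.2]
  obtain ⟨n, hn⟩ := Int.eq_ofNat_of_zero_le (sub_nonneg.2 hab)
  obtain ⟨k, rfl | rfl⟩ := n.even_or_odd'
  · refine ⟨a + k, by push_cast at hn; linarith, ?_⟩
    have h1 := (key k).2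
    rw [show b - (k : ℤ) - 1 = a + k - 1 by push_cast at hn; linarith] at h1
    exact h1.symm
  · have h1 := (key k).1
    rw [show b - (k : ℤ) = a + k + 1 by push_cast at hn; linarith] at h1
    exact absurd h1 (F.tri (a + k)).2.2.1

/-- The walk turns around exactly at the boundary edges. -/
theorem isBoundaryEdge_iff {m : ℤ} : T.IsBoundaryEdge i (F.j m) ↔ F.j (m - 1) = F.j (m + 1) := by
  rw [SurfaceTriangulation.isBoundaryEdge_iff]
  constructor
  · rintro ⟨a, -, h⟩
    rw [h _ (F.tri' m).swap, h _ (F.tri m)]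
  · intro h
    refine ⟨_, F.tri m, fun c hc => ?_⟩
    rcases F.nbr hc with h' | h'
    · rw [h', h]
    · exact h'

/-- If the walk never turns around, it visits a vertex of the link once in each period. -/
theorem dvd_of_eq (hF : ∀ m, F.j (m - 1) ≠ F.j (m + 1)) {a b : ℤ} (h : F.j a = F.j b) :
    (F.N : ℤ) ∣ b - a := by
  have main : ∀ a b : ℤ, a ≤ b → F.j a = F.j b → (F.N : ℤ) ∣ b - a := by
    intro a b hab h
    have h1 := F.tri a
    rw [h] at h1
    rcases F.nbr h1 with h2 | h2
    · obtain ⟨m, -, hm⟩ := F.exists_turn hab h h2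
      exact absurd hm (hF m)
    · exact F.dvd a b h h2
  rcases le_total a b with hab | hab
  · exact main a b hab h
  · rw [← neg_sub, dvd_neg]
    exact main b a hab h.symm

/-- A walk that never turns around has period at least three. -/
theorem two_lt_period (hF : ∀ m, F.j (m - 1) ≠ F.j (m + 1)) : 2 < F.N := by
  have h1 := F.N_pos
  by_contra! h
  interval_cases hN : F.N
  · have := F.periodic 0
    rw [hN] at this
    exact (F.tri 0).2.2.1 this.symm
  · have := F.periodic (-1)
    rw [hN] at this
    exact hF 0 (by simpa using this.symm)

/-- The walk that starts at the end of a link that is a path reaches the other end without visiting a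
vertex twice. -/
theorem exists_length (h0 : F.j (-1) = F.j 1) :
    ∃ n : ℤ, 0 < n ∧ F.j (n - 1) = F.j (n + 1) ∧ (∀ m, 0 < m → m < n → F.j (m - 1) ≠ F.j (m + 1)) ∧
      ∀ a b, 0 ≤ a → a ≤ n → 0 ≤ b → b ≤ n → F.j a = F.j b → a = b := by
  classical
  have hex : ∃ n : ℕ, 0 < n ∧ F.j ((n : ℤ) - 1) = F.j (n + 1) := by
    refine ⟨F.N, F.N_pos, ?_⟩
    have h1 := F.periodic (-1)
    have h2 := F.periodic 1
    rw [show (-1 : ℤ) + F.N = F.N - 1 by ring] at h1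
    rw [add_comm] at h2
    rw [h1, h2, h0]
  obtain ⟨n, ⟨hn, hturn⟩, hmin⟩ : ∃ n : ℕ, (0 < n ∧ F.j ((n : ℤ) - 1) = F.j (n + 1)) ∧
      ∀ m : ℕ, m < n → ¬ (0 < m ∧ F.j ((m : ℤ) - 1) = F.j (m + 1)) :=
    ⟨Nat.find hex, Nat.find_spec hex, fun m hm => Nat.find_min hex hm⟩
  have hno : ∀ m : ℤ, 0 < m → m < n → F.j (m - 1) ≠ F.j (m + 1) := by
    intro m hm hmn h
    lift m to ℕ using hm.le
    exact hmin m (by exact_mod_cast hmn) ⟨by exact_mod_cast hm, h⟩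
  refine ⟨n, by exact_mod_cast hn, hturn, hno, ?_⟩
  have main : ∀ a b : ℤ, 0 ≤ a → a < b → b ≤ n → F.j a ≠ F.j b := by
    intro a b ha hab hb h
    have rev : F.j (a + 1) ≠ F.j (b - 1) := by
      intro h1
      obtain ⟨m, hm, hm'⟩ := F.exists_turn hab.le h h1
      exact hno m (by linarith) (by linarith) hm'
    have h1 := F.tri' b
    have h2 := h1.swap
    rw [← h] at h2
    rcases F.nbr h2 with h3 | h3
    · rcases ha.eq_or_lt with rfl | ha
      · rw [zero_sub, h0] at h3
        exact rev h3.symm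
      · -- The walk is periodic with period `b - a`, so that it turns around at `b - a`.
        have key : F.j (0 - 1) = F.j (b - a - 1) ∧ F.j (0 : ℤ) = F.j (b - a) := by
          have : ∀ k : ℕ, F.j (a - k - 1) = F.j (b - k - 1) ∧ F.j (a - k) = F.j (b - k) := by
            intro k
            induction k with
            | zero => simpa using ⟨h3.symm, h⟩
            | succ k ih =>
              push_cast
              have e1 := F.prev (a - k - 2)
              have e2 := F.prev (b - k - 2)
              rw [show a - (k : ℤ) - 2 + 2 = a - k by ring,
                show a - (k : ℤ) - 2 + 1 = a - k - 1 by ring] at e1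
              rw [show b - (k : ℤ) - 2 + 2 = b - k by ring,
                show b - (k : ℤ) - 2 + 1 = b - k - 1 by ring] at e2
              refine ⟨?_, ?_⟩
              · rw [show a - ((k : ℤ) + 1) - 1 = a - k - 2 by ring,
                  show b - ((k : ℤ) + 1) - 1 = b - k - 2 by ring, e1, e2, ih.1, ih.2]
              · rw [← sub_sub, ← sub_sub, ih.1]
          have := this a.toNat
          rwa [Int.toNat_of_nonneg ha.le, sub_self] at this
        have e1 := F.step (-1)
        have e2 := F.step (b - a - 1)
        rw [show (-1 : ℤ) + 2 = 1 by ring, show (-1 : ℤ) + 1 = 0 by ring] at e1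
        rw [show b - a - 1 + 2 = b - a + 1 by ring, sub_add_cancel, ← key.1, ← key.2] at e2
        refine hno (b - a) (by linarith) (by linarith) ?_
        rw [e2, ← key.1, zero_sub, ← e1, h0]
    · exact rev h3.symm
  intro a b ha ha' hb hb' h
  rcases lt_trichotomy a b with hab | hab | hab
  · exact absurd h (main a b ha hab hb')
  · exact hab
  · exact absurd h.symm (main b a hb hab ha')

/-- If the link is a path, the triangles at `i` are those of the walk from one end to the other. -/
theorem exists_eq_of_turn (h0 : F.j (-1) = F.j 1) {n : ℤ} (hn : 0 < n)
    (h1 : F.j (n - 1) = F.j (n + 1)) {t : Finset V} (ht : t ∈ T.triangles) (hi : i ∈ t) :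
    ∃ m, 0 ≤ m ∧ m < n ∧ t = {i, F.j m, F.j (m + 1)} := by
  have hsurj : ∀ c, T.IsEdge i c → ∃ m, 0 ≤ m ∧ m ≤ n ∧ F.j m = c := by
    intro c hc
    refine SimpleGraph.Connected.induction_on (T.connected_link i)
      (P := fun a => ∃ m, 0 ≤ m ∧ m ≤ n ∧ F.j m = a.1) ?_
      (a := ⟨F.j 0, (F.tri 0).1.symm, (F.tri 0).isEdge.2⟩) ⟨0, le_rfl, hn.le, rfl⟩
      ⟨c, hc.1.symm, hc.2⟩
    rintro ⟨a, ha, ha'⟩ ⟨b, hb, hb'⟩ ⟨hab, hf⟩ ⟨m, hm0, hmn, hm⟩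
    have hab : b ≠ a := fun h => hab (Subtype.ext h.symm)
    have hm : F.j m = a := hm
    have : T.Tri i (F.j m) b := by
      rw [hm]
      exact (tri_iff ha.symm).2 ⟨hb, hab, hf⟩
    change ∃ m, 0 ≤ m ∧ m ≤ n ∧ F.j m = b
    rcases F.nbr this with h | h
    · rcases hm0.eq_or_lt with rfl | hm0
      · exact ⟨1, zero_le_one, hn, by rw [h, zero_sub, h0]⟩
      · exact ⟨m - 1, by linarith [Int.add_one_le_iff.2 hm0], by linarith, h.symm⟩
    · rcases hmn.eq_or_lt with rfl | hmn
      · exact ⟨m - 1, by linarith [Int.add_one_le_iff.2 hn], by linarith, by rw [h, h1]⟩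
      · exact ⟨m + 1, by linarith, hmn, h.symm⟩
  obtain ⟨a, b, hia, hib, hab, rfl⟩ := exists_triangle_eq ht hi
  obtain ⟨m, hm0, hmn, rfl⟩ := hsurj a ⟨hia, pair_mem_faces ht (by simp) (by simp)⟩
  have hdown : 0 < m → ({i, F.j m, F.j (m - 1)} : Finset V) = {i, F.j (m - 1), F.j (m - 1 + 1)} := by
    intro _
    rw [sub_add_cancel, Finset.pair_comm]
  rcases F.nbr ⟨hia, hib, hab, ht⟩ with rfl | rfl
  · rcases hm0.eq_or_lt with rfl | hm0
    · exact ⟨0, le_rfl, hn, by rw [zero_sub, h0, zero_add]⟩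
    · exact ⟨m - 1, by linarith [Int.add_one_le_iff.2 hm0], by linarith, hdown hm0⟩
  · rcases hmn.eq_or_lt with rfl | hmn
    · exact ⟨m - 1, by linarith [Int.add_one_le_iff.2 hn], by linarith, by rw [← h1, hdown hn]⟩
    · exact ⟨m, hm0, hmn, rfl⟩

end Fan

end SurfaceTriangulation

/-! ### Developing the star of a vertex along a walk -/

namespace SurfaceTriangulation.Fan

open DiscreteMetric

variable {V : Type*} [DecidableEq V] {T : SurfaceTriangulation V} {i : V} (F : T.Fan i)
  (l : DiscreteMetric T)

/-- The horocyclic length of the angle at `i` of the `m`-th triangle of the walk. -/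
def gap (m : ℤ) : ℝ := √(l.gapSq i (F.j m) (F.j (m + 1)))

theorem gap_pos (m : ℤ) : 0 < F.gap l m :=
  Real.sqrt_pos.2 (gapSq_pos (F.tri m).1 (F.tri m).2.1 (F.tri m).2.2.1 (F.tri m).2.2.2)

theorem gap_sq (m : ℤ) : F.gap l m ^ 2 = l.gapSq i (F.j m) (F.j (m + 1)) :=
  Real.sq_sqrt (gapSq_pos (F.tri m).1 (F.tri m).2.1 (F.tri m).2.2.1 (F.tri m).2.2.2).le

/-- The boundary point of the upper half-plane to which the `m`-th vertex of the walk is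
developed. -/
def pos (m : ℤ) : ℝ := ∑ k ∈ Finset.Ico 0 m, F.gap l k - ∑ k ∈ Finset.Ico m 0, F.gap l k

@[simp] theorem pos_zero : F.pos l 0 = 0 := by simp [pos]

theorem pos_succ (m : ℤ) : F.pos l (m + 1) = F.pos l m + F.gap l m := by
  rcases le_or_gt 0 m with h | h
  · have h1 : Finset.Ico (0 : ℤ) (m + 1) = insert m (Finset.Ico 0 m) := by
      ext k; simp only [Finset.mem_Ico, Finset.mem_insert]; omega
    rw [pos, pos, h1, Finset.sum_insert (by simp), Finset.Ico_eq_empty (a := m + 1) (by omega),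
      Finset.Ico_eq_empty (a := m) (by omega)]
    simp [add_comm]
  · have h1 : Finset.Ico m (0 : ℤ) = insert m (Finset.Ico (m + 1) 0) := by
      ext k; simp only [Finset.mem_Ico, Finset.mem_insert]; omega
    rw [pos, pos, h1, Finset.sum_insert (by simp), Finset.Ico_eq_empty (b := m + 1) (by omega),
      Finset.Ico_eq_empty (b := m) (by omega)]
    simp

theorem pos_strictMono : StrictMono (F.pos l) :=
  strictMono_int_of_lt_succ fun m => by rw [pos_succ]; linarith [F.gap_pos l m]

theorem pos_lt (m : ℤ) : F.pos l m < F.pos l (m + 1) := F.pos_strictMono l (by omega)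

theorem pos_sub_sq (m : ℤ) :
    (F.pos l m - F.pos l (m + 1)) ^ 2 = l.gapSq i (F.j m) (F.j (m + 1)) := by
  rw [← gap_sq, pos_succ]; ring

/-- The horocyclic length of one period of the walk. -/
def width : ℝ := F.pos l F.N

theorem width_pos : 0 < F.width l := by
  rw [width, ← F.pos_zero l]
  exact F.pos_strictMono l (by exact_mod_cast F.N_pos)

theorem pos_add_period (m : ℤ) : F.pos l (m + F.N) = F.pos l m + F.width l := by
  have hgap : ∀ m, F.gap l (m + F.N) = F.gap l m := by
    intro m
    rw [gap, gap, F.periodic, show m + (F.N : ℤ) + 1 = m + 1 + F.N by ring, F.periodic]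
  induction m using Int.induction_on with
  | zero => simp [width]
  | succ k ih =>
    rw [show (k : ℤ) + 1 + F.N = k + F.N + 1 by ring, pos_succ, pos_succ, ih, hgap]; ring
  | pred k ih =>
    have h1 := F.pos_succ l (-(k : ℤ) - 1)
    have h2 := F.pos_succ l (-(k : ℤ) - 1 + F.N)
    rw [sub_add_cancel] at h1
    rw [show -(k : ℤ) - 1 + F.N + 1 = -k + F.N by ring, hgap, ih] at h2
    linarith

theorem pos_add_zmul (k m : ℤ) : F.pos l (m + k * F.N) = F.pos l m + k * F.width l := by
  induction k using Int.induction_on with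
  | zero => simp
  | succ k ih =>
    rw [show m + ((k : ℤ) + 1) * F.N = m + k * F.N + F.N by ring, pos_add_period, ih]
    push_cast; ring
  | pred k ih =>
    have := F.pos_add_period l (m + (-(k : ℤ) - 1) * F.N)
    rw [show m + (-(k : ℤ) - 1) * F.N + F.N = m + -k * F.N by ring, ih] at this
    push_cast at this ⊢
    linarith

theorem gap_le_width (m : ℤ) : F.gap l m ≤ F.width l := by
  have h1 := F.pos_succ l m
  have h2 := F.pos_add_period l m
  have h3 : F.pos l (m + 1) ≤ F.pos l (m + F.N) :=
    (F.pos_strictMono l).monotone (by have := F.N_pos; omega)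
  linarith

theorem exists_idx (u : ℝ) : ∃ m, F.pos l m ≤ u ∧ u < F.pos l (m + 1) := by
  have hw := F.width_pos l
  have hk : ∀ k : ℤ, F.pos l (k * F.N) = k * F.width l := fun k => by
    have := F.pos_add_zmul l k 0
    simpa using this
  obtain ⟨m, hm, hmax⟩ := Int.exists_greatest_of_bdd (P := fun m => F.pos l m ≤ u)
    ⟨(⌊u / F.width l⌋ + 1) * F.N, fun z hz => by
      by_contra! h
      have h1 := F.pos_strictMono l h
      rw [hk] at h1
      have h2 := Int.lt_floor_add_one (u / F.width l)
      rw [div_lt_iff₀ hw] at h2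
      push_cast at h1
      linarith⟩
    ⟨⌊u / F.width l⌋ * F.N, by
      rw [hk]
      have h2 := Int.floor_le (u / F.width l)
      rwa [le_div_iff₀ hw] at h2⟩
  refine ⟨m, hm, ?_⟩
  by_contra! h
  have := hmax _ h
  omega

/-- The strip into which the `m`-th triangle of the walk is developed. -/
def strip (m : ℤ) : Set ℍ := {z | F.pos l m ≤ z.re ∧ z.re ≤ F.pos l (m + 1)}

/-- The points above the geodesic that joins the ideal points of the `m`-th strip. -/
def above (m : ℤ) : Set ℍ :=
  {z | 0 < (z.re - F.pos l m) * (z.re - F.pos l (m + 1)) + z.im ^ 2}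

theorem isOpen_above (m : ℤ) : IsOpen (F.above l m) := by
  have hre := UpperHalfPlane.continuous_re
  have him := UpperHalfPlane.continuous_im
  exact isOpen_lt continuous_const (by fun_prop)

theorem above_of_re_eq {m : ℤ} {z : ℍ} (h : z.re = F.pos l m ∨ z.re = F.pos l (m + 1)) :
    z ∈ F.above l m := by
  have := z.im_pos
  rw [above, mem_ofPred_eq]
  rcases h with h | h <;> rw [h] <;> simp <;> positivity

theorem above_of_lt_im {m : ℤ} {z : ℍ} (h : F.width l < z.im) : z ∈ F.above l m := by
  have h1 := F.gap_le_width l m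
  have h2 := F.gap_pos l m
  have h3 := F.pos_succ l m
  rw [above, mem_ofPred_eq]
  have h4 : F.gap l m ^ 2 < z.im ^ 2 := pow_lt_pow_left₀ (by linarith) h2.le two_ne_zero
  rw [h3]
  nlinarith [sq_nonneg (z.re - F.pos l m - F.gap l m / 2)]

/-- The point of the `m`-th triangle of the walk that is developed to `z`. -/
def stripChart (m : ℤ) (z : ℍ) : V → ℝ :=
  l.stripPt i (F.j m) (F.j (m + 1)) (F.pos l m) (F.pos l (m + 1)) z

/-- The index of the strip of `z`. -/
def idx (z : ℍ) : ℤ := (F.exists_idx l z.re).choose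

theorem pos_idx_le (z : ℍ) : F.pos l (F.idx l z) ≤ z.re := (F.exists_idx l z.re).choose_spec.1

theorem lt_pos_idx (z : ℍ) : z.re < F.pos l (F.idx l z + 1) :=
  (F.exists_idx l z.re).choose_spec.2

theorem mem_strip_idx (z : ℍ) : z ∈ F.strip l (F.idx l z) :=
  ⟨F.pos_idx_le l z, (F.lt_pos_idx l z).le⟩

theorem idx_eq {m : ℤ} {z : ℍ} (h : F.pos l m ≤ z.re) (h' : z.re < F.pos l (m + 1)) :
    F.idx l z = m := by
  have h1 := (F.pos_strictMono l).lt_iff_lt.1 ((F.pos_idx_le l z).trans_lt h')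
  have h2 := (F.pos_strictMono l).lt_iff_lt.1 (h.trans_lt (F.lt_pos_idx l z))
  omega

/-- The inverse of the developing map along the walk. -/
def chart (z : ℍ) : V → ℝ := F.stripChart l (F.idx l z) z

variable {l}

/-- The parametrisations of two adjacent triangles agree over the common side of their strips. -/
theorem chart_eq {m : ℤ} {z : ℍ} (hz : z ∈ F.strip l m) : F.chart l z = F.stripChart l m z := by
  rcases hz.2.lt_or_eq with h | h
  · rw [chart, F.idx_eq l hz.1 h]
  · have hlt := F.pos_lt l (m + 1)
    have h0 := F.pos_lt l m
    rw [chart, F.idx_eq l h.ge (h ▸ hlt), stripChart, stripChart, stripPt, stripPt]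
    congr 1
    rw [stripVec, stripVec, h, sub_self]
    rw [div_self (sub_pos.2 hlt).ne', div_self (sub_pos.2 h0).ne']
    simp

theorem stripChart_mem {m : ℤ} {z : ℍ} (hz : z ∈ F.strip l m) (hz' : z ∈ F.above l m) :
    F.stripChart l m z ∈ puncturedSimplex {i, F.j m, F.j (m + 1)} :=
  stripPt_mem (F.tri m).1 (F.tri m).2.1 (F.tri m).2.2.1 (F.tri m).2.2.2 (F.pos_lt l m) hz.1 hz.2 hz'

theorem chart_mem {m : ℤ} {z : ℍ} (hz : z ∈ F.strip l m) (hz' : z ∈ F.above l m) :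
    F.chart l z ∈ puncturedSimplex {i, F.j m, F.j (m + 1)} := by
  rw [F.chart_eq hz]; exact F.stripChart_mem hz hz'

theorem dev_chart {m : ℤ} {z : ℍ} (hz : z ∈ F.strip l m) (hz' : z ∈ F.above l m) {s : V → ℝ}
    (h : s (F.j m) = F.pos l m) (h' : s (F.j (m + 1)) = F.pos l (m + 1)) :
    l.dev i s (F.chart l z) = z := by
  rw [F.chart_eq hz]
  exact dev_stripPt (F.tri m).1 (F.tri m).2.1 (F.tri m).2.2.1 (F.tri m).2.2.2 (F.pos_lt l m) hz.1
    hz.2 hz' (by rw [h, h', pos_sub_sq]) h h'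

theorem spread {m : ℤ} {s : V → ℝ} (h : s (F.j m) = F.pos l m)
    (h' : s (F.j (m + 1)) = F.pos l (m + 1)) : l.Spread i s {i, F.j m, F.j (m + 1)} :=
  spread_triple (by rw [h, h', pos_sub_sq])

theorem chart_dev {m : ℤ} {s : V → ℝ} (h : s (F.j m) = F.pos l m)
    (h' : s (F.j (m + 1)) = F.pos l (m + 1)) {p : V → ℝ}
    (hp : p ∈ puncturedSimplex {i, F.j m, F.j (m + 1)}) :
    l.dev i s p ∈ F.strip l m ∧ (0 < p i → l.dev i s p ∈ F.above l m) ∧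
      F.chart l (l.dev i s p) = p := by
  have hlt := F.pos_lt l m
  have hsq : (s (F.j m) - s (F.j (m + 1))) ^ 2 = l.gapSq i (F.j m) (F.j (m + 1)) := by
    rw [h, h', pos_sub_sq]
  obtain ⟨h1, h2, h3⟩ := dev_mem_strip (F.tri m).1 (F.tri m).2.1 (F.tri m).2.2.1 (F.tri m).2.2.2
    (by rwa [h, h']) hsq hp
  have h4 := stripPt_dev (F.tri m).1 (F.tri m).2.1 (F.tri m).2.2.1 (F.tri m).2.2.2
    (by rw [h, h']; exact hlt.ne) hsq hp
  rw [h, h'] at h3 h4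
  rw [h] at h1
  rw [h'] at h2
  exact ⟨⟨h1, h2⟩, h3, by rw [F.chart_eq ⟨h1, h2⟩]; exact h4⟩

theorem exists_pos_fun (F : T.Fan i) (l : DiscreteMetric T) (m : ℤ) :
    ∃ s : V → ℝ, s (F.j m) = F.pos l m ∧ s (F.j (m + 1)) = F.pos l (m + 1) :=
  ⟨fun k => if k = F.j m then F.pos l m else F.pos l (m + 1), by simp,
    by simp [(F.tri m).2.2.1.symm]⟩

/-- The support of a point of the chart. -/
theorem chart_pos {m : ℤ} {z : ℍ} (hz : z ∈ F.strip l m) (hz' : z ∈ F.above l m) :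
    0 < F.chart l z i ∧ (0 < F.chart l z (F.j m) ↔ z.re < F.pos l (m + 1)) ∧
      (0 < F.chart l z (F.j (m + 1)) ↔ F.pos l m < z.re) := by
  obtain ⟨h1, h2, h3, h4⟩ := F.tri m
  have hlt := sub_pos.2 (F.pos_lt l m)
  have hc := stripVec_mem_cone (l := l) h1 h2 h3 h4 (F.pos_lt l m) hz.1 hz.2 hz'
  have hs := inv_pos.2 (sum_pos_of_mem_cone hc)
  have hj := l.sqLen_pos_of_mem h4 (by simp : i ∈ _) (by simp : F.j m ∈ _) h1
  have hk := l.sqLen_pos_of_mem h4 (by simp : i ∈ _) (by simp : F.j (m + 1) ∈ _) h2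
  rw [F.chart_eq hz, stripChart, stripPt, radialProj, finsum_eq_of_cone hc.2.1]
  simp only [Pi.smul_apply, smul_eq_mul, mul_pos_iff_of_pos_left hs]
  rw [stripVec_apply_left h1 h2, stripVec_apply_mid h1 h3, stripVec_apply_right h2 h3]
  refine ⟨hz', ?_, ?_⟩
  · rw [div_pos_iff_of_pos_right hj, div_pos_iff_of_pos_right hlt, sub_pos]
  · rw [div_pos_iff_of_pos_right hk, div_pos_iff_of_pos_right hlt, sub_pos]

end SurfaceTriangulation.Fan

namespace DiscreteMetric

variable {V : Type*} [DecidableEq V] {T : SurfaceTriangulation V}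

/-- The map `φ`, restricted to `D`, is isometric near `z₀`, and maps neighbourhoods of `z₀` in `D` onto
neighbourhoods in the punctured surface. -/
def IsLocalChart (l : DiscreteMetric T) (φ : ℍ → V → ℝ) (D : Set ℍ) (z₀ : ℍ) : Prop :=
  ∃ ρ > 0, MapsTo φ (Metric.ball z₀ ρ ∩ D) T.punctured ∧
    (∀ a ∈ Metric.ball z₀ ρ ∩ D, ∀ b ∈ Metric.ball z₀ ρ ∩ D,
      l.hypDist (φ a) (φ b) = dist a b) ∧
    ∀ ρ' > 0, φ '' (Metric.ball z₀ ρ' ∩ D) ∈ 𝓝[T.punctured] (φ z₀)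

theorem IsLocalChart.congr {l : DiscreteMetric T} {φ : ℍ → V → ℝ} {D D' : Set ℍ} {z₀ : ℍ}
    (h : l.IsLocalChart φ D z₀) (hD : ∀ᶠ z in 𝓝 z₀, z ∈ D ↔ z ∈ D') : l.IsLocalChart φ D' z₀ := by
  obtain ⟨ρ, hρ, h1, h2, h3⟩ := h
  obtain ⟨ε, hε, hD⟩ := Metric.eventually_nhds_iff_ball.1 hD
  have hsub : Metric.ball z₀ (min ρ ε) ∩ D' ⊆ Metric.ball z₀ ρ ∩ D := fun z hz =>
    ⟨Metric.ball_subset_ball (min_le_left _ _) hz.1,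
      (hD z (Metric.ball_subset_ball (min_le_right _ _) hz.1)).2 hz.2⟩
  refine ⟨min ρ ε, lt_min hρ hε, h1.mono_left hsub,
    fun a ha b hb => h2 a (hsub ha) b (hsub hb), fun ρ' hρ' => ?_⟩
  refine mem_of_superset (h3 (min ρ' ε) (lt_min hρ' hε)) (image_mono fun z hz =>
    ⟨Metric.ball_subset_ball (min_le_left _ _) hz.1,
      (hD z (Metric.ball_subset_ball (min_le_right _ _) hz.1)).1 hz.2⟩)

end DiscreteMetric

namespace SurfaceTriangulation.Fan

open DiscreteMetric

variable {V : Type*} [DecidableEq V] {T : SurfaceTriangulation V} {i : V} (F : T.Fan i)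
  {l : DiscreteMetric T}

/-- The chart of a walk is a local isometry on a set of at most two adjacent strips, provided that
these strips contain all triangles at the point in question. A geodesic that passes from one of
the strips to the other crosses their common side. -/
theorem isLocalChart_strips {P : Finset ℤ} (hP : P.Nonempty) {z₀ : ℍ}
    (hz₀ : ∀ m ∈ P, z₀ ∈ F.strip l m) (hz₀' : ∀ m ∈ P, z₀ ∈ F.above l m)
    (hadj : ∀ m ∈ P, ∀ n ∈ P, m < n → n = m + 1) {s : V → ℝ}
    (hs : ∀ m ∈ P, s (F.j m) = F.pos l m ∧ s (F.j (m + 1)) = F.pos l (m + 1))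
    (hT : ∀ t ∈ T.triangles, F.chart l z₀ ∈ simplex t → ∃ m ∈ P, t = {i, F.j m, F.j (m + 1)}) :
    l.IsLocalChart (F.chart l) (⋃ m ∈ P, F.strip l m) z₀ := by
  obtain ⟨m₀, hm₀⟩ := hP
  set x := F.chart l z₀ with hx
  have hxm : ∀ m ∈ P, x ∈ puncturedSimplex {i, F.j m, F.j (m + 1)} := fun m hm =>
    F.chart_mem (hz₀ m hm) (hz₀' m hm)
  have hxp : x ∈ T.punctured := mem_punctured (F.tri m₀).2.2.2 (hxm m₀ hm₀)
  have hxi : 0 < x i := (F.chart_pos (hz₀ m₀ hm₀) (hz₀' m₀ hm₀)).1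
  have hdx : l.dev i s x = z₀ := F.dev_chart (hz₀ m₀ hm₀) (hz₀' m₀ hm₀) (hs m₀ hm₀).1 (hs m₀ hm₀).2
  have hspread : ∀ t ∈ T.triangles, x ∈ simplex t → l.Spread i s t := by
    intro t ht hxt
    obtain ⟨m, hm, rfl⟩ := hT t ht hxt
    exact F.spread (hs m hm).1 (hs m hm).2
  obtain ⟨ρ, hρ, hlow⟩ := exists_dist_dev_le hxp hxi hspread
  have hab : ∀ᶠ z in 𝓝 z₀, ∀ m ∈ P, z ∈ F.above l m := by
    rw [Filter.eventually_all_finset]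
    exact fun m hm => (F.isOpen_above l m).mem_nhds (hz₀' m hm)
  obtain ⟨ρ₁, hρ₁, hab⟩ := Metric.eventually_nhds_iff_ball.1 hab
  set S : Set ℍ := ⋃ m ∈ P, F.strip l m with hS
  obtain ⟨ρ₂, hρ₂, hle, hle'⟩ : ∃ ρ₂ > 0, ρ₂ ≤ ρ / 2 ∧ ρ₂ ≤ ρ₁ :=
    ⟨min (ρ / 2) ρ₁, lt_min (half_pos hρ) hρ₁, min_le_left _ _, min_le_right _ _⟩
  have hmem : ∀ a ∈ Metric.ball z₀ ρ₂ ∩ S, ∃ m ∈ P, a ∈ F.strip l m ∧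
      F.chart l a ∈ puncturedSimplex {i, F.j m, F.j (m + 1)} ∧ l.dev i s (F.chart l a) = a := by
    rintro a ⟨ha, haS⟩
    obtain ⟨m, hm, ham⟩ := mem_iUnion₂.1 haS
    have ha' := hab a (Metric.ball_subset_ball hle' ha) m hm
    exact ⟨m, hm, ham, F.chart_mem ham ha', F.dev_chart ham ha' (hs m hm).1 (hs m hm).2⟩
  have htd : ∀ m ∈ P, ∀ p ∈ puncturedSimplex {i, F.j m, F.j (m + 1)},
      ∀ q ∈ puncturedSimplex {i, F.j m, F.j (m + 1)},
      l.hypDist p q ≤ dist (l.dev i s p) (l.dev i s q) := by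
    intro m hm p hp q hq
    rw [← triangleDist_eq_dist_dev (F.tri m).2.2.2 (by simp) (F.spread (hs m hm).1 (hs m hm).2) hp hq]
    exact hypDist_le_triangleDist _ hp hq
  have hup : ∀ a ∈ Metric.ball z₀ ρ₂ ∩ S, ∀ b ∈ Metric.ball z₀ ρ₂ ∩ S, ∀ m ∈ P, ∀ n ∈ P,
      a ∈ F.strip l m → F.chart l a ∈ puncturedSimplex {i, F.j m, F.j (m + 1)} →
      l.dev i s (F.chart l a) = a →
      b ∈ F.strip l n → F.chart l b ∈ puncturedSimplex {i, F.j n, F.j (n + 1)} →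
      l.dev i s (F.chart l b) = b → m ≤ n → l.hypDist (F.chart l a) (F.chart l b) ≤ dist a b := by
    intro a ha b hb m hm n hn ham hap had hbn hbp hbd hmn
    rcases hmn.eq_or_lt with rfl | hmn
    · have := htd m hm _ hap _ hbp
      rwa [had, hbd] at this
    · obtain rfl := hadj m hm n hn hmn
      obtain ⟨c, hc, hcd⟩ := exists_dist_add_dist_of_re ham.2 hbn.1
      have hlt1 := F.pos_lt l m
      have hlt2 := F.pos_lt l (m + 1)
      have hcm : c ∈ F.strip l m := ⟨by rw [hc]; exact hlt1.le, hc.le⟩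
      have hcn : c ∈ F.strip l (m + 1) := ⟨hc.ge, by rw [hc]; exact hlt2.le⟩
      have hcm' := F.above_of_re_eq l (m := m) (Or.inr hc)
      have hcn' := F.above_of_re_eq l (m := m + 1) (Or.inl hc)
      have hcd' := F.dev_chart hcm hcm' (hs m hm).1 (hs m hm).2
      have h1 := htd m hm _ hap _ (F.chart_mem hcm hcm')
      have h2 := htd (m + 1) hn _ (F.chart_mem hcn hcn') _ hbp
      rw [had, hcd'] at h1
      rw [hbd, hcd'] at h2
      have := hypDist_triangle (l := l) (mem_punctured (F.tri m).2.2.2 hap)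
        (mem_punctured (F.tri m).2.2.2 (F.chart_mem hcm hcm'))
        (mem_punctured (F.tri (m + 1)).2.2.2 hbp)
      linarith
  refine ⟨ρ₂, hρ₂, fun a ha => ?_, fun a ha b hb => le_antisymm ?_ ?_, fun ρ' hρ' => ?_⟩
  · obtain ⟨m, hm, -, h, -⟩ := hmem a ha
    exact mem_punctured (F.tri m).2.2.2 h
  · obtain ⟨m, hm, ham, hap, had⟩ := hmem a ha
    obtain ⟨n, hn, hbn, hbp, hbd⟩ := hmem b hb
    rcases le_total m n with hmn | hmn
    · exact hup a ha b hb m hm n hn ham hap had hbn hbp hbd hmn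
    · rw [hypDist_comm, dist_comm]
      exact hup b hb a ha n hn m hm hbn hbp hbd ham hap had hmn
  · obtain ⟨m, hm, ham, hap, had⟩ := hmem a ha
    obtain ⟨n, hn, hbn, hbp, hbd⟩ := hmem b hb
    have ha1 : dist a z₀ < ρ / 2 := (Metric.mem_ball.1 ha.1).trans_le hle
    have hb1 : dist b z₀ < ρ / 2 := (Metric.mem_ball.1 hb.1).trans_le hle
    have h := (hlow (F.chart l a) ⟨_, (F.tri m).2.2.2, (hxm m hm).1, hap⟩
      (by rw [had, hdx]; linarith)).1 (F.chart l b) ⟨_, (F.tri n).2.2.2, (hxm n hn).1, hbp⟩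
    rw [had, hbd] at h
    rwa [min_eq_right] at h
    linarith [dist_triangle_right a b z₀]
  · have hcont : ContinuousAt (l.dev i s) x := continuousAt_dev (F.tri m₀).2.2.2 (by simp)
      (F.spread (hs m₀ hm₀).1 (hs m₀ hm₀).2) (mem_puncturedSimplex_iff.1 (hxm m₀ hm₀)).1
    filter_upwards [eventually_inStar hxp,
      nhdsWithin_le_nhds (hcont (Metric.ball_mem_nhds _ hρ'))] with p ⟨t, ht, hxt, hpt⟩ hd
    obtain ⟨m, hm, rfl⟩ := hT t ht hxt
    obtain ⟨h1, -, h3⟩ := F.chart_dev (hs m hm).1 (hs m hm).2 hpt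
    rw [mem_preimage, hdx] at hd
    exact ⟨_, ⟨hd, mem_iUnion₂.2 ⟨m, hm, h1⟩⟩, h3⟩

/-- If the walk turns around at the side of a strip, then this strip is a chart near the side. -/
theorem isLocalChart_of_turn {m k : ℤ} {z₀ : ℍ} (hk : k = m ∨ k + 1 = m) (hz₀ : z₀.re = F.pos l m)
    (hturn : F.j (m - 1) = F.j (m + 1)) : l.IsLocalChart (F.chart l) (F.strip l k) z₀ := by
  have hlt1 := F.pos_lt l (m - 1)
  have hlt2 := F.pos_lt l m
  rw [sub_add_cancel] at hlt1
  obtain ⟨s, hs⟩ := F.exists_pos_fun l k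
  have hkstrip : z₀ ∈ F.strip l k := by
    rcases hk with rfl | rfl
    · exact ⟨hz₀.ge, by rw [hz₀]; exact hlt2.le⟩
    · rw [add_sub_cancel_right] at hlt1
      exact ⟨by rw [hz₀]; exact hlt1.le, hz₀.le⟩
  have hkab : z₀ ∈ F.above l k := F.above_of_re_eq l (by
    rcases hk with rfl | rfl
    exacts [Or.inl hz₀, Or.inr hz₀])
  have hm : z₀ ∈ F.strip l m := ⟨hz₀.ge, by rw [hz₀]; exact hlt2.le⟩
  have hm' : z₀ ∈ F.above l m := F.above_of_re_eq l (Or.inl hz₀)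
  have h := F.isLocalChart_strips (l := l) (P := {k}) ⟨k, by simp⟩ (z₀ := z₀) (by simpa using hkstrip)
    (by simpa using hkab) (by simp) (s := s) (by simpa using hs) ?_
  · simpa using h
  · intro t ht hxt
    obtain ⟨h1, h2, -⟩ := F.chart_pos hm hm'
    have hit := mem_of_mem_simplex hxt h1.ne'
    have hjt := mem_of_mem_simplex hxt (h2.2 (by rw [hz₀]; exact hlt2)).ne'
    obtain ⟨c, hic, hjc, rfl⟩ := exists_triangle_eq₂ ht hit hjt (F.tri m).1
    have hc : c = F.j (m + 1) := by
      rcases F.nbr ⟨(F.tri m).1, hic, hjc, ht⟩ with h | h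
      exacts [h.trans hturn, h]
    refine ⟨k, by simp, ?_⟩
    rcases hk with rfl | rfl
    · rw [hc]
    · rw [hc, ← hturn, add_sub_cancel_right, Finset.pair_comm]

/-- The chart of a walk is a local isometry wherever the walk does not turn around. -/
theorem isLocalChart_univ {m : ℤ} {z₀ : ℍ} (h1 : F.pos l m ≤ z₀.re) (h2 : z₀.re < F.pos l (m + 1))
    (h3 : z₀ ∈ F.above l m) (hturn : z₀.re = F.pos l m → F.j (m - 1) ≠ F.j (m + 1)) :
    l.IsLocalChart (F.chart l) univ z₀ := by
  have hre := UpperHalfPlane.continuous_re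
  have hm : z₀ ∈ F.strip l m := ⟨h1, h2.le⟩
  obtain ⟨hxi, hxj, hxk⟩ := F.chart_pos hm h3
  rcases h1.lt_or_eq with h1 | h1
  · obtain ⟨s, hs⟩ := F.exists_pos_fun l m
    have h := F.isLocalChart_strips (l := l) (P := {m}) ⟨m, by simp⟩ (z₀ := z₀) (by simpa using hm)
      (by simpa using h3) (by simp) (s := s) (by simpa using hs) ?_
    · refine h.congr ?_
      filter_upwards [(isOpen_Ioo.preimage hre).mem_nhds (⟨h1, h2⟩ : z₀ ∈ _ ⁻¹' Ioo _ _)] with z hz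
      simpa [strip] using ⟨hz.1.le, hz.2.le⟩
    · intro t ht hxt
      refine ⟨m, by simp, (Finset.eq_of_subset_of_card_le ?_ ?_).symm⟩
      · intro v hv
        simp only [Finset.mem_insert, Finset.mem_singleton] at hv
        rcases hv with rfl | rfl | rfl
        · exact mem_of_mem_simplex hxt hxi.ne'
        · exact mem_of_mem_simplex hxt (hxj.2 h2).ne'
        · exact mem_of_mem_simplex hxt (hxk.2 h1).ne'
      · rw [ht.2, (F.tri m).2.2.2.2]
  · have hne := hturn h1.symm
    have hlt := F.pos_lt l (m - 1)
    rw [sub_add_cancel] at hlt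
    have e1 := (F.tri' m).2.2.1
    have e2 := (F.tri m).2.2.1
    obtain ⟨s, hs0, hs1, hs2⟩ : ∃ s : V → ℝ, s (F.j (m - 1)) = F.pos l (m - 1) ∧
        s (F.j m) = F.pos l m ∧ s (F.j (m + 1)) = F.pos l (m + 1) :=
      ⟨fun k => if k = F.j (m - 1) then F.pos l (m - 1) else
        if k = F.j m then F.pos l m else F.pos l (m + 1), by simp, by simp [e1.symm],
        by simp [hne.symm, e2.symm]⟩
    have h := F.isLocalChart_strips (l := l) (P := {m - 1, m}) ⟨m, by simp⟩ (z₀ := z₀) ?_ ?_ ?_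
      (s := s) ?_ ?_
    · refine h.congr ?_
      have : z₀ ∈ UpperHalfPlane.re ⁻¹' Ioo (F.pos l (m - 1)) (F.pos l (m + 1)) :=
        ⟨h1 ▸ hlt, h2⟩
      filter_upwards [(isOpen_Ioo.preimage hre).mem_nhds this] with z hz
      simp only [Finset.mem_insert, Finset.mem_singleton, iUnion_iUnion_eq_or_left,
        iUnion_iUnion_eq_left, mem_union, strip, mem_ofPred_eq, sub_add_cancel, mem_univ, iff_true]
      rcases le_total z.re (F.pos l m) with h | h
      · exact Or.inl ⟨hz.1.le, h⟩
      · exact Or.inr ⟨h, hz.2.le⟩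
    · simp only [Finset.mem_insert, Finset.mem_singleton, forall_eq_or_imp, forall_eq]
      exact ⟨⟨by rw [← h1]; exact hlt.le, by rw [sub_add_cancel]; exact h1.ge⟩, hm⟩
    · simp only [Finset.mem_insert, Finset.mem_singleton, forall_eq_or_imp, forall_eq]
      exact ⟨F.above_of_re_eq l (Or.inr (by rw [sub_add_cancel]; exact h1.symm)), h3⟩
    · intro a ha b hb hab
      simp only [Finset.mem_insert, Finset.mem_singleton] at ha hb
      omega
    · simp only [Finset.mem_insert, Finset.mem_singleton, forall_eq_or_imp, forall_eq,
        sub_add_cancel]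
      exact ⟨⟨hs0, hs1⟩, hs1, hs2⟩
    · intro t ht hxt
      have hit := mem_of_mem_simplex hxt hxi.ne'
      have hjt := mem_of_mem_simplex hxt (hxj.2 h2).ne'
      obtain ⟨c, hic, hjc, rfl⟩ := exists_triangle_eq₂ ht hit hjt (F.tri m).1
      rcases F.nbr ⟨(F.tri m).1, hic, hjc, ht⟩ with h | h
      · exact ⟨m - 1, by simp, by rw [h, sub_add_cancel, Finset.pair_comm]⟩
      · exact ⟨m, by simp, by rw [h]⟩

end SurfaceTriangulation.Fan

/-! ### The glued metric is hyperbolic with cusps -/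

/-- The orientation preserving isometry of the upper half-plane that fixes infinity and maps `I` to
a given point. -/
theorem exists_isometry_map_I (z₀ : ℍ) : ∃ e : ℍ ≃ᵢ ℍ, e UpperHalfPlane.I = z₀ ∧
    ∀ w, (e w).re = z₀.re + z₀.im * w.re := by
  obtain ⟨c, hc⟩ : ∃ c : {x : ℝ // 0 < x}, (c : ℝ) = z₀.im := ⟨⟨z₀.im, z₀.im_pos⟩, rfl⟩
  obtain ⟨e, he⟩ : ∃ e : ℍ ≃ᵢ ℍ, ∀ w, e w = z₀.re +ᵥ (c • w) :=
    ⟨⟨(MulAction.toPerm c).trans (AddAction.toPerm z₀.re),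
      (UpperHalfPlane.isometry_real_vadd z₀.re).comp (UpperHalfPlane.isometry_pos_mul c)⟩,
      fun _ => rfl⟩
  refine ⟨e, ?_, fun w => ?_⟩
  · apply UpperHalfPlane.ext_re_im <;> simp [he, hc]
  · simp [he, hc]

namespace DiscreteMetric

open SurfaceTriangulation

variable {V : Type*} [DecidableEq V] {T : SurfaceTriangulation V} {l : DiscreteMetric T}

theorem IsLocalChart.comp_isometry {φ : ℍ → V → ℝ} {D : Set ℍ} {z₀ : ℍ}
    (h : l.IsLocalChart φ D z₀) (e : ℍ ≃ᵢ ℍ) (he : e UpperHalfPlane.I = z₀) :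
    l.IsLocalChart (φ ∘ e) (e ⁻¹' D) UpperHalfPlane.I := by
  obtain ⟨ρ, hρ, h1, h2, h3⟩ := h
  have hball : ∀ ρ, Metric.ball UpperHalfPlane.I ρ ∩ e ⁻¹' D = e ⁻¹' (Metric.ball z₀ ρ ∩ D) := by
    intro ρ
    rw [preimage_inter, ← he, e.preimage_ball, e.symm_apply_apply]
  refine ⟨ρ, hρ, ?_, ?_, fun ρ' hρ' => ?_⟩
  · rw [hball]; exact fun a ha => h1 ha
  · rw [hball]
    intro a ha b hb
    rw [Function.comp_apply, Function.comp_apply, h2 _ ha _ hb, e.dist_eq]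
  · rw [hball, image_comp, image_preimage_eq _ e.surjective, Function.comp_apply, he]
    exact h3 ρ' hρ'

theorem locallyIsometricOn_of_isLocalChart {φ : ℍ → V → ℝ} {D : Set ℍ}
    (h : ∀ z ∈ D, ∃ D', l.IsLocalChart φ D' z ∧ ∀ᶠ w in 𝓝 z, w ∈ D → w ∈ D') :
    LocallyIsometricOn l.hypDist φ D := by
  intro z hz
  obtain ⟨D', ⟨ρ, hρ, -, h2, -⟩, hD⟩ := h z hz
  obtain ⟨ε, hε, hD⟩ := Metric.eventually_nhds_iff_ball.1 hD
  have hsub : ∀ a ∈ D ∩ Metric.ball z (min ρ ε), a ∈ Metric.ball z ρ ∩ D' := fun a ha =>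
    ⟨Metric.ball_subset_ball (min_le_left _ _) ha.2,
      hD a (Metric.ball_subset_ball (min_le_right _ _) ha.2) ha.1⟩
  exact ⟨min ρ ε, lt_min hρ hε, fun a ha b hb => h2 a (hsub a ha) b (hsub b hb)⟩

/-- The squared height of a developed point is at least the ratio of its barycentric coordinate at the
cusp to the weighted sum of the others. -/
theorem le_im_dev_sq {t : Finset V} (ht : t ∈ T.triangles) {i : V} (hi : i ∈ t) {s : V → ℝ}
    (hs : l.Spread i s t) {p : V → ℝ} (hp : p ∈ cone t) :
    p i ≤ (l.dev i s p).im ^ 2 * ∑ k ∈ T.star i, p k * l.sqLen i k := by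
  obtain ⟨j, k, hij, hik, hjk, rfl⟩ := exists_triangle_eq ht hi
  have hs := hs j (by simp) k (by simp) hij hik hjk
  have hC := moment_pos (l := l) hij hik ht hp
  have hD := l.form_pos ht hp hp
  rw [← moment_det hij hik hjk ht hs] at hD
  rw [sum_star hij hik hjk ht hp.2.1, dev_triple hij hik hjk ht hp.2.1, halfPlanePt_im hC hD,
    div_pow, Real.sq_sqrt hD.le, moment_det hij hik hjk ht hs, sqLen_self, mul_zero, zero_add,
    div_mul_eq_mul_div, le_div_iff₀ (by positivity), l.form_triple hij hik hjk]
  have hj := hp.1 j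
  have hk := hp.1 k
  have : 0 ≤ p j * p k * l.sqLen j k := by have := l.sqLen_nonneg j k; positivity
  have h2 : 0 ≤ p j * l.sqLen i j + p k * l.sqLen i k := hC.le
  nlinarith [mul_nonneg this h2]

/-- Points of the star of `i` that are close to `i` are developed to points of large height. -/
theorem eventually_lt_im_dev (l : DiscreteMetric T) (i : V) (h : ℝ) :
    ∀ᶠ p in 𝓝 (vertex i : V → ℝ), 0 < p i ∧ ∀ t ∈ T.triangles, i ∈ t → ∀ s, l.Spread i s t →
      p ∈ cone t → h < (l.dev i s p).im := by
  have hC : Continuous fun p : V → ℝ => ∑ k ∈ T.star i, p k * l.sqLen i k :=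
    continuous_finsetSum _ fun k _ => (continuous_apply k).mul continuous_const
  have hF : Continuous fun p : V → ℝ => p i - h ^ 2 * ∑ k ∈ T.star i, p k * l.sqLen i k :=
    (continuous_apply i).sub (continuous_const.mul hC)
  have h0 : ∑ k ∈ T.star i, vertex i k * l.sqLen i k = 0 := by
    refine Finset.sum_eq_zero fun k _ => ?_
    by_cases hk : k = i
    · rw [hk, sqLen_self, mul_zero]
    · simp [vertex, hk]
  have h1 : 0 < (vertex i : V → ℝ) i := by simp [vertex]
  have h2 : 0 < (vertex i : V → ℝ) i - h ^ 2 * ∑ k ∈ T.star i, vertex i k * l.sqLen i k := by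
    rw [h0]; simpa using h1
  filter_upwards [(continuous_apply i).continuousAt.eventually_const_lt h1,
    hF.continuousAt.eventually_const_lt h2] with p hp hp'
  refine ⟨hp, fun t ht hi s hs hpt => ?_⟩
  have h3 := le_im_dev_sq ht hi hs hpt
  have him := (l.dev i s p).im_pos
  by_contra! hle
  have h4 : 0 ≤ ∑ k ∈ T.star i, p k * l.sqLen i k :=
    Finset.sum_nonneg fun k _ => mul_nonneg (hpt.1 k) (l.sqLen_nonneg _ _)
  have h5 : (l.dev i s p).im ^ 2 ≤ h ^ 2 := pow_le_pow_left₀ him.le hle 2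
  have := mul_le_mul_of_nonneg_right h5 h4
  linarith

end DiscreteMetric

namespace SurfaceTriangulation.Fan

open DiscreteMetric

variable {V : Type*} [DecidableEq V] {T : SurfaceTriangulation V} {i : V} (F : T.Fan i)
  {l : DiscreteMetric T}

theorem above_idx {m : ℤ} {z : ℍ} (hz : z ∈ F.strip l m) (hz' : z ∈ F.above l m) :
    z ∈ F.above l (F.idx l z) := by
  rcases hz.2.lt_or_eq with h | h
  · rwa [F.idx_eq l hz.1 h]
  · exact F.above_of_re_eq l (Or.inl (by rw [F.idx_eq l h.ge (h ▸ F.pos_lt l (m + 1)), h]))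

theorem chart_inj_strip {m : ℤ} {z z' : ℍ} (hz : z ∈ F.strip l m) (hz' : z' ∈ F.strip l m)
    (ha : z ∈ F.above l m) (ha' : z' ∈ F.above l m) (h : F.chart l z = F.chart l z') : z = z' := by
  obtain ⟨s, h1, h2⟩ := F.exists_pos_fun l m
  rw [← F.dev_chart hz ha h1 h2, h, F.dev_chart hz' ha' h1 h2]

/-- Two points with the same image under the chart lie over the same triangle. -/
theorem j_idx_of_chart_eq {z z' : ℍ} (ha : z ∈ F.above l (F.idx l z))
    (ha' : z' ∈ F.above l (F.idx l z')) (h : F.chart l z = F.chart l z') :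
    F.j (F.idx l z) = F.j (F.idx l z') ∨ (F.pos l (F.idx l z) < z.re ∧
      F.pos l (F.idx l z') < z'.re ∧ F.j (F.idx l z) = F.j (F.idx l z' + 1) ∧
      F.j (F.idx l z') = F.j (F.idx l z + 1)) := by
  have key : ∀ z z' : ℍ, z ∈ F.above l (F.idx l z) → z' ∈ F.above l (F.idx l z') →
      F.chart l z = F.chart l z' → F.j (F.idx l z) ≠ F.j (F.idx l z') →
      F.pos l (F.idx l z') < z'.re ∧ F.j (F.idx l z) = F.j (F.idx l z' + 1) := by
    intro z z' ha ha' h hne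
    have h1 := (F.chart_pos (F.mem_strip_idx l z) ha).2.1.2 (F.lt_pos_idx l z)
    rw [h] at h1
    have h2 := mem_of_mem_simplex (F.chart_mem (F.mem_strip_idx l z') ha').1 h1.ne'
    simp only [Finset.mem_insert, Finset.mem_singleton] at h2
    rcases h2 with h2 | h2 | h2
    · exact absurd h2.symm (F.tri _).1
    · exact absurd h2 hne
    · rw [h2] at h1
      exact ⟨(F.chart_pos (F.mem_strip_idx l z') ha').2.2.1 h1, h2⟩
  by_cases hne : F.j (F.idx l z) = F.j (F.idx l z')
  · exact Or.inl hne
  · obtain ⟨h1, h2⟩ := key z z' ha ha' h hne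
    obtain ⟨h3, h4⟩ := key z' z ha' ha h.symm (Ne.symm hne)
    exact Or.inr ⟨h3, h1, h2, h4⟩

/-- The chart is invariant under the translation by the width of the cusp. -/
theorem chart_vadd (n : ℤ) (z : ℍ) : F.chart l (((n : ℝ) * F.width l) +ᵥ z) = F.chart l z := by
  have h := F.mem_strip_idx l z
  have hre : (((n : ℝ) * F.width l) +ᵥ z).re = n * F.width l + z.re := by simp
  have e1 : F.pos l (F.idx l z + n * F.N) = F.pos l (F.idx l z) + n * F.width l :=
    F.pos_add_zmul l n _
  have e2 : F.pos l (F.idx l z + n * F.N + 1) = F.pos l (F.idx l z + 1) + n * F.width l := by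
    rw [← F.pos_add_zmul l n]; congr 1; ring
  have e3 : F.j (F.idx l z + n * F.N + 1) = F.j (F.idx l z + 1) := by
    rw [← F.periodic_zmul n (F.idx l z + 1)]; congr 1; ring
  have h' : ((n : ℝ) * F.width l) +ᵥ z ∈ F.strip l (F.idx l z + n * F.N) := by
    refine ⟨?_, ?_⟩
    · rw [hre, e1]; linarith [h.1]
    · rw [hre, e2]; linarith [h.2]
  rw [F.chart_eq h', F.chart_eq h, stripChart, stripChart, stripPt, stripPt, stripVec, stripVec, e3,
    F.periodic_zmul, e1, e2, hre, UpperHalfPlane.vadd_im]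
  congr 4 <;> ring_nf

/-- The image of a horoball under the chart is a punctured neighbourhood of the vertex. -/
theorem chart_image_mem_nhds {h : ℝ} {D : Set ℍ}
    (hD : ∀ t ∈ T.triangles, i ∈ t → ∃ m, t = {i, F.j m, F.j (m + 1)} ∧
      ∀ z ∈ F.strip l m, h < z.im → z ∈ D) :
    insert (vertex i) (F.chart l '' D) ∈ 𝓝[T.space] (vertex i) := by
  filter_upwards [nhdsWithin_le_nhds (eventually_lt_im_dev l i h), self_mem_nhdsWithin]
    with p ⟨hpi, hp⟩ ⟨t, ht, hpt⟩
  by_cases hv : p = vertex i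
  · exact Or.inl hv
  right
  have hpp : p ∈ puncturedSimplex t := by
    refine ⟨hpt, fun k hk => hv ?_⟩
    have : k = i := by
      by_contra hne
      rw [hk] at hpi
      simp [vertex, Ne.symm hne] at hpi
    rw [hk, this]
  have hi := mem_of_mem_simplex hpt hpi.ne'
  obtain ⟨m, rfl, hm⟩ := hD t ht hi
  obtain ⟨s, h1, h2⟩ := F.exists_pos_fun l m
  obtain ⟨h3, -, h5⟩ := F.chart_dev h1 h2 hpp
  exact ⟨_, hm _ h3 (hp _ ht hi s (F.spread h1 h2) (mem_puncturedSimplex_iff.1 hpp).1), h5⟩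

/-- The barycentric coordinates other than the one at the cusp tend to zero with increasing height. -/
theorem chart_le {z : ℍ} (hz : F.width l < z.im) {k : V} (hk : i ≠ k) :
    0 ≤ F.chart l z k ∧ F.chart l z k ≤ 1 / l.sqLen i k * (z.im ^ 2 - F.width l ^ 2)⁻¹ := by
  set m := F.idx l z
  have hw := F.width_pos l
  have h0 : 0 < z.im ^ 2 - F.width l ^ 2 := by
    have := pow_lt_pow_left₀ hz hw.le two_ne_zero
    linarith
  have hm : z ∈ F.strip l m := F.mem_strip_idx l z
  have ha := F.above_of_lt_im l (m := m) hz
  obtain ⟨h1, h2, h3, h4⟩ := F.tri m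
  have hc := stripVec_mem_cone (l := l) h1 h2 h3 h4 (F.pos_lt l m) hm.1 hm.2 ha
  have hs := sum_pos_of_mem_cone hc
  have hlt := sub_pos.2 (F.pos_lt l m)
  have hgap := F.gap_le_width l m
  have hsucc := F.pos_succ l m
  refine ⟨(F.chart_mem hm ha).1.1 k, ?_⟩
  have hle : z.im ^ 2 - F.width l ^ 2 ≤ ∑ v ∈ ({i, F.j m, F.j (m + 1)} : Finset V),
      l.stripVec i (F.j m) (F.j (m + 1)) (F.pos l m) (F.pos l (m + 1)) z v := by
    refine le_trans ?_ (Finset.single_le_sum (fun v _ => hc.1 v) (by simp : i ∈ _))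
    rw [stripVec_apply_left h1 h2]
    nlinarith [mul_nonneg (sub_nonneg.2 hm.1) (sub_nonneg.2 hm.2), F.gap_pos l m, hm.1, hm.2,
      mul_le_mul hgap hgap (F.gap_pos l m).le hw.le]
  have hsq := l.sqLen_nonneg i k
  have hk' : l.stripVec i (F.j m) (F.j (m + 1)) (F.pos l m) (F.pos l (m + 1)) z k ≤
      1 / l.sqLen i k := by
    by_cases hkt : k ∈ ({i, F.j m, F.j (m + 1)} : Finset V)
    · simp only [Finset.mem_insert, Finset.mem_singleton] at hkt
      rcases hkt with rfl | rfl | rfl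
      · exact absurd rfl hk
      · rw [stripVec_apply_mid h1 h3]
        refine div_le_div_of_nonneg_right ?_ hsq
        rw [div_le_one hlt]; linarith [hm.1]
      · rw [stripVec_apply_right h2 h3]
        refine div_le_div_of_nonneg_right ?_ hsq
        rw [div_le_one hlt]; linarith [hm.2]
    · rw [stripVec_apply_of_notMem hkt]
      positivity
  rw [F.chart_eq hm, stripChart, stripPt, radialProj, finsum_eq_of_cone hc.2.1, Pi.smul_apply,
    smul_eq_mul, mul_comm]
  refine mul_le_mul hk' ((inv_le_inv₀ hs h0).2 hle) (inv_nonneg.2 hs.le) (by positivity)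

/-- The point at infinity of the chart corresponds to the vertex. -/
theorem tendsto_chart : Tendsto (F.chart l) (comap UpperHalfPlane.im atTop) (𝓝 (vertex i)) := by
  have him : Tendsto UpperHalfPlane.im (comap UpperHalfPlane.im atTop) atTop := tendsto_comap
  have hev : ∀ᶠ z in comap UpperHalfPlane.im atTop, F.width l < z.im :=
    him.eventually (eventually_gt_atTop _)
  have hlim : Tendsto (fun z : ℍ => (z.im ^ 2 - F.width l ^ 2)⁻¹) (comap UpperHalfPlane.im atTop)
      (𝓝 0) := by
    refine tendsto_inv_atTop_zero.comp ?_
    refine tendsto_atTop_add_const_right _ _ ?_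
    exact (tendsto_pow_atTop two_ne_zero).comp him
  have hk : ∀ k, i ≠ k → Tendsto (fun z => F.chart l z k) (comap UpperHalfPlane.im atTop) (𝓝 0) := by
    intro k hk
    refine tendsto_of_tendsto_of_tendsto_of_le_of_le' tendsto_const_nhds ?_
      (hev.mono fun z hz => (F.chart_le hz hk).1) (hev.mono fun z hz => (F.chart_le hz hk).2)
    simpa using hlim.const_mul (1 / l.sqLen i k)
  rw [tendsto_pi_nhds]
  intro k
  by_cases hik : i = k
  · subst hik
    have h1 : Tendsto (fun z => 1 - ∑ k ∈ (T.star i).erase i, F.chart l z k)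
        (comap UpperHalfPlane.im atTop) (𝓝 (1 - ∑ k ∈ (T.star i).erase i, 0)) :=
      tendsto_const_nhds.sub (tendsto_finsetSum _ fun k hk' => hk k (Finset.ne_of_mem_erase hk').symm)
    have hv : (vertex i : V → ℝ) i = 1 := by simp [vertex]
    rw [hv]
    simp only [Finset.sum_const_zero, sub_zero] at h1
    refine h1.congr' (hev.mono fun z hz => ?_)
    have hm := F.chart_mem (F.mem_strip_idx l z) (F.above_of_lt_im l hz)
    have hsub := subset_star (F.tri (F.idx l z)).2.2.2 (by simp : i ∈ _)
    have hsum := hm.1.2.2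
    rw [Finset.sum_subset hsub fun v _ hv => hm.1.2.1 v hv,
      ← Finset.add_sum_erase _ _ (hsub (by simp : i ∈ _))] at hsum
    linarith
  · have hv : (vertex i : V → ℝ) k = 0 := by simp [vertex, Ne.symm hik]
    rw [hv]
    exact hk k hik

end SurfaceTriangulation.Fan

namespace DiscreteMetric

open SurfaceTriangulation

variable {V : Type*} [DecidableEq V] {T : SurfaceTriangulation V} (l : DiscreteMetric T)

/-- Every point that does not lie on the boundary has a chart. -/
theorem exists_isLocalChart {x : V → ℝ} (hx : x ∈ T.punctured) (hb : ¬ T.IsBoundaryPoint x) :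
    ∃ φ z₀, φ z₀ = x ∧ l.IsLocalChart φ univ z₀ := by
  obtain ⟨i, -, -, hi, -⟩ := exists_pos_of_mem_punctured hx
  obtain ⟨t, ht, hxt⟩ := mem_punctured_iff.1 hx
  have hit := mem_of_mem_simplex hxt.1 hi.ne'
  obtain ⟨a, b, hia, hib, hab, rfl⟩ := exists_triangle_eq ht hit
  obtain ⟨F, -⟩ := exists_fan ⟨hia, hib, hab, ht⟩
  obtain ⟨m, hm⟩ := F.exists_eq ht hit
  rw [hm] at hxt
  obtain ⟨s, h1, h2⟩ := F.exists_pos_fun l m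
  obtain ⟨h3, h4, h5⟩ := F.chart_dev h1 h2 hxt
  set z₀ := l.dev i s x
  have ha := F.above_idx h3 (h4 hi)
  refine ⟨F.chart l, z₀, h5, F.isLocalChart_univ (F.pos_idx_le l z₀) (F.lt_pos_idx l z₀) ha
    fun hre hturn => hb ?_⟩
  have hmem := F.chart_mem (F.mem_strip_idx l z₀) ha
  have hpos := F.chart_pos (F.mem_strip_idx l z₀) ha
  rw [h5] at hmem hpos
  refine ⟨i, _, F.isBoundaryEdge_iff.2 hturn, mem_simplex_of_support hmem.1 fun v hv => ?_⟩
  have hv' := mem_of_mem_simplex hmem.1 hv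
  simp only [Finset.mem_insert, Finset.mem_singleton] at hv' ⊢
  rcases hv' with rfl | rfl | rfl
  · exact Or.inl rfl
  · exact Or.inr rfl
  · exact absurd hre (hpos.2.2.1 (lt_of_le_of_ne (hmem.1.1 _) hv.symm)).ne'

/-- Every boundary point has a half-disk chart. -/
theorem exists_isLocalChart_boundary {x : V → ℝ} (hx : x ∈ T.punctured) (hb : T.IsBoundaryPoint x) :
    ∃ φ z₀, φ z₀ = x ∧ z₀.re = 0 ∧ l.IsLocalChart φ {z | 0 ≤ z.re} z₀ := by
  obtain ⟨i, b, hib, hxib⟩ := hb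
  obtain ⟨a, htri, -⟩ := isBoundaryEdge_iff.1 hib
  obtain ⟨F, hF0, hF1⟩ := exists_fan htri
  have hxt : x ∈ puncturedSimplex {i, F.j 0, F.j (0 + 1)} := by
    refine ⟨mem_simplex_of_support hxib fun v hv => ?_, hx.2⟩
    have := mem_of_mem_simplex hxib hv
    simp only [Finset.mem_insert, Finset.mem_singleton] at this ⊢
    rw [hF0]; tauto
  have hi : 0 < x i := by
    refine lt_of_le_of_ne (hxib.1 i) fun h0 => ?_
    have hsum := hxib.2.2
    rw [Finset.sum_pair hib.1, ← h0, zero_add] at hsum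
    refine hx.2 b (funext fun v => ?_)
    by_cases hvb : v = b
    · simp [vertex, hvb, hsum]
    · by_cases hvi : v = i
      · simp [vertex, hvi, ← h0, hib.1]
      · simp [vertex, hvb, hxib.2.1 v (by simp [hvi, hvb])]
  obtain ⟨s, h1, h2⟩ := F.exists_pos_fun l 0
  obtain ⟨h3, h4, h5⟩ := F.chart_dev h1 h2 hxt
  set z₀ := l.dev i s x
  have hpos := (F.chart_pos h3 (h4 hi)).2.2
  have ha : x (F.j (0 + 1)) = 0 := by
    refine hxib.2.1 _ ?_
    simp only [Finset.mem_insert, Finset.mem_singleton, not_or]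
    exact ⟨(F.tri 0).2.1.symm, by rw [← hF0]; exact (F.tri 0).2.2.1.symm⟩
  rw [h5, ha, F.pos_zero] at hpos
  have hre : z₀.re = 0 := by
    have h6 := h3.1
    rw [F.pos_zero] at h6
    by_contra hne
    exact lt_irrefl _ (hpos.2 (lt_of_le_of_ne h6 (Ne.symm hne)))
  have hturn : F.j (0 - 1) = F.j (0 + 1) := F.isBoundaryEdge_iff.1 (by rwa [hF0])
  refine ⟨F.chart l, z₀, h5, hre, (F.isLocalChart_of_turn (k := 0) (m := 0) (Or.inl rfl)
    (by rw [hre, F.pos_zero]) hturn).congr ?_⟩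
  have hlt : z₀.re < F.pos l (0 + 1) := by rw [hre, ← F.pos_zero l]; exact F.pos_lt l 0
  filter_upwards [UpperHalfPlane.continuous_re.continuousAt.eventually_lt_const hlt] with z hz
  change F.pos l 0 ≤ z.re ∧ z.re ≤ F.pos l (0 + 1) ↔ 0 ≤ z.re
  rw [F.pos_zero]
  exact ⟨fun h => h.1, fun h => ⟨h, hz.le⟩⟩

theorem exists_tri (T : SurfaceTriangulation V) (i : V) : ∃ a b, T.Tri i a b := by
  obtain ⟨t, ht, hc, hi⟩ := T.pure _ (T.singleton_mem i)
  obtain ⟨a, b, h1, h2, h3, rfl⟩ := exists_triangle_eq (T := T) ⟨ht, hc⟩ (hi (by simp : i ∈ _))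
  exact ⟨a, b, h1, h2, h3, ht, hc⟩

/-- The cusp at an interior vertex. -/
theorem exists_cusp {i : V} (hi : ¬ T.IsBoundaryVertex i) : ∃ w > 0, ∃ h > 0, ∃ φ : ℍ → V → ℝ,
    T.IsCuspChart l.hypDist i {z | h < z.im} φ ∧
    ∀ z z' : ℍ, h < z.im → h < z'.im → (φ z = φ z' ↔ ∃ n : ℤ, z' = ((n : ℝ) * w) +ᵥ z) := by
  obtain ⟨a, b, hab⟩ := exists_tri T i
  obtain ⟨F, -⟩ := exists_fan hab
  have hF : ∀ m, F.j (m - 1) ≠ F.j (m + 1) := fun m hm =>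
    hi ⟨F.j m, F.isBoundaryEdge_iff.2 hm⟩
  have hw := F.width_pos l
  -- The height `F.width l` exceeds that of the geodesics below the strips.
  refine ⟨F.width l, hw, F.width l, hw, F.chart l, ⟨?_, ?_, ?_, ?_⟩, ?_⟩
  · intro z hz
    exact mem_punctured (F.tri _).2.2.2 (F.chart_mem (F.mem_strip_idx l z) (F.above_of_lt_im l hz))
  · exact locallyIsometricOn_of_isLocalChart fun z hz =>
      ⟨univ, F.isLocalChart_univ (F.pos_idx_le l z) (F.lt_pos_idx l z) (F.above_of_lt_im l hz)
        fun _ => hF _, by simp⟩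
  · exact F.chart_image_mem_nhds fun t ht hit =>
      (F.exists_eq ht hit).imp fun m hm => ⟨hm, fun _ _ hz => hz⟩
  · exact F.tendsto_chart.mono_left inf_le_left
  · intro z z' hz hz'
    constructor
    · intro h
      rcases F.j_idx_of_chart_eq (F.above_of_lt_im l hz) (F.above_of_lt_im l hz') h with
        h1 | ⟨-, -, h1, h2⟩
      · obtain ⟨n, hn⟩ := F.dvd_of_eq hF h1
        refine ⟨n, ?_⟩
        have hidx : F.idx l z' = F.idx l z + n * F.N := by rw [mul_comm n, ← hn]; ring
        have hre : (((n : ℝ) * F.width l) +ᵥ z).re = n * F.width l + z.re := by simp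
        have hs : ((n : ℝ) * F.width l) +ᵥ z ∈ F.strip l (F.idx l z') := by
          have hz0 := F.mem_strip_idx l z
          refine ⟨?_, ?_⟩
          · rw [hre, hidx, F.pos_add_zmul]; linarith [hz0.1]
          · rw [hre, hidx, add_right_comm, F.pos_add_zmul]; linarith [hz0.2]
        refine F.chart_inj_strip (F.mem_strip_idx l z') hs (F.above_of_lt_im l hz')
          (F.above_of_lt_im l (by simpa using hz)) ?_
        rw [F.chart_vadd, h]
      · have d1 := F.dvd_of_eq hF h1
        have d2 := F.dvd_of_eq hF h2
        have d3 := dvd_add d1 d2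
        rw [show F.idx l z' + 1 - F.idx l z + (F.idx l z + 1 - F.idx l z') = 2 by ring] at d3
        have h3 := Int.le_of_dvd two_pos d3
        have h4 := F.two_lt_period hF
        omega
    · rintro ⟨n, rfl⟩
      exact (F.chart_vadd n z).symm

/-- The cusp at a boundary vertex. -/
theorem exists_boundary_cusp {i : V} (hi : T.IsBoundaryVertex i) :
    ∃ w > 0, ∃ h > 0, ∃ φ : ℍ → V → ℝ,
      T.IsCuspChart l.hypDist i {z | h < z.im ∧ 0 ≤ z.re ∧ z.re ≤ w} φ ∧
      InjOn φ {z | h < z.im ∧ 0 ≤ z.re ∧ z.re ≤ w} := by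
  obtain ⟨b, hib⟩ := hi
  obtain ⟨a, htri, -⟩ := isBoundaryEdge_iff.1 hib
  obtain ⟨F, hF0, -⟩ := exists_fan htri
  have hturn0 : F.j (0 - 1) = F.j (0 + 1) := F.isBoundaryEdge_iff.1 (by rwa [hF0])
  have hturn : F.j (-1) = F.j 1 := by simpa using hturn0
  obtain ⟨n, hn, hturn', hmid, hinj⟩ := F.exists_length hturn
  have hw := F.width_pos l
  have hmono := F.pos_strictMono l
  have hn0 : 0 < F.pos l n := by rw [← F.pos_zero l]; exact hmono hn
  set D : Set ℍ := {z | F.width l < z.im ∧ 0 ≤ z.re ∧ z.re ≤ F.pos l n} with hD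
  have hidx : ∀ z ∈ D, 0 ≤ F.idx l z ∧ F.idx l z ≤ n := by
    rintro z ⟨-, h1, h2⟩
    constructor
    · by_contra! h
      have h3 : F.pos l (F.idx l z + 1) ≤ F.pos l 0 := hmono.monotone (by omega)
      rw [F.pos_zero] at h3
      linarith [F.lt_pos_idx l z]
    · exact hmono.le_iff_le.1 ((F.pos_idx_le l z).trans h2)
  refine ⟨F.pos l n, hn0, F.width l, hw, F.chart l, ⟨?_, ?_, ?_, ?_⟩, ?_⟩
  · intro z hz
    exact mem_punctured (F.tri _).2.2.2 (F.chart_mem (F.mem_strip_idx l z) (F.above_of_lt_im l hz.1))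
  · refine locallyIsometricOn_of_isLocalChart fun z hz => ?_
    obtain ⟨h0, h1⟩ := hidx z hz
    have hcont := UpperHalfPlane.continuous_re.continuousAt (x := z)
    by_cases hre : z.re = F.pos l (F.idx l z) ∧ F.j (F.idx l z - 1) = F.j (F.idx l z + 1)
    · obtain ⟨hre, ht⟩ := hre
      rcases h0.eq_or_lt with h0 | h0
      · refine ⟨_, F.isLocalChart_of_turn (k := 0) (Or.inl h0) hre ht, ?_⟩
        have hlt : z.re < F.pos l (0 + 1) := by rw [h0]; exact F.lt_pos_idx l z
        filter_upwards [hcont.eventually_lt_const hlt] with w hw hwD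
        exact ⟨by rw [F.pos_zero]; exact hwD.2.1, hw.le⟩
      · rcases h1.eq_or_lt with h1 | h1
        · refine ⟨_, F.isLocalChart_of_turn (k := n - 1) (m := F.idx l z)
            (Or.inr (by omega)) hre ht, ?_⟩
          have hlt : F.pos l (n - 1) < z.re := by rw [hre, h1]; exact hmono (by omega)
          filter_upwards [hcont.eventually_const_lt hlt] with w hw hwD
          exact ⟨hw.le, by rw [sub_add_cancel]; exact hwD.2.2⟩
        · exact absurd ht (hmid _ h0 h1)
    · exact ⟨univ, F.isLocalChart_univ (F.pos_idx_le l z) (F.lt_pos_idx l z)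
        (F.above_of_lt_im l hz.1) fun h1 h2 => hre ⟨h1, h2⟩, by simp⟩
  · refine F.chart_image_mem_nhds (h := F.width l) fun t ht hit => ?_
    obtain ⟨m, hm0, hmn, rfl⟩ := F.exists_eq_of_turn hturn hn hturn' ht hit
    refine ⟨m, rfl, fun z hz hzi => ⟨hzi, ?_, ?_⟩⟩
    · rw [← F.pos_zero l]; exact (hmono.monotone hm0).trans hz.1
    · exact hz.2.trans (hmono.monotone (by omega))
  · exact F.tendsto_chart.mono_left inf_le_left
  · intro z hz z' hz' h
    obtain ⟨a0, a1⟩ := hidx z hz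
    obtain ⟨b0, b1⟩ := hidx z' hz'
    rcases F.j_idx_of_chart_eq (F.above_of_lt_im l hz.1) (F.above_of_lt_im l hz'.1) h with
      h1 | ⟨c1, c2, h1, h2⟩
    · have e := hinj _ _ a0 a1 b0 b1 h1
      refine F.chart_inj_strip (F.mem_strip_idx l z) ?_ (F.above_of_lt_im l hz.1)
        (F.above_of_lt_im l hz'.1) h
      rw [e]; exact F.mem_strip_idx l z'
    · have e1 := hmono.lt_iff_lt.1 (c1.trans_le hz.2.2)
      have e2 := hmono.lt_iff_lt.1 (c2.trans_le hz'.2.2)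
      have e3 := hinj _ _ a0 a1 (by omega) (by omega) h1
      have e4 := hinj _ _ b0 b1 (by omega) (by omega) h2
      omega

theorem isHyperbolicCuspMetric : T.IsHyperbolicCuspMetric l.hypDist where
  eq_zero_iff x hx y hy := ⟨eq_of_hypDist_eq_zero hx hy, fun h => by rw [h, hypDist_self]⟩
  symm x _ y _ := hypDist_comm x y
  triangle x hx y hy z hz := hypDist_triangle hx hy hz
  topology x hx := hasBasis_hypDist hx
  interior x hx hb := by
    obtain ⟨φ, z₀, hφ, hc⟩ := l.exists_isLocalChart hx hb
    obtain ⟨e, he, -⟩ := exists_isometry_map_I z₀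
    obtain ⟨r, hr, h1, h2, h3⟩ := hc.comp_isometry e he
    simp only [preimage_univ, inter_univ, Function.comp_apply, he, hφ] at h1 h2 h3
    exact ⟨r, hr, φ ∘ e, by rw [Function.comp_apply, he, hφ], h1, h3 r hr, h2⟩
  boundary x hx hb := by
    obtain ⟨φ, z₀, hφ, hre, hc⟩ := l.exists_isLocalChart_boundary hx hb
    obtain ⟨e, he, he'⟩ := exists_isometry_map_I z₀
    have hpre : e ⁻¹' {z | 0 ≤ z.re} = {z | 0 ≤ z.re} := by
      ext z
      change 0 ≤ (e z).re ↔ 0 ≤ z.re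
      rw [he', hre, zero_add, mul_nonneg_iff_of_pos_left z₀.im_pos]
    obtain ⟨r, hr, h1, h2, h3⟩ := hc.comp_isometry e he
    rw [hpre] at h1 h2 h3
    refine ⟨r, hr, φ ∘ e, by rw [Function.comp_apply, he, hφ], h1, ?_, h2⟩
    have := h3 r hr
    rwa [Function.comp_apply, he, hφ] at this
  cusp i hi := l.exists_cusp hi
  boundary_cusp i hi := l.exists_boundary_cusp hi

end DiscreteMetric

/-! ### Scaling barycentric coordinates -/

namespace SurfaceTriangulation

variable {V : Type*} [DecidableEq V] {T : SurfaceTriangulation V}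

/-- Multiply the barycentric coordinates by the weights `d` and renormalise. -/
def scale (d x : V → ℝ) : V → ℝ := radialProj (d * x)

section scale

variable {t : Finset V} {d x : V → ℝ}

theorem sum_mul_pos (hd : ∀ i ∈ t, 0 < d i) (hx : x ∈ simplex t) : 0 < ∑ i ∈ t, d i * x i := by
  obtain ⟨i, hi, hxi⟩ := Finset.exists_ne_zero_of_sum_ne_zero (hx.2.2.trans_ne one_ne_zero)
  exact Finset.sum_pos' (fun k hk => mul_nonneg (hd k hk).le (hx.1 k))
    ⟨i, hi, mul_pos (hd i hi) (lt_of_le_of_ne (hx.1 i) hxi.symm)⟩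

theorem scale_eq (hx : ∀ i, i ∉ t → x i = 0) : scale d x = (∑ i ∈ t, d i * x i)⁻¹ • (d * x) := by
  rw [scale, radialProj, finsum_eq_of_cone (t := t) (fun i hi => by simp [hx i hi])]
  rfl

theorem support_scale (hd : ∀ i ∈ t, 0 < d i) (hx : x ∈ simplex t) :
    Function.support (scale d x) = Function.support x := by
  have hs := sum_mul_pos hd hx
  ext i
  rw [scale_eq hx.2.1, Function.mem_support, Function.mem_support, Pi.smul_apply, Pi.mul_apply,
    smul_eq_mul]
  by_cases hi : i ∈ t
  · simp [hs.ne', (hd i hi).ne']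
  · simp [hx.2.1 i hi]

theorem scale_mem_simplex (hd : ∀ i ∈ t, 0 < d i) (hx : x ∈ simplex t) : scale d x ∈ simplex t := by
  have hs := sum_mul_pos hd hx
  have h0 : ∀ i, i ∉ t → scale d x i = 0 := fun i hi => by
    rw [scale_eq hx.2.1]; simp [hx.2.1 i hi]
  refine ⟨fun i => ?_, h0, ?_⟩
  · by_cases hi : i ∈ t
    · rw [scale_eq hx.2.1]
      exact mul_nonneg (inv_nonneg.2 hs.le) (mul_nonneg (hd i hi).le (hx.1 i))
    · rw [h0 i hi]
  · rw [scale_eq hx.2.1]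
    simp only [Pi.smul_apply, smul_eq_mul, Pi.mul_apply, ← Finset.mul_sum]
    exact inv_mul_cancel₀ hs.ne'

/-- A point of the surface is a vertex if and only if its support has only one element. -/
theorem puncturedSimplex_iff_support :
    x ∈ puncturedSimplex t ↔ x ∈ simplex t ∧ (Function.support x).Nontrivial := by
  constructor
  · intro hx
    obtain ⟨i, j, hij, hi, hj⟩ := (mem_puncturedSimplex_iff.1 hx).1.2.2
    exact ⟨hx.1, i, hi.ne', j, hj.ne', hij⟩
  · rintro ⟨hx, i, hi, j, hj, hij⟩
    exact mem_puncturedSimplex_iff.2 ⟨⟨hx.1, hx.2.1, i, j, hij,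
      lt_of_le_of_ne (hx.1 i) (Ne.symm hi), lt_of_le_of_ne (hx.1 j) (Ne.symm hj)⟩, hx.2.2⟩

theorem punctured_iff_support :
    x ∈ T.punctured ↔ x ∈ T.space ∧ (Function.support x).Nontrivial := by
  rw [mem_punctured_iff]
  simp only [puncturedSimplex_iff_support]
  exact ⟨fun ⟨t, ht, hx, h⟩ => ⟨⟨t, ht, hx⟩, h⟩, fun ⟨⟨t, ht, hx⟩, h⟩ => ⟨t, ht, hx, h⟩⟩

theorem mem_simplex_of_support_eq {y : V → ℝ} (hx : x ∈ simplex t) (hy : y ∈ T.space)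
    (h : Function.support y = Function.support x) : y ∈ simplex t := by
  obtain ⟨t', -, hy⟩ := hy
  exact mem_simplex_of_support hy fun i hi => mem_of_mem_simplex hx (by
    have : i ∈ Function.support y := hi
    rwa [h] at this)

theorem mem_puncturedSimplex_of_support_eq {y : V → ℝ} (hx : x ∈ puncturedSimplex t)
    (hy : y ∈ T.space) (h : Function.support y = Function.support x) : y ∈ puncturedSimplex t := by
  rw [puncturedSimplex_iff_support] at hx ⊢
  exact ⟨mem_simplex_of_support_eq hx.1 hy h, h ▸ hx.2⟩

theorem scale_mem_space (hd : ∀ i, 0 < d i) (hx : x ∈ T.space) : scale d x ∈ T.space := by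
  obtain ⟨t, ht, hx⟩ := hx
  exact ⟨t, ht, scale_mem_simplex (fun i _ => hd i) hx⟩

theorem scale_inv_scale (hd : ∀ i, 0 < d i) (hx : x ∈ T.space) : scale d⁻¹ (scale d x) = x := by
  obtain ⟨t, -, hx⟩ := hx
  have hs := sum_mul_pos (fun i _ => hd i) hx
  have h : d⁻¹ * ((∑ i ∈ t, d i * x i)⁻¹ • (d * x)) = (∑ i ∈ t, d i * x i)⁻¹ • x := by
    funext i
    have := (hd i).ne'
    simp only [Pi.mul_apply, Pi.inv_apply, Pi.smul_apply, smul_eq_mul]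
    field_simp
  rw [scale, scale_eq hx.2.1, h, radialProj_smul (inv_pos.2 hs).ne', radialProj_eq_self hx]

/-- Scaling is continuous on the surface, as the complex is locally finite. -/
theorem continuousOn_scale (hd : ∀ i, 0 < d i) : ContinuousOn (scale d) T.space := by
  rintro x ⟨t, ht, hx⟩
  obtain ⟨i, hi, hxi⟩ := Finset.exists_ne_zero_of_sum_ne_zero (hx.2.2.trans_ne one_ne_zero)
  have hsub : ∀ p ∈ T.space, p i ≠ 0 → ∀ k, k ∉ T.star i → p k = 0 := by
    rintro p ⟨t, ht, hp⟩ hpi k hk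
    exact hp.2.1 k fun hkt => hk (subset_star ht (mem_of_mem_simplex hp hpi) hkt)
  have hev : ∀ᶠ p in 𝓝[T.space] x, scale d p = (∑ k ∈ T.star i, d k * p k)⁻¹ • (d * p) := by
    filter_upwards [self_mem_nhdsWithin, nhdsWithin_le_nhds
      ((continuous_apply i).continuousAt.eventually_ne hxi)] with p hp hpi
    exact scale_eq (hsub p hp hpi)
  have hs : 0 < ∑ k ∈ T.star i, d k * x k := by
    refine Finset.sum_pos' (fun k _ => mul_nonneg (hd k).le (hx.1 k))
      ⟨i, subset_star ht hi hi, mul_pos (hd i) (lt_of_le_of_ne (hx.1 i) hxi.symm)⟩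
  have hx' := scale_eq (d := d) (hsub x ⟨t, ht, hx⟩ hxi)
  refine ContinuousWithinAt.congr_of_eventuallyEq ?_ hev hx'
  refine ContinuousAt.continuousWithinAt (continuousAt_pi.2 fun m => ContinuousAt.mul
    (ContinuousAt.inv₀ ?_ hs.ne') ?_)
  · exact (continuous_finsetSum _ fun k _ => continuous_const.mul (continuous_apply k)).continuousAt
  · exact (continuous_const.mul (continuous_apply m)).continuousAt

/-- The homeomorphism of the surface that scales the barycentric coordinates. -/
def scaleHomeo (T : SurfaceTriangulation V) (hd : ∀ i, 0 < d i) : T.space ≃ₜ T.space where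
  toFun x := ⟨scale d x, scale_mem_space hd x.2⟩
  invFun x := ⟨scale d⁻¹ x, scale_mem_space (fun i => inv_pos.2 (hd i)) x.2⟩
  left_inv x := Subtype.ext (scale_inv_scale hd x.2)
  right_inv x := Subtype.ext (by
    have := scale_inv_scale (d := d⁻¹) (fun i => inv_pos.2 (hd i)) x.2
    rwa [inv_inv] at this)
  continuous_toFun := (continuousOn_iff_continuous_domRestrict.1 (continuousOn_scale hd)).subtype_mk _
  continuous_invFun := (continuousOn_iff_continuous_domRestrict.1
    (continuousOn_scale fun i => inv_pos.2 (hd i))).subtype_mk _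

end scale

/-- A homeomorphism of the surface that preserves supports restricts to the punctured surface. -/
theorem exists_restrict (F : T.space ≃ₜ T.space)
    (hF : ∀ x : T.space, Function.support (F x : V → ℝ) = Function.support (x : V → ℝ)) :
    ∃ g : T.punctured ≃ T.punctured, DiscreteMetric.Extends F g := by
  have hF' : ∀ x : T.space, Function.support (F.symm x : V → ℝ) = Function.support (x : V → ℝ) := by
    intro x
    rw [← hF, F.apply_symm_apply]
  have hp : ∀ x : T.punctured, (F ⟨x.1, x.2.1⟩ : V → ℝ) ∈ T.punctured := fun x => by
    rw [punctured_iff_support, hF]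
    exact ⟨(F ⟨x.1, x.2.1⟩).2, (punctured_iff_support.1 x.2).2⟩
  have hp' : ∀ x : T.punctured, (F.symm ⟨x.1, x.2.1⟩ : V → ℝ) ∈ T.punctured := fun x => by
    rw [punctured_iff_support, hF']
    exact ⟨(F.symm ⟨x.1, x.2.1⟩).2, (punctured_iff_support.1 x.2).2⟩
  refine ⟨⟨fun x => ⟨_, hp x⟩, fun x => ⟨_, hp' x⟩, fun x => ?_, fun x => ?_⟩, fun x => rfl⟩
  · have h : (F.symm (F ⟨x.1, x.2.1⟩) : V → ℝ) = x := by rw [F.symm_apply_apply]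
    exact Subtype.ext h
  · have h : (F (F.symm ⟨x.1, x.2.1⟩) : V → ℝ) = x := by rw [F.apply_symm_apply]
    exact Subtype.ext h

end SurfaceTriangulation

namespace DiscreteMetric

open SurfaceTriangulation

variable {V : Type*} [DecidableEq V] {T : SurfaceTriangulation V} {l l' : DiscreteMetric T}

/-- The weights `d` on the vertices carry the squared lengths of `l'` to those of `l`. -/
def Weights (l l' : DiscreteMetric T) (d : V → ℝ) : Prop :=
  (∀ i, 0 < d i) ∧ ∀ i j, T.IsEdge i j → d i * d j * l'.sqLen i j = l.sqLen i j

theorem conformallyEquivalent_iff : l.ConformallyEquivalent l' ↔ ∃ d, l.Weights l' d := by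
  constructor
  · rintro ⟨u, hu⟩
    refine ⟨fun i => Real.exp (-u i), fun i => Real.exp_pos _, fun i j hij => ?_⟩
    rw [sqLen, sqLen, if_neg hij.1, if_neg hij.1, hu i j hij, mul_pow, ← Real.exp_nat_mul,
      ← mul_assoc, ← Real.exp_add, ← Real.exp_add]
    have : -u i + -u j + ((2 : ℕ) : ℝ) * ((u i + u j) / 2) = 0 := by push_cast; ring
    rw [this, Real.exp_zero, one_mul]
  · rintro ⟨d, hd, h⟩
    refine ⟨fun i => -Real.log (d i), fun i j hij => ?_⟩
    have hij' := h i j hij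
    have h1 := l.pos i j hij
    have h2 := l'.pos i j hij
    rw [sqLen, sqLen, if_neg hij.1, if_neg hij.1] at hij'
    rw [← sq_eq_sq₀ h2.le (by positivity), mul_pow, ← hij', ← Real.exp_nat_mul]
    have : ((2 : ℕ) : ℝ) * ((-Real.log (d i) + -Real.log (d j)) / 2) =
        -(Real.log (d i) + Real.log (d j)) := by push_cast; ring
    rw [this, Real.exp_neg, Real.exp_add, Real.exp_log (hd i), Real.exp_log (hd j),
      inv_mul_cancel_left₀ (mul_pos (hd i) (hd j)).ne']

/-- Weights that carry the squared lengths in the triangle `t` to each other, up to a factor, carry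
the forms of the triangles to each other. -/
theorem form_mul {t : Finset V} {d : V → ℝ} {μ : ℝ}
    (h : ∀ i ∈ t, ∀ j ∈ t, i ≠ j → d i * d j * l'.sqLen i j = μ * l.sqLen i j) (x y : V → ℝ) :
    l'.form t (d * x) (d * y) = μ * l.form t x y := by
  rw [form, form, mul_div_assoc', Finset.mul_sum]
  congr 1
  refine Finset.sum_congr rfl fun k hk => ?_
  rw [Finset.mul_sum]
  refine Finset.sum_congr rfl fun m hm => ?_
  by_cases hkm : k = m
  · subst hkm; simp
  · rw [Pi.mul_apply, Pi.mul_apply]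
    linear_combination (x k * y m) * h k hk m hm hkm

theorem triangleDist_scale {t : Finset V} (ht : t ∈ T.triangles) {d : V → ℝ} {μ : ℝ} (hμ : 0 < μ)
    (hd : ∀ i ∈ t, 0 < d i)
    (h : ∀ i ∈ t, ∀ j ∈ t, i ≠ j → d i * d j * l'.sqLen i j = μ * l.sqLen i j) {x y : V → ℝ}
    (hx : x ∈ puncturedSimplex t) (hy : y ∈ puncturedSimplex t) :
    l'.triangleDist ht (scale d x) (scale d y) = l.triangleDist ht x y := by
  rw [l'.triangleDist_eq ht (scale_mem_simplex hd hx.1) (scale_mem_simplex hd hy.1),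
    l.triangleDist_eq ht hx.1 hy.1, scale_eq hx.1.2.1, scale_eq hy.1.2.1,
    formDist_smul_left _ _ (inv_pos.2 (sum_mul_pos hd hx.1)),
    formDist_smul_right _ _ (inv_pos.2 (sum_mul_pos hd hy.1)), formDist, formDist, form_mul h,
    form_mul h, form_mul h, Real.sqrt_mul hμ.le, Real.sqrt_mul hμ.le,
    mul_mul_mul_comm, Real.mul_self_sqrt hμ.le, mul_div_mul_left _ _ hμ.ne']

/-! ### Isometries that respect the triangulation -/

/-- A bijection of the punctured surface that respects the triangulation is an isometry if it is
isometric on every triangle. -/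
theorem isHyperbolicIsometry_of_triangleDist {g : T.punctured ≃ T.punctured}
    (hs : ∀ x : T.punctured, Function.support (g x : V → ℝ) = Function.support (x : V → ℝ))
    (hg : ∀ (t : Finset V) (ht : t ∈ T.triangles) (x y : T.punctured),
      (x : V → ℝ) ∈ puncturedSimplex t → (y : V → ℝ) ∈ puncturedSimplex t →
      l'.triangleDist ht (g x) (g y) = l.triangleDist ht x y) : l.IsHyperbolicIsometry l' g := by
  classical
  have key : ∀ {l l' : DiscreteMetric T} (g : T.punctured ≃ T.punctured),
      (∀ x : T.punctured, Function.support (g x : V → ℝ) = Function.support (x : V → ℝ)) →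
      (∀ (t : Finset V) (ht : t ∈ T.triangles) (x y : T.punctured),
        (x : V → ℝ) ∈ puncturedSimplex t → (y : V → ℝ) ∈ puncturedSimplex t →
        l'.triangleDist ht (g x) (g y) = l.triangleDist ht x y) →
      ∀ x y : T.punctured, l'.hypDist (g x) (g y) ≤ l.hypDist x y := by
    intro l l' g hs hg x y
    obtain ⟨f, hf⟩ : ∃ f : (V → ℝ) → (V → ℝ), ∀ z : T.punctured, f z = g z :=
      ⟨fun z => if h : z ∈ T.punctured then g ⟨z, h⟩ else z, fun z => dif_pos z.2⟩
    have hchain : ∀ {a b L}, l.Chain a b L → l'.Chain (f a) (f b) L := by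
      intro a b L h
      induction h with
      | nil => exact Chain.nil _
      | @snoc p q L t ht _ hp hq ih =>
        have hp' := mem_punctured ht hp
        have hq' := mem_punctured ht hq
        have e := hg t ht ⟨p, hp'⟩ ⟨q, hq'⟩ hp hq
        rw [← hf, ← hf] at e
        change l'.triangleDist ht (f p) (f q) = l.triangleDist ht p q at e
        rw [← e]
        refine ih.snoc ht ?_ ?_
        · rw [hf ⟨p, hp'⟩]
          exact mem_puncturedSimplex_of_support_eq hp (g _).2.1 (hs ⟨p, hp'⟩)
        · rw [hf ⟨q, hq'⟩]
          exact mem_puncturedSimplex_of_support_eq hq (g _).2.1 (hs ⟨q, hq'⟩)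
    rw [← hf, ← hf, hypDist_eq_sInf (l := l)]
    exact le_csInf (l.exists_chain x.2 y.2) fun L hL => hypDist_le_of_chain (hchain hL)
  refine ⟨fun x y => le_antisymm (key g hs hg x y) ?_, hs⟩
  have hs' : ∀ x : T.punctured, Function.support (g.symm x : V → ℝ) =
      Function.support (x : V → ℝ) := fun x => by rw [← hs, g.apply_symm_apply]
  have := key g.symm hs' (l := l') (l' := l) (fun t ht x y hx hy => by
    have := hg t ht (g.symm x) (g.symm y)
      (mem_puncturedSimplex_of_support_eq hx (g.symm x).2.1 (hs' x))
      (mem_puncturedSimplex_of_support_eq hy (g.symm y).2.1 (hs' y))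
    rw [← this, g.apply_symm_apply, g.apply_symm_apply]) (g x) (g y)
  rwa [g.symm_apply_apply, g.symm_apply_apply] at this

theorem isHyperbolicIsometry_of_weights {d : V → ℝ} (hd : l.Weights l' d)
    {g : T.punctured ≃ T.punctured} (hg : Extends (T.scaleHomeo hd.1) g) :
    l.IsHyperbolicIsometry l' g := by
  have hg' : ∀ x : T.punctured, (g x : V → ℝ) = scale d x := fun x => (hg x).symm
  refine isHyperbolicIsometry_of_triangleDist (fun x => ?_) fun t ht x y hx hy => ?_
  · obtain ⟨t, -, hx⟩ := x.2.1
    rw [hg', support_scale (fun i _ => hd.1 i) hx]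
  · rw [hg', hg']
    refine triangleDist_scale ht one_pos (fun i _ => hd.1 i) (fun i hi j hj hij => ?_) hx hy
    rw [one_mul]
    exact hd.2 i j ⟨hij, pair_mem_faces ht hi hj⟩

theorem exists_extends_of_weights {d : V → ℝ} (hd : l.Weights l' d) :
    ∃ g : T.punctured ≃ T.punctured, Extends (T.scaleHomeo hd.1) g :=
  exists_restrict _ fun x => by
    obtain ⟨t, -, hx⟩ := x.2
    exact support_scale (fun i _ => hd.1 i) hx

namespace IsHyperbolicIsometry

variable {g : T.punctured ≃ T.punctured}

theorem symm (hg : l.IsHyperbolicIsometry l' g) : l'.IsHyperbolicIsometry l g.symm :=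
  ⟨fun x y => by rw [← hg.dist_eq, g.apply_symm_apply, g.apply_symm_apply],
    fun x => by rw [← hg.support_eq, g.apply_symm_apply]⟩

theorem mem (hg : l.IsHyperbolicIsometry l' g) {t : Finset V} {x : T.punctured}
    (hx : (x : V → ℝ) ∈ puncturedSimplex t) : (g x : V → ℝ) ∈ puncturedSimplex t :=
  mem_puncturedSimplex_of_support_eq hx (g x).2.1 (hg.support_eq x)

/-- An isometry preserves the hyperbolic distance of a triangle locally. -/
theorem exists_nhds (hg : l.IsHyperbolicIsometry l' g) {t : Finset V} (ht : t ∈ T.triangles)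
    {x : T.punctured} (hx : (x : V → ℝ) ∈ puncturedSimplex t) :
    ∃ U : Set (V → ℝ), IsOpen U ∧ (x : V → ℝ) ∈ U ∧ ∀ y z : T.punctured, (y : V → ℝ) ∈ U →
      (z : V → ℝ) ∈ U → (y : V → ℝ) ∈ puncturedSimplex t → (z : V → ℝ) ∈ puncturedSimplex t →
      l'.triangleDist ht (g y) (g z) = l.triangleDist ht y z := by
  obtain ⟨U, hU, h⟩ := l.restrictsToTriangles t ht x hx
  obtain ⟨U', hU', h'⟩ := l'.restrictsToTriangles t ht (g x) (hg.mem hx)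
  obtain ⟨ε, hε, hε'⟩ := exists_hypDist_lt (l := l') (g x).2 hU'
  obtain ⟨W, hW, hWU⟩ := mem_nhdsWithin_iff_exists_mem_nhds_inter.1
    (eventually_hypDist_lt (l := l) x.2 hε)
  obtain ⟨O, hO, hO', hxO⟩ := mem_nhds_iff.1 (inter_mem hU hW)
  have hmem : ∀ y : T.punctured, (y : V → ℝ) ∈ O → (g y : V → ℝ) ∈ U' := fun y hy =>
    hε' _ (g y).2 (by rw [hg.dist_eq]; exact hWU ⟨(hO hy).2, y.2⟩)
  refine ⟨O, hO', hxO, fun y z hy hz hyt hzt => ?_⟩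
  rw [← h y ⟨(hO hy).1, hyt⟩ z ⟨(hO hz).1, hzt⟩,
    ← h' _ ⟨hmem y hy, hg.mem hyt⟩ _ ⟨hmem z hz, hg.mem hzt⟩, hg.dist_eq]

/-- An isometry does not increase distances in a triangle: a geodesic of the triangle can be cut into
pieces on which the isometry preserves the distance of the triangle. -/
theorem triangleDist_le (hg : l.IsHyperbolicIsometry l' g) {t : Finset V} (ht : t ∈ T.triangles)
    {x y : T.punctured} (hx : (x : V → ℝ) ∈ puncturedSimplex t)
    (hy : (y : V → ℝ) ∈ puncturedSimplex t) :
    l'.triangleDist ht (g x) (g y) ≤ l.triangleDist ht x y := by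
  have hconv : ∀ s : Icc (0 : ℝ) 1,
      (1 - (s : ℝ)) • (x : V → ℝ) + (s : ℝ) • (y : V → ℝ) ∈ puncturedSimplex t := by
    rintro ⟨s, h0, h1⟩
    have hxc := mem_puncturedSimplex_iff.1 hx
    have hyc := mem_puncturedSimplex_iff.1 hy
    refine mem_puncturedSimplex_iff.2 ⟨?_, ?_⟩
    · rcases h0.eq_or_lt with rfl | h0
      · simpa using hxc.1
      · rcases h1.eq_or_lt with rfl | h1
        · simpa using hyc.1
        · exact add_mem_cone (smul_mem_cone hxc.1 (sub_pos.2 h1)) (smul_mem_cone hyc.1 h0)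
    · simp only [Pi.add_apply, Pi.smul_apply, smul_eq_mul, Finset.sum_add_distrib, ← Finset.mul_sum,
        hxc.2, hyc.2]
      ring
  obtain ⟨p, hp⟩ : ∃ p : Icc (0 : ℝ) 1 → T.punctured,
      ∀ s, (p s : V → ℝ) = (1 - (s : ℝ)) • (x : V → ℝ) + (s : ℝ) • (y : V → ℝ) :=
    ⟨fun s => ⟨_, mem_punctured ht (hconv s)⟩, fun _ => rfl⟩
  have hpt : ∀ s, (p s : V → ℝ) ∈ puncturedSimplex t := fun s => hp s ▸ hconv s
  have hcont : Continuous fun s => (p s : V → ℝ) := by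
    simp only [hp]
    fun_prop
  choose U hUo hUm hU using fun s => hg.exists_nhds ht (hpt s)
  obtain ⟨τ, hτ0, hmono, ⟨N, hN⟩, hcov⟩ := exists_monotone_Icc_subset_open_cover_Icc
    (zero_le_one (α := ℝ)) (c := fun s => (fun s' => (p s' : V → ℝ)) ⁻¹' U s)
    (fun s => (hUo s).preimage hcont) (fun s _ => mem_iUnion.2 ⟨s, hUm s⟩)
  have hadd : ∀ a b : Icc (0 : ℝ) 1, a ≤ b →
      l.triangleDist ht x (p a) + l.triangleDist ht (p a) (p b) = l.triangleDist ht x (p b) := by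
    intro a b hab
    have hab' : (a : ℝ) ≤ b := hab
    rw [l.triangleDist_eq ht hx.1 (hpt a).1, l.triangleDist_eq ht (hpt a).1 (hpt b).1,
      l.triangleDist_eq ht hx.1 (hpt b).1]
    -- If `b = 0`, then `a = 0` and the junk value of the quotient is the right one.
    have e : (p a : V → ℝ) = (1 - (a : ℝ) / b) • (x : V → ℝ) + ((a : ℝ) / b) • (p b : V → ℝ) := by
      have h1 : (a : ℝ) / b * b = a := by
        rcases b.2.1.eq_or_lt with h | h
        · have : (a : ℝ) = 0 := le_antisymm (hab'.trans h.symm.le) a.2.1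
          rw [this]; simp
        · field_simp
      rw [hp, hp, smul_add, smul_smul, smul_smul, ← add_assoc, ← add_smul, h1]
      congr 2
      linear_combination h1
    rw [e]
    refine formDist_add_formDist ht (mem_puncturedSimplex_iff.1 hx).1
      (mem_puncturedSimplex_iff.1 (hpt b)).1 ?_ (div_nonneg a.2.1 b.2.1) ?_
    · exact sub_nonneg.2 (div_le_one_of_le₀ hab' b.2.1)
    · rw [← e]; exact (mem_puncturedSimplex_iff.1 (hpt a)).1
  have hp0 : p (τ 0) = x := Subtype.ext (by rw [hp, hτ0]; simp)
  have hp1 : p (τ N) = y := Subtype.ext (by rw [hp, hN N le_rfl]; simp)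
  have main : ∀ n, l'.triangleDist ht (g x) (g (p (τ n))) ≤ l.triangleDist ht x (p (τ n)) := by
    intro n
    induction n with
    | zero => rw [hp0, triangleDist_self ht hx, triangleDist_self ht (hg.mem hx)]
    | succ n ih =>
      obtain ⟨s, hs⟩ := hcov n
      have hle := hmono n.le_succ
      have h1 := hU s (p (τ n)) (p (τ (n + 1))) (hs ⟨le_rfl, hle⟩) (hs ⟨hle, le_rfl⟩) (hpt _) (hpt _)
      have h2 : l'.triangleDist ht (g x) (g (p (τ (n + 1)))) ≤
          l'.triangleDist ht (g x) (g (p (τ n))) +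
            l'.triangleDist ht (g (p (τ n))) (g (p (τ (n + 1)))) := by
        rw [l'.triangleDist_eq ht (hg.mem hx).1 (hg.mem (hpt _)).1,
          l'.triangleDist_eq ht (hg.mem hx).1 (hg.mem (hpt _)).1,
          l'.triangleDist_eq ht (hg.mem (hpt _)).1 (hg.mem (hpt _)).1]
        exact formDist_triangle ht (mem_puncturedSimplex_iff.1 (hg.mem hx)).1
          (mem_puncturedSimplex_iff.1 (hg.mem (hpt _))).1
          (mem_puncturedSimplex_iff.1 (hg.mem (hpt _))).1
      linarith [hadd _ _ hle]
  have := main N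
  rwa [hp1] at this

theorem triangleDist_eq (hg : l.IsHyperbolicIsometry l' g) {t : Finset V} (ht : t ∈ T.triangles)
    {x y : T.punctured} (hx : (x : V → ℝ) ∈ puncturedSimplex t)
    (hy : (y : V → ℝ) ∈ puncturedSimplex t) :
    l'.triangleDist ht (g x) (g y) = l.triangleDist ht x y := by
  refine le_antisymm (hg.triangleDist_le ht hx hy) ?_
  have := hg.symm.triangleDist_le ht (hg.mem hx) (hg.mem hy)
  rwa [g.symm_apply_apply, g.symm_apply_apply] at this

end IsHyperbolicIsometry

end DiscreteMetric

namespace DiscreteMetric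

open SurfaceTriangulation

variable {V : Type*} [DecidableEq V] {T : SurfaceTriangulation V} {l l' : DiscreteMetric T}

/-! ### Isometries scale the barycentric coordinates -/

section cone

variable {t : Finset V} {G : (V → ℝ) → (V → ℝ)}

/-- A map of the cone over a triangle that preserves the form is linear, as the form is
nondegenerate. -/
theorem map_comb_of_form_eq (ht : t ∈ T.triangles) (hG : MapsTo G (cone t) (cone t))
    (hsurj : SurjOn G (cone t) (cone t))
    (hform : ∀ x ∈ cone t, ∀ y ∈ cone t, l'.form t (G x) (G y) = l.form t x y) {x y z : V → ℝ} {a : ℝ}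
    (hx : x ∈ cone t) (hy : y ∈ cone t) (hz : z ∈ cone t) {w : V → ℝ} (hw : w ∈ cone t)
    (h : x + y = a • z + w) : G x + G y = a • G z + G w := by
  suffices G x + G y - (a • G z + G w) = 0 from sub_eq_zero.1 this
  refine l'.eq_zero_of_form_eq_zero ht (fun i hi => ?_) fun p hp => ?_
  · simp [(hG hx).2.1 i hi, (hG hy).2.1 i hi, (hG hz).2.1 i hi, (hG hw).2.1 i hi]
  · obtain ⟨q, hq, rfl⟩ := hsurj hp
    rw [form_sub_left, form_add_left, form_add_left, form_smul_left, hform x hx q hq,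
      hform y hy q hq, hform z hz q hq, hform w hw q hq, ← form_add_left, h, form_add_left,
      form_smul_left, sub_self]

/-- A map of the cone over a triangle that preserves the form and all faces is diagonal. -/
theorem exists_diagonal (ht : t ∈ T.triangles)
    (hsupp : ∀ x ∈ cone t, Function.support (G x) = Function.support x)
    (hG : MapsTo G (cone t) (cone t)) (hsurj : SurjOn G (cone t) (cone t))
    (hform : ∀ x ∈ cone t, ∀ y ∈ cone t, l'.form t (G x) (G y) = l.form t x y) :
    ∃ d : V → ℝ, (∀ j ∈ t, 0 < d j) ∧ ∀ x ∈ cone t, G x = d * x := by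
  have key : ∀ j ∈ t, ∃ c : ℝ, 0 < c ∧ ∀ x ∈ cone t, G x j = c * x j := by
    intro j hj
    obtain ⟨i, k, hji, hjk, hik, rfl⟩ := exists_triangle_eq ht hj
    have hm := (mem_puncturedSimplex_iff.1
      (midpt_mem (t := {j, i, k}) (by simp : j ∈ _) (by simp : i ∈ _) hji)).1
    have hmj : midpt j i j = 1 / 2 := by simp [midpt, hji]
    have hpos : G (midpt j i) j ≠ 0 := by
      rw [← Function.mem_support, hsupp _ hm, Function.mem_support, hmj]
      norm_num
    have hpos : 0 < G (midpt j i) j := lt_of_le_of_ne ((hG hm).1 j) hpos.symm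
    refine ⟨2 * G (midpt j i) j, by positivity, fun x hx => ?_⟩
    -- Points of the opposite edge can be added without a change of the coordinate in question.
    have hedge : ∀ a b : ℝ, 0 < a → 0 < b → (Pi.single i a + Pi.single k b : V → ℝ) ∈ cone {j, i, k} ∧
        G (Pi.single i a + Pi.single k b) j = 0 := by
      intro a b ha hb
      have hc : (Pi.single i a + Pi.single k b : V → ℝ) ∈ cone {j, i, k} := by
        refine ⟨fun m => ?_, fun m hm => ?_, i, k, hik, ?_, ?_⟩
        · simp only [Pi.add_apply, Pi.single_apply]
          split_ifs <;> positivity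
        · simp only [Finset.mem_insert, Finset.mem_singleton, not_or] at hm
          simp [hm.2.1, hm.2.2]
        · simpa [hik] using ha
        · simpa [hik.symm] using hb
      refine ⟨hc, ?_⟩
      have : j ∉ Function.support (Pi.single i a + Pi.single k b : V → ℝ) := by
        simp [hji, hjk]
      rw [← hsupp _ hc] at this
      exact Function.notMem_support.1 this
    obtain ⟨h1, h1'⟩ := hedge (x j + 1) 1 (by linarith [hx.1 j]) one_pos
    obtain ⟨h2, h2'⟩ := hedge (x i + 1) (x k + 1) (by linarith [hx.1 i]) (by linarith [hx.1 k])
    have h := map_comb_of_form_eq ht hG hsurj hform (a := 2 * x j) hx h1 hm h2 (by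
      funext m
      simp only [midpt, Pi.add_apply, Pi.smul_apply, Pi.single_apply, smul_eq_mul]
      by_cases h : m ∈ ({j, i, k} : Finset V)
      · simp only [Finset.mem_insert, Finset.mem_singleton] at h
        rcases h with rfl | rfl | rfl
        · simp [hji, hjk]; ring
        · simp [hji.symm, hik]; ring
        · simp [hjk.symm, hik.symm]
      · rw [hx.2.1 m h]
        simp only [Finset.mem_insert, Finset.mem_singleton, not_or] at h
        simp [h.1, h.2.1, h.2.2])
    have h := congrFun h j
    simp only [Pi.add_apply, Pi.smul_apply, smul_eq_mul, h1', h2', add_zero] at h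
    rw [h]; ring
  choose c hc hc' using key
  refine ⟨fun j => if hj : j ∈ t then c j hj else 0, fun j hj => ?_, fun x hx => ?_⟩
  · simpa [hj] using hc j hj
  · funext j
    by_cases hj : j ∈ t
    · rw [hc' j hj x hx, Pi.mul_apply, dif_pos hj]
    · rw [Pi.mul_apply, hx.2.1 j hj, (hG hx).2.1 j hj, mul_zero]

end cone

theorem form_midpt {t : Finset V} (ht : t ∈ T.triangles) {i j : V} (hi : i ∈ t) (hj : j ∈ t)
    (hij : i ≠ j) (d : V → ℝ) :
    l.form t (d * midpt i j) (d * midpt i j) = d i * d j * l.sqLen i j / 4 := by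
  obtain ⟨k, hik, hjk, rfl⟩ := exists_triangle_eq₂ ht hi hj hij
  rw [l.form_triple hij hik hjk]
  simp [midpt, hij, hij.symm, hik.symm, hjk.symm]
  ring

namespace IsHyperbolicIsometry

variable {g : T.punctured ≃ T.punctured}

/-- On each triangle, an isometry scales the barycentric coordinates, with weights that carry the
squared lengths to each other. -/
theorem exists_scale (hg : l.IsHyperbolicIsometry l' g) {t : Finset V} (ht : t ∈ T.triangles) :
    ∃ d : V → ℝ, (∀ j ∈ t, 0 < d j) ∧
      (∀ x : T.punctured, (x : V → ℝ) ∈ puncturedSimplex t → (g x : V → ℝ) = scale d x) ∧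
      ∀ i ∈ t, ∀ j ∈ t, i ≠ j → d i * d j * l'.sqLen i j = l.sqLen i j := by
  classical
  obtain ⟨f, hf⟩ : ∃ f : (V → ℝ) → (V → ℝ), ∀ z : T.punctured, f z = g z :=
    ⟨fun z => if h : z ∈ T.punctured then g ⟨z, h⟩ else z, fun z => dif_pos z.2⟩
  -- Points of the cone over the triangle are determined by their radial projections and their norms.
  set c : (V → ℝ) → ℝ := fun x => √(l.form t x x) /
    √(l'.form t (f (radialProj x)) (f (radialProj x))) with hcdef
  set G : (V → ℝ) → (V → ℝ) := fun x => c x • f (radialProj x) with hGdef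
  have hmem : ∀ x ∈ cone t, radialProj x ∈ T.punctured := fun x hx =>
    mem_punctured ht (radialProj_mem hx)
  have hf1 : ∀ x ∈ cone t, f (radialProj x) ∈ puncturedSimplex t := fun x hx =>
    hf ⟨_, hmem x hx⟩ ▸ hg.mem (x := ⟨_, hmem x hx⟩) (radialProj_mem hx)
  have hf2 : ∀ x ∈ cone t, f (radialProj x) ∈ cone t := fun x hx =>
    (mem_puncturedSimplex_iff.1 (hf1 x hx)).1
  have hc : ∀ x ∈ cone t, 0 < c x := fun x hx =>
    div_pos (Real.sqrt_pos.2 (l.form_pos ht hx hx))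
      (Real.sqrt_pos.2 (l'.form_pos ht (hf2 x hx) (hf2 x hx)))
  have hG : MapsTo G (cone t) (cone t) := fun x hx => smul_mem_cone (hf2 x hx) (hc x hx)
  have hsupp : ∀ x ∈ cone t, Function.support (G x) = Function.support x := by
    intro x hx
    rw [← support_radialProj hx, ← hg.support_eq ⟨_, hmem x hx⟩, ← hf]
    exact Function.support_const_smul_of_ne_zero _ _ (hc x hx).ne'
  have hnorm : ∀ x ∈ cone t, l'.form t (G x) (G x) = l.form t x x := by
    intro x hx
    have h1 := l'.form_pos ht (hf2 x hx) (hf2 x hx)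
    rw [hGdef, form_smul_left, form_smul_right, ← mul_assoc, ← sq, hcdef]
    simp only
    rw [div_pow, Real.sq_sqrt (l.form_pos ht hx hx).le, Real.sq_sqrt h1.le,
      div_mul_cancel₀ _ h1.ne']
  have hrad : ∀ x ∈ cone t, ∃ r : ℝ, 0 < r ∧ radialProj x = r • x := fun x hx =>
    ⟨_, inv_pos.2 (sum_pos_of_mem_cone hx), by rw [radialProj, finsum_eq_of_cone hx.2.1]⟩
  have hform : ∀ x ∈ cone t, ∀ y ∈ cone t, l'.form t (G x) (G y) = l.form t x y := by
    intro x hx y hy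
    have h := hg.triangleDist_eq ht (x := ⟨_, hmem x hx⟩) (y := ⟨_, hmem y hy⟩)
      (radialProj_mem hx) (radialProj_mem hy)
    rw [← hf, ← hf, l'.triangleDist_eq ht (hf1 x hx).1 (hf1 y hy).1,
      l.triangleDist_eq ht (radialProj_mem hx).1 (radialProj_mem hy).1] at h
    obtain ⟨r, hr, hr'⟩ := hrad x hx
    obtain ⟨s, hs, hs'⟩ := hrad y hy
    have h' : l'.formDist t (G x) (G y) = l.formDist t x y := by
      rw [hGdef, formDist_smul_left _ _ (hc x hx), formDist_smul_right _ _ (hc y hy), h]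
      rw [hr', hs', formDist_smul_left _ _ hr, formDist_smul_right _ _ hs]
    have h' := congrArg Real.cosh h'
    rw [cosh_formDist ht (hG hx) (hG hy), cosh_formDist ht hx hy, hnorm x hx, hnorm y hy] at h'
    have hpos := mul_pos (Real.sqrt_pos.2 (l.form_pos ht hx hx)) (Real.sqrt_pos.2 (l.form_pos ht hy hy))
    exact (div_left_inj' hpos.ne').1 h'
  have hproj : ∀ x ∈ cone t, radialProj (G x) = f (radialProj x) := fun x hx => by
    rw [hGdef]
    simp only
    rw [radialProj_smul (hc x hx).ne', radialProj_eq_self (hf1 x hx).1]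
  have hsurj : SurjOn G (cone t) (cone t) := by
    intro y hy
    obtain ⟨z, hz⟩ := g.surjective ⟨_, hmem y hy⟩
    have hzt : (z : V → ℝ) ∈ puncturedSimplex t := by
      have := hg.symm.mem (x := ⟨_, hmem y hy⟩) (radialProj_mem hy)
      rwa [← hz, g.symm_apply_apply] at this
    have hzc := (mem_puncturedSimplex_iff.1 hzt).1
    obtain ⟨s, hs, hs'⟩ := hrad y hy
    have e : f (radialProj z) = s • y := by
      rw [radialProj_eq_self hzt.1, hf, hz]
      exact hs'
    have hcz := hc _ hzc
    refine ⟨(c z * s)⁻¹ • (z : V → ℝ), smul_mem_cone hzc (by positivity), ?_⟩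
    have hr : 0 < (c z * s)⁻¹ := by positivity
    have e2 : c ((c z * s)⁻¹ • (z : V → ℝ)) = (c z * s)⁻¹ * c z := by
      rw [hcdef]
      simp only
      rw [radialProj_smul hr.ne', form_smul_left, form_smul_right, ← mul_assoc,
        Real.sqrt_mul (by positivity), Real.sqrt_mul_self hr.le, mul_div_assoc]
    rw [hGdef]
    simp only
    rw [e2, radialProj_smul hr.ne', e, smul_smul]
    have : (c z * s)⁻¹ * c z * s = 1 := by field_simp
    rw [this, one_smul]
  obtain ⟨d, hd, hd'⟩ := exists_diagonal ht hsupp hG hsurj hform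
  refine ⟨d, hd, fun x hx => ?_, fun i hi j hj hij => ?_⟩
  · have h1 := (mem_puncturedSimplex_iff.1 hx).1
    have := hproj x h1
    rw [radialProj_eq_self hx.1, hf, hd' x h1] at this
    exact this.symm
  · have h1 := (mem_puncturedSimplex_iff.1 (midpt_mem hi hj hij)).1
    have h2 := hform _ h1 _ h1
    rw [hd' _ h1, form_midpt ht hi hj hij] at h2
    have h3 := form_midpt (l := l) ht hi hj hij 1
    rw [one_mul] at h3
    rw [h3] at h2
    simp only [Pi.one_apply, one_mul] at h2
    linarith

/-- An isometry that respects the triangulation scales the barycentric coordinates, with weights on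
the vertices that carry the squared lengths to each other. -/
theorem exists_weights (hg : l.IsHyperbolicIsometry l' g) :
    ∃ d : V → ℝ, l.Weights l' d ∧ ∀ x : T.punctured, (g x : V → ℝ) = scale d x := by
  choose! D hD hDg hDl using fun t (ht : t ∈ T.triangles) => hg.exists_scale ht
  -- The weights at the ends of an edge are determined by their product and their quotient.
  have edge : ∀ s ∈ T.triangles, ∀ t ∈ T.triangles, ∀ i j, i ≠ j → i ∈ s → j ∈ s → i ∈ t → j ∈ t →
      D s i = D t i := by
    intro s hs t ht i j hij his hjs hit hjt
    have h1 : D s i * D s j = D t i * D t j :=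
      mul_right_cancel₀ (l'.sqLen_pos_of_mem hs his hjs hij).ne'
        ((hDl s hs i his j hjs hij).trans (hDl t ht i hit j hjt hij).symm)
    have hms := midpt_mem his hjs hij
    have hmt := midpt_mem hit hjt hij
    have h2 : scale (D s) (midpt i j) = scale (D t) (midpt i j) :=
      (hDg s hs ⟨_, mem_punctured hs hms⟩ hms).symm.trans (hDg t ht ⟨_, mem_punctured hs hms⟩ hmt)
    rw [scale_eq hms.1.2.1, scale_eq hmt.1.2.1] at h2
    have p1 := sum_mul_pos (hD s hs) hms.1
    have p2 := sum_mul_pos (hD t ht) hmt.1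
    have e1 := congrFun h2 i
    have e2 := congrFun h2 j
    have m1 : midpt i j i = 1 / 2 := by simp [midpt, hij]
    have m2 : midpt i j j = 1 / 2 := by simp [midpt, hij.symm]
    simp only [Pi.smul_apply, Pi.mul_apply, smul_eq_mul, m1, m2] at e1 e2
    have q1 := hD s hs i his
    have q2 := hD s hs j hjs
    have q3 := hD t ht i hit
    have q4 := hD t ht j hjt
    set A := (∑ k ∈ s, D s k * midpt i j k)⁻¹
    set B := (∑ k ∈ t, D t k * midpt i j k)⁻¹
    have hA : 0 < A := inv_pos.2 p1
    have hB : 0 < B := inv_pos.2 p2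
    have e3 : D s i * D t j = D t i * D s j := by
      refine mul_left_cancel₀ (mul_pos hA hB).ne' ?_
      linear_combination (2 * B * D t j) * e1 - (2 * B * D t i) * e2
    have e4 : D s i ^ 2 = D t i ^ 2 := by
      refine mul_left_cancel₀ (mul_pos q2 q4).ne' ?_
      linear_combination (D s i * D t j) * h1 + (D t i * D t j) * e3
    exact (sq_eq_sq₀ q1.le q3.le).1 e4
  have link : ∀ s ∈ T.triangles, ∀ t ∈ T.triangles, ∀ i, i ∈ s → i ∈ t → D s i = D t i := by
    intro s hs t ht i his hit
    obtain ⟨j, j', hij, hij', hjj', rfl⟩ := exists_triangle_eq hs his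
    obtain ⟨k, k', hik, hik', hkk', rfl⟩ := exists_triangle_eq ht hit
    have hj := pair_mem_faces hs his (by simp : j ∈ _)
    have hk := pair_mem_faces ht hit (by simp : k ∈ _)
    refine (SimpleGraph.Connected.induction_on (T.connected_link i)
      (P := fun a => ∀ r ∈ T.triangles, i ∈ r → a.1 ∈ r → D {i, j, j'} i = D r i) ?_
      (a := ⟨j, hij.symm, hj⟩) (fun r hr hir hjr => edge _ hs _ hr i j hij his (by simp) hir hjr)
      ⟨k, hik.symm, hk⟩) _ ht hit (by simp)
    rintro ⟨a, ha, ha'⟩ ⟨b, hb, hb'⟩ ⟨hab, hf⟩ ih r hr hir hbr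
    have hab : a ≠ b := fun h => hab (Subtype.ext h)
    have hr' := (triple_mem_triangles ha.symm hb.symm hab).2 hf
    rw [ih _ hr' (by simp) (by simp)]
    exact edge _ hr' _ hr i b hb.symm (by simp) (by simp) hir hbr
  choose S hS hiS using fun i : V => show ∃ t ∈ T.triangles, i ∈ t by
    obtain ⟨t, ht, ht', hi⟩ := T.pure {i} (T.singleton_mem i)
    exact ⟨t, ⟨ht, ht'⟩, hi (by simp)⟩
  have hSt : ∀ t ∈ T.triangles, ∀ i ∈ t, D (S i) i = D t i := fun t ht i hi =>
    link _ (hS i) _ ht i (hiS i) hi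
  refine ⟨fun i => D (S i) i, ⟨fun i => hD _ (hS i) i (hiS i), fun i j hij => ?_⟩, fun x => ?_⟩
  · obtain ⟨t, ht, ht', hijt⟩ := T.pure _ hij.2
    have hi : i ∈ t := hijt (by simp)
    have hj : j ∈ t := hijt (by simp)
    simp only [hSt t ⟨ht, ht'⟩ i hi, hSt t ⟨ht, ht'⟩ j hj]
    exact hDl t ⟨ht, ht'⟩ i hi j hj hij.1
  · obtain ⟨t, ht, hx⟩ := mem_punctured_iff.1 x.2
    rw [hDg t ht x hx, scale, scale]
    congr 1
    funext i
    by_cases hi : i ∈ t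
    · simp [hSt t ht i hi]
    · simp [hx.1.2.1 i hi]

end IsHyperbolicIsometry

end DiscreteMetric

/-! ### Projective maps between triangles -/

theorem projMap_toProj {A : (Plane × ℝ) ≃ₗ[ℝ] (Plane × ℝ)} {p q : Plane} :
    projMap A (toProj p) = toProj q ↔ ∃ c : ℝ, c ≠ 0 ∧ A (p, 1) = c • (q, 1) := by
  rw [toProj, toProj, projMap, Projectivization.map_mk, Projectivization.mk_eq_mk_iff']
  constructor
  · rintro ⟨c, hc⟩
    refine ⟨c, ?_, hc.symm⟩
    rintro rfl
    rw [zero_smul] at hc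
    have := A.map_eq_zero_iff.1 hc.symm
    exact one_ne_zero (congrArg Prod.snd this)
  · rintro ⟨c, -, hc⟩
    exact ⟨c, hc.symm⟩

namespace DiscreteMetric

open SurfaceTriangulation

variable {V : Type*} [DecidableEq V] {T : SurfaceTriangulation V} {l l' : DiscreteMetric T}

namespace Placement

variable {t : Finset V}

/-- The point of a euclidean triangle with homogeneous barycentric coordinates `x`, in homogeneous
coordinates of the plane. -/
def homog (P : l.Placement t) (x : V → ℝ) : Plane × ℝ := ∑ i ∈ t, x i • (P.pt i, 1)

theorem homog_eq (P : l.Placement t) (x : V → ℝ) : P.homog x = (P.point x, ∑ i ∈ t, x i) := by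
  rw [homog, point, Prod.ext_iff]
  simp [Prod.fst_sum, Prod.snd_sum]

theorem homog_of_mem (P : l.Placement t) {x : V → ℝ} (hx : x ∈ simplex t) :
    P.homog x = (P.point x, 1) := by
  rw [homog_eq, hx.2.2]

theorem homog_smul (P : l.Placement t) (c : ℝ) (x : V → ℝ) : P.homog (c • x) = c • P.homog x := by
  simp only [homog, Finset.smul_sum, Pi.smul_apply, smul_eq_mul, mul_smul]

theorem homog_sub (P : l.Placement t) (x y : V → ℝ) :
    P.homog (x - y) = P.homog x - P.homog y := by
  simp only [homog, Pi.sub_apply, sub_smul, Finset.sum_sub_distrib]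

theorem homog_congr (P : l.Placement t) {x y : V → ℝ} (h : ∀ i ∈ t, x i = y i) :
    P.homog x = P.homog y :=
  Finset.sum_congr rfl fun i hi => by rw [h i hi]

theorem point_vertex (P : l.Placement t) {i : V} (hi : i ∈ t) : P.point (vertex i) = P.pt i := by
  rw [point, Finset.sum_eq_single i (fun j _ hj => by simp [vertex, hj]) (fun h => absurd hi h)]
  simp [vertex]

end Placement

section triangle

variable {t : Finset V} (ht : t ∈ T.triangles)

/-- The form of a triangle in homogeneous coordinates of the plane. -/
theorem form_self_eq (x : V → ℝ) : l.form t x x =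
    ((l.placement ht).circ.radius * ((l.placement ht).homog x).2) ^ 2 -
      ‖((l.placement ht).homog x).1 -
        ((l.placement ht).homog x).2 • (l.placement ht).circ.center‖ ^ 2 := by
  rw [form_eq_inner l ht, Placement.homog_eq, real_inner_self_eq_norm_sq]
  have : ∑ i ∈ t, x i • ((l.placement ht).pt i - (l.placement ht).circ.center) =
      (l.placement ht).point x - (∑ i ∈ t, x i) • (l.placement ht).circ.center := by
    simp only [smul_sub, Finset.sum_sub_distrib, ← Finset.sum_smul]
    rfl
  rw [this]
  ring

theorem eq_zero_of_homog_eq_zero {x : V → ℝ} (hx : ∀ i, i ∉ t → x i = 0)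
    (h : (l.placement ht).homog x = 0) : x = 0 := by
  have h0 : ∀ z, (l.placement ht).homog z = (l.placement ht).homog (z - x) := fun z => by
    rw [Placement.homog_sub, h, sub_zero]
  refine l.eq_zero_of_form_eq_zero ht hx fun y _ => ?_
  have h1 := form_self_eq (l := l) ht x
  have h2 := form_self_eq (l := l) ht y
  have h3 := form_self_eq (l := l) ht (x + y)
  rw [h0 (x + y), add_sub_cancel_left, ← h2] at h3
  rw [h] at h1
  simp only [form_add_left, form_add_right, l.form_comm t y x] at h3
  simp only [Prod.fst_zero, Prod.snd_zero, zero_smul, sub_zero, norm_zero, mul_zero] at h1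
  linarith

/-- The homogeneous barycentric coordinates of a triangle are linear coordinates on the space of
homogeneous coordinates of the plane. -/
def homogEquiv : (t → ℝ) ≃ₗ[ℝ] Plane × ℝ :=
  LinearMap.linearEquivOfInjective
    (Fintype.linearCombination ℝ fun i : t => ((l.placement ht).pt i, (1 : ℝ)))
    (by
      rw [← LinearMap.ker_eq_bot, LinearMap.ker_eq_bot']
      intro y hy
      have hx : ∀ i : t, (fun j => if h : j ∈ t then y ⟨j, h⟩ else 0) (i : V) = y i := fun i => by
        simp
      have := eq_zero_of_homog_eq_zero ht (l := l) (x := fun j => if h : j ∈ t then y ⟨j, h⟩ else 0)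
        (fun i hi => by simp [hi]) (by
          rw [Placement.homog, ← Finset.sum_coe_sort]
          simp only [hx]
          exact hy)
      funext i
      rw [← hx i, this]
      rfl)
    (by
      rw [Module.finrank_fintype_fun_eq_card, Fintype.card_coe, ht.2, Module.finrank_prod,
        finrank_euclideanSpace_fin, Module.finrank_self])

theorem homogEquiv_apply (x : V → ℝ) :
    homogEquiv (l := l) ht (fun i => x i) = (l.placement ht).homog x := by
  rw [Placement.homog, ← Finset.sum_coe_sort]
  rfl

theorem exists_homog_eq (p : Plane × ℝ) : ∃ x : V → ℝ, (l.placement ht).homog x = p := by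
  obtain ⟨y, rfl⟩ := (homogEquiv (l := l) ht).surjective p
  refine ⟨fun j => if h : j ∈ t then y ⟨j, h⟩ else 0, ?_⟩
  rw [← homogEquiv_apply]
  congr 1
  funext i
  simp

/-- The projective maps between two triangles that map each vertex to the corresponding one scale
the homogeneous barycentric coordinates. -/
theorem exists_linearEquiv {d : V → ℝ} (hd : ∀ i ∈ t, d i ≠ 0) :
    ∃ A : (Plane × ℝ) ≃ₗ[ℝ] (Plane × ℝ),
      ∀ x, A ((l.placement ht).homog x) = (l'.placement ht).homog (d * x) := by
  refine ⟨(homogEquiv (l := l) ht).symm ≪≫ₗ (LinearEquiv.piCongrRight fun i : t =>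
    LinearEquiv.smulOfNeZero ℝ ℝ (d i) (hd i i.2)) ≪≫ₗ homogEquiv (l := l') ht, fun x => ?_⟩
  rw [← homogEquiv_apply, ← homogEquiv_apply, LinearEquiv.trans_apply, LinearEquiv.trans_apply,
    LinearEquiv.symm_apply_apply]
  rfl

theorem radius_nonneg : 0 ≤ (l.placement ht).circ.radius := by
  obtain ⟨i, hi⟩ : t.Nonempty := Finset.card_pos.1 (by rw [ht.2]; norm_num)
  rw [← (l.placement ht).pt_mem i hi]
  exact dist_nonneg

/-- A point lies on the circumcircle if and only if the form of the triangle vanishes on it. -/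
theorem mem_circ_iff {x : V → ℝ} {c : ℝ} (hc : c ≠ 0) {p : Plane}
    (hx : (l.placement ht).homog x = c • (p, 1)) :
    p ∈ (l.placement ht).circ ↔ l.form t x x = 0 := by
  rw [form_self_eq ht, hx]
  simp only [Prod.smul_fst, Prod.smul_snd, smul_eq_mul, mul_one]
  rw [← smul_sub, norm_smul, mul_pow, mul_pow, mul_comm, Real.norm_eq_abs, sq_abs, ← mul_sub,
    mul_eq_zero, or_iff_right (pow_ne_zero 2 hc), sub_eq_zero, EuclideanGeometry.mem_sphere,
    dist_eq_norm, sq_eq_sq₀ (radius_nonneg ht) (norm_nonneg _), eq_comm]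

/-- Points at infinity do not lie on the circumcircle. -/
theorem exists_of_form_eq_zero {x : V → ℝ} (hx : (l.placement ht).homog x ≠ 0)
    (h : l.form t x x = 0) : ∃ p : Plane, ∃ c : ℝ, c ≠ 0 ∧ (l.placement ht).homog x = c • (p, 1) := by
  have hc : ((l.placement ht).homog x).2 ≠ 0 := by
    intro h0
    rw [form_self_eq ht, h0, mul_zero, zero_smul, sub_zero] at h
    refine hx (Prod.ext ?_ h0)
    simpa using h
  exact ⟨((l.placement ht).homog x).2⁻¹ • ((l.placement ht).homog x).1, _, hc,
    Prod.ext (by simp [smul_smul, hc]) (by simp)⟩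

theorem exists_mem_circ {A : (Plane × ℝ) ≃ₗ[ℝ] (Plane × ℝ)} {d : V → ℝ}
    (hA : ∀ x, A ((l.placement ht).homog x) = (l'.placement ht).homog (d * x)) {μ : ℝ}
    (hd : ∀ x, l'.form t (d * x) (d * x) = μ * l.form t x x) {p : Plane}
    (hp : p ∈ (l.placement ht).circ) :
    ∃ q ∈ (l'.placement ht).circ, projMap A (toProj p) = toProj q := by
  obtain ⟨x, hx⟩ := exists_homog_eq (l := l) ht (p, 1)
  have h0 := (mem_circ_iff ht one_ne_zero (by rw [hx, one_smul])).1 hp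
  have h1 : l'.form t (d * x) (d * x) = 0 := by rw [hd, h0, mul_zero]
  have h2 := hA x
  rw [hx] at h2
  obtain ⟨q, c, hc, hq⟩ := exists_of_form_eq_zero (l := l') ht (by
    rw [← h2]
    exact fun h => one_ne_zero (congrArg Prod.snd (A.map_eq_zero_iff.1 h))) h1
  exact ⟨q, (mem_circ_iff ht hc hq).2 h1, projMap_toProj.2 ⟨c, hc, h2.trans hq⟩⟩

/-- Scaling of the barycentric coordinates is a projective map, which respects the circumcircles if
the weights carry the squared lengths to each other. -/
theorem exists_projMap {d : V → ℝ} (hd : ∀ i ∈ t, 0 < d i)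
    (h : ∀ i ∈ t, ∀ j ∈ t, i ≠ j → d i * d j * l'.sqLen i j = l.sqLen i j) :
    ∃ A : (Plane × ℝ) ≃ₗ[ℝ] (Plane × ℝ),
      (fun p => projMap A (toProj p)) '' {p | p ∈ (l.placement ht).circ} =
        toProj '' {p | p ∈ (l'.placement ht).circ} ∧
      ∀ x ∈ simplex t, projMap A (toProj ((l.placement ht).point x)) =
        toProj ((l'.placement ht).point (scale d x)) := by
  obtain ⟨A, hA⟩ := exists_linearEquiv (l := l) (l' := l') ht fun i hi => (hd i hi).ne'
  have h1 : ∀ x, l'.form t (d * x) (d * x) = 1 * l.form t x x := fun x =>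
    form_mul (fun i hi j hj hij => by rw [h i hi j hj hij, one_mul]) x x
  have h2 : ∀ x, l.form t (d⁻¹ * x) (d⁻¹ * x) = 1 * l'.form t x x := fun x =>
    form_mul (fun i hi j hj hij => by
      have := (hd i hi).ne'
      have := (hd j hj).ne'
      rw [← h i hi j hj hij, Pi.inv_apply, Pi.inv_apply]
      field_simp) x x
  have hA' : ∀ x, A.symm ((l'.placement ht).homog x) = (l.placement ht).homog (d⁻¹ * x) := by
    intro x
    rw [LinearEquiv.symm_apply_eq, hA]
    refine Placement.homog_congr _ fun i hi => ?_
    have := (hd i hi).ne'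
    simp only [Pi.mul_apply, Pi.inv_apply]
    field_simp
  refine ⟨A, Subset.antisymm ?_ ?_, fun x hx => ?_⟩
  · rintro _ ⟨p, hp, rfl⟩
    obtain ⟨q, hq, e⟩ := exists_mem_circ ht hA h1 hp
    exact ⟨q, hq, e.symm⟩
  · rintro _ ⟨q, hq, rfl⟩
    obtain ⟨p, hp, e⟩ := exists_mem_circ ht hA' h2 hq
    obtain ⟨c, hc, e⟩ := projMap_toProj.1 e
    refine ⟨p, hp, projMap_toProj.2 ⟨c⁻¹, inv_ne_zero hc, ?_⟩⟩
    rw [LinearEquiv.symm_apply_eq, map_smul] at e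
    rw [e, smul_smul, inv_mul_cancel₀ hc, one_smul]
  · refine projMap_toProj.2 ⟨_, (sum_mul_pos hd hx).ne', ?_⟩
    rw [← Placement.homog_of_mem _ hx, ← Placement.homog_of_mem _ (scale_mem_simplex hd hx), hA,
      scale_eq hx.2.1, Placement.homog_smul, smul_smul, mul_inv_cancel₀ (sum_mul_pos hd hx).ne',
      one_smul]

end triangle

theorem scale_vertex {d : V → ℝ} {i : V} (hi : d i ≠ 0) : scale d (vertex i) = vertex i := by
  have : d * vertex i = d i • vertex i := by
    funext j
    by_cases h : j = i
    · subst h; simp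
    · simp [vertex, h]
  rw [scale, this, radialProj_smul hi,
    radialProj_eq_self (vertex_mem_simplex (Finset.mem_singleton_self i))]

theorem isDiscreteConformalMap_of_weights {d : V → ℝ} (hd : l.Weights l' d) :
    l.IsDiscreteConformalMap l' (T.scaleHomeo hd.1) := by
  intro t ht
  obtain ⟨A, h1, h2⟩ := exists_projMap (l := l) (l' := l') ht (fun i _ => hd.1 i)
    fun i hi j hj hij => hd.2 i j ⟨hij, pair_mem_faces ht hi hj⟩
  refine ⟨A, fun i hi => ?_, h1, fun x hx => ⟨scale_mem_simplex (fun i _ => hd.1 i) hx, h2 x hx⟩⟩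
  have := h2 _ (vertex_mem_simplex hi)
  rwa [scale_vertex (hd.1 i).ne', Placement.point_vertex _ hi, Placement.point_vertex _ hi] at this

/-! ### Discrete conformal maps scale the barycentric coordinates -/

/-- Two forms are proportional if one of them vanishes on the circumcircle of the other. -/
theorem exists_proportional {t : Finset V} (ht : t ∈ T.triangles) {c : V → ℝ}
    (h : ∀ x : V → ℝ, l.form t x x = 0 → l'.form t (c * x) (c * x) = 0) :
    ∃ μ : ℝ, ∀ i ∈ t, ∀ j ∈ t, i ≠ j → c i * c j * l'.sqLen i j = μ * l.sqLen i j := by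
  obtain ⟨i, j, k, hij, hik, hjk, rfl⟩ := Finset.card_eq_three.1 ht.2
  have hij' := l.sqLen_pos_of_mem ht (by simp : i ∈ _) (by simp : j ∈ _) hij
  have hik' := l.sqLen_pos_of_mem ht (by simp : i ∈ _) (by simp : k ∈ _) hik
  have hjk' := l.sqLen_pos_of_mem ht (by simp : j ∈ _) (by simp : k ∈ _) hjk
  -- Test with the second intersection of the circumcircle with lines through the vertex `k`.
  have key : ∀ τ : ℝ, 0 < τ →
      (l.sqLen i k + τ * l.sqLen j k) * (c i * c j * l'.sqLen i j) -
        l.sqLen i j * (c i * c k * l'.sqLen i k) -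
        τ * l.sqLen i j * (c j * c k * l'.sqLen j k) = 0 := by
    intro τ hτ
    have hD : 0 < l.sqLen i k + τ * l.sqLen j k := by positivity
    set D := l.sqLen i k + τ * l.sqLen j k with hDdef
    have h1 := h (Pi.single i D + Pi.single j (τ * D) + Pi.single k (-(l.sqLen i j * τ))) (by
      rw [l.form_triple hij hik hjk]
      simp only [Pi.add_apply, Pi.single_apply, hij, hik, hjk, hij.symm, hik.symm, hjk.symm,
        if_false, if_true, add_zero, zero_add]
      linear_combination (τ * D * l.sqLen i j) * hDdef)
    rw [l'.form_triple hij hik hjk] at h1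
    simp only [Pi.add_apply, Pi.mul_apply, Pi.single_apply, hij, hik, hjk, hij.symm, hik.symm,
      hjk.symm, if_false, if_true, add_zero, zero_add] at h1
    refine mul_left_cancel₀ (mul_pos hτ hD).ne' ?_
    linear_combination h1
  have h1 := key 1 one_pos
  have h2 := key 2 two_pos
  have e1 : l.sqLen j k * (c i * c j * l'.sqLen i j) = l.sqLen i j * (c j * c k * l'.sqLen j k) := by
    linarith
  have e2 : l.sqLen i k * (c i * c j * l'.sqLen i j) = l.sqLen i j * (c i * c k * l'.sqLen i k) := by
    linarith
  have f0 : c i * c j * l'.sqLen i j = c i * c j * l'.sqLen i j / l.sqLen i j * l.sqLen i j := by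
    field_simp
  have f1 : c j * c k * l'.sqLen j k = c i * c j * l'.sqLen i j / l.sqLen i j * l.sqLen j k := by
    field_simp; linarith
  have f2 : c i * c k * l'.sqLen i k = c i * c j * l'.sqLen i j / l.sqLen i j * l.sqLen i k := by
    field_simp; linarith
  refine ⟨c i * c j * l'.sqLen i j / l.sqLen i j, fun a ha b hb hab => ?_⟩
  simp only [Finset.mem_insert, Finset.mem_singleton] at ha hb
  rcases ha with rfl | rfl | rfl <;> rcases hb with rfl | rfl | rfl
  · exact absurd rfl hab
  · exact f0
  · exact f2
  · rw [l'.sqLen_comm, l.sqLen_comm a b, mul_comm (c a)]; exact f0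
  · exact absurd rfl hab
  · exact f1
  · rw [l'.sqLen_comm, l.sqLen_comm a b, mul_comm (c a)]; exact f2
  · rw [l'.sqLen_comm, l.sqLen_comm a b, mul_comm (c a)]; exact f1
  · exact absurd rfl hab

/-- On each triangle, a discrete conformal map scales the barycentric coordinates, with weights that
carry the squared lengths to each other up to a factor. -/
theorem IsDiscreteConformalMap.exists_scale {F : T.space ≃ₜ T.space}
    (hF : l.IsDiscreteConformalMap l' F) {t : Finset V} (ht : t ∈ T.triangles) :
    ∃ d : V → ℝ, ∃ μ : ℝ, 0 < μ ∧ (∀ i ∈ t, 0 < d i) ∧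
      (∀ i ∈ t, ∀ j ∈ t, i ≠ j → d i * d j * l'.sqLen i j = μ * l.sqLen i j) ∧
      ∀ x : T.space, (x : V → ℝ) ∈ simplex t → (F x : V → ℝ) = scale d x := by
  obtain ⟨A, hv, hcirc, hx⟩ := hF t ht
  choose! c hc0 hc using fun i (hi : i ∈ t) => projMap_toProj.1 (hv i hi)
  have hA : ∀ x, A ((l.placement ht).homog x) = (l'.placement ht).homog (c * x) := by
    intro x
    rw [Placement.homog, map_sum, Placement.homog]
    refine Finset.sum_congr rfl fun i hi => ?_
    rw [map_smul, hc i hi, smul_smul, Pi.mul_apply, mul_comm]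
  have hcF : ∀ x : T.space, (x : V → ℝ) ∈ simplex t → ∃ r : ℝ, r ≠ 0 ∧
      ∀ i ∈ t, c i * (x : V → ℝ) i = r * (F x : V → ℝ) i := by
    intro x hxt
    obtain ⟨hFx, e⟩ := hx x hxt
    obtain ⟨r, hr, e⟩ := projMap_toProj.1 e
    rw [← Placement.homog_of_mem _ hxt, ← Placement.homog_of_mem _ hFx, hA,
      ← Placement.homog_smul, ← sub_eq_zero, ← Placement.homog_sub] at e
    have e := eq_zero_of_homog_eq_zero ht (fun i hi => by simp [hxt.2.1 i hi, hFx.2.1 i hi]) e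
    exact ⟨r, hr, fun i _ => sub_eq_zero.1 (congrFun e i)⟩
  have hsign : ∀ i ∈ t, ∀ j ∈ t, 0 < c i * c j := by
    intro i hi j hj
    by_cases hij : i = j
    · subst hij; exact mul_self_pos.2 (hc0 i hi)
    have hm := midpt_mem hi hj hij
    obtain ⟨r, hr, e⟩ := hcF ⟨midpt i j, t, ht, hm.1⟩ hm.1
    have hFm := (hx ⟨midpt i j, t, ht, hm.1⟩ hm.1).1
    have e1 := e i hi
    have e2 := e j hj
    have m1 : midpt i j i = 1 / 2 := by simp [midpt, hij]
    have m2 : midpt i j j = 1 / 2 := by simp [midpt, Ne.symm hij]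
    simp only [m1, m2] at e1 e2
    have h1 := hFm.1 i
    have h2 := hFm.1 j
    have h3 : c i * c j = 4 * (r * r * ((F ⟨midpt i j, t, ht, hm.1⟩ : V → ℝ) i *
        (F ⟨midpt i j, t, ht, hm.1⟩ : V → ℝ) j)) := by
      linear_combination 4 * (c j * (1 / 2)) * e1 +
        4 * (r * (F ⟨midpt i j, t, ht, hm.1⟩ : V → ℝ) i) * e2
    refine lt_of_le_of_ne ?_ (mul_ne_zero (hc0 i hi) (hc0 j hj)).symm
    rw [h3]
    have := mul_self_nonneg r
    positivity
  obtain ⟨μ, hμ⟩ := exists_proportional (l := l) (l' := l') ht (c := c) (by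
    intro x h0
    by_cases hx0 : (l.placement ht).homog x = 0
    · have h1 := hA x
      rw [hx0, map_zero] at h1
      rw [form_self_eq ht, ← h1]
      simp
    · obtain ⟨p, r, hr, hp⟩ := exists_of_form_eq_zero ht hx0 h0
      have hpc := (mem_circ_iff ht hr hp).2 h0
      obtain ⟨q, hq, e⟩ : projMap A (toProj p) ∈ toProj '' {p | p ∈ (l'.placement ht).circ} :=
        hcirc ▸ ⟨p, hpc, rfl⟩
      obtain ⟨s, hs, e⟩ := projMap_toProj.1 e.symm
      have h1 := hA x
      rw [hp, map_smul, e, smul_smul] at h1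
      exact (mem_circ_iff ht (mul_ne_zero hr hs) h1.symm).1 hq)
  obtain ⟨i, j, k, hij, hik, hjk, rfl⟩ := Finset.card_eq_three.1 ht.2
  have hi : i ∈ ({i, j, k} : Finset V) := by simp
  have hj : j ∈ ({i, j, k} : Finset V) := by simp
  have hci := hc0 i hi
  -- The numbers `c` have a common sign, so that one of them can be used to make all of them positive.
  refine ⟨c i • c, c i ^ 2 * μ, mul_pos (by positivity) ?_, fun a ha => hsign i hi a ha,
    fun a ha b hb hab => ?_, fun x hxt => ?_⟩
  · have h1 := hμ i hi j hj hij
    have h2 := l.sqLen_pos_of_mem ht hi hj hij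
    have h3 := mul_pos (hsign i hi j hj) (l'.sqLen_pos_of_mem ht hi hj hij)
    rw [h1] at h3
    exact (mul_pos_iff_of_pos_right h2).1 h3
  · simp only [Pi.smul_apply, smul_eq_mul]
    linear_combination c i ^ 2 * hμ a ha b hb hab
  · obtain ⟨r, hr, e⟩ := hcF x hxt
    have hFx := (hx x hxt).1
    have : (c i • c) * (x : V → ℝ) = (c i * r) • (F x : V → ℝ) := by
      funext a
      simp only [Pi.mul_apply, Pi.smul_apply, smul_eq_mul]
      by_cases ha : a ∈ ({i, j, k} : Finset V)
      · rw [mul_assoc, e a ha, mul_assoc]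
      · rw [hxt.2.1 a ha, hFx.2.1 a ha, mul_zero, mul_zero]
    rw [scale, this, radialProj_smul (mul_ne_zero hci hr), radialProj_eq_self hFx]

theorem IsDiscreteConformalMap.exists_isometry {F : T.space ≃ₜ T.space}
    (hF : l.IsDiscreteConformalMap l' F) :
    ∃ g : T.punctured ≃ T.punctured, l.IsHyperbolicIsometry l' g ∧ Extends F g := by
  have hs : ∀ x : T.space, Function.support (F x : V → ℝ) = Function.support (x : V → ℝ) := by
    intro x
    obtain ⟨t, ht, hx⟩ := x.2
    obtain ⟨d, μ, -, hd, -, h⟩ := hF.exists_scale ht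
    rw [h x hx, support_scale hd hx]
  obtain ⟨g, hg⟩ := exists_restrict F hs
  refine ⟨g, isHyperbolicIsometry_of_triangleDist (fun x => ?_) fun t ht x y hx hy => ?_, hg⟩
  · rw [← hg x, hs]
  · obtain ⟨d, μ, hμ, hd, hl, h⟩ := hF.exists_scale ht
    rw [← hg x, ← hg y, h _ hx.1, h _ hy.1]
    exact triangleDist_scale ht hμ hd hl hx hy

/-! ### Extension to the vertices -/

theorem _root_.SurfaceTriangulation.dense_punctured :
    Dense {x : T.space | (x : V → ℝ) ∈ T.punctured} := by
  rintro ⟨x, t, ht, hx⟩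
  rw [closure_subtype]
  obtain ⟨i, j, k, hij, -, -, hijk⟩ := Finset.card_eq_three.1 ht.2
  have hi : i ∈ t := by simp [hijk]
  have hj : j ∈ t := by simp [hijk]
  have hm := mem_puncturedSimplex_iff.1 (midpt_mem hi hj hij)
  -- The segment from `x` to the midpoint of an edge of a triangle that contains `x`.
  have hlim : Tendsto (fun s : ℝ => (1 - s) • x + s • midpt i j) (𝓝[>] 0) (𝓝 x) := by
    have : ContinuousAt (fun s : ℝ => (1 - s) • x + s • midpt i j) 0 := by fun_prop
    have h := this.tendsto
    simp only [sub_zero, one_smul, zero_smul, add_zero] at h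
    exact h.mono_left nhdsWithin_le_nhds
  refine mem_closure_of_tendsto hlim ?_
  filter_upwards [Ioo_mem_nhdsGT (zero_lt_one' ℝ)] with s hs
  have hp : (1 - s) • x + s • midpt i j ∈ puncturedSimplex t := by
    rw [mem_puncturedSimplex_iff]
    have h1 : 0 ≤ 1 - s := by linarith [hs.2]
    refine ⟨⟨fun m => add_nonneg (mul_nonneg h1 (hx.1 m)) (mul_nonneg hs.1.le (hm.1.1 m)),
      fun m hmt => by simp [hx.2.1 m hmt, hm.1.2.1 m hmt], i, j, hij, ?_, ?_⟩, ?_⟩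
    · exact add_pos_of_nonneg_of_pos (mul_nonneg h1 (hx.1 i))
        (mul_pos hs.1 (by simp [midpt, hij]))
    · exact add_pos_of_nonneg_of_pos (mul_nonneg h1 (hx.1 j))
        (mul_pos hs.1 (by simp [midpt, hij.symm]))
    · simp only [Pi.add_apply, Pi.smul_apply, smul_eq_mul, Finset.sum_add_distrib,
        ← Finset.mul_sum, hx.2.2, hm.2]
      ring
  exact ⟨⟨_, t, ht, hp.1⟩, mem_punctured ht hp, rfl⟩

theorem eq_scaleHomeo_of_extends {d : V → ℝ} (hd : ∀ i, 0 < d i) {g : T.punctured ≃ T.punctured}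
    (hg : ∀ x : T.punctured, (g x : V → ℝ) = scale d x) {F : T.space ≃ₜ T.space}
    (hF : Extends F g) : F = T.scaleHomeo hd :=
  DFunLike.coe_injective <| F.continuous.ext_on T.dense_punctured (T.scaleHomeo hd).continuous
    fun x hx => Subtype.ext ((hF ⟨x, hx⟩).trans (hg ⟨x, hx⟩))

end DiscreteMetric
end

theorem mainTheorem8 {V : Type*} [DecidableEq V] (T : SurfaceTriangulation V) :
    (∀ l : DiscreteMetric T,
      T.IsHyperbolicCuspMetric l.hypDist ∧ l.RestrictsToTriangles l.hypDist) ∧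
    ∀ l l' : DiscreteMetric T,
      (l.ConformallyEquivalent l' ↔
        ∃ g : T.punctured ≃ T.punctured, l.IsHyperbolicIsometry l' g) ∧
      (∀ F : T.space ≃ₜ T.space, l.IsDiscreteConformalMap l' F ↔
        ∃ g : T.punctured ≃ T.punctured,
          l.IsHyperbolicIsometry l' g ∧ DiscreteMetric.Extends F g) ∧
      (∀ g : T.punctured ≃ T.punctured, l.IsHyperbolicIsometry l' g →
        ∃! F : T.space ≃ₜ T.space,
          l.IsDiscreteConformalMap l' F ∧ DiscreteMetric.Extends F g) := by
  refine ⟨fun l => ⟨l.isHyperbolicCuspMetric, l.restrictsToTriangles⟩, fun l l' =>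
    ⟨?_, fun F => ⟨fun hF => hF.exists_isometry, ?_⟩, fun g hg => ?_⟩⟩
  · rw [DiscreteMetric.conformallyEquivalent_iff]
    constructor
    · rintro ⟨d, hd⟩
      obtain ⟨g, hg⟩ := DiscreteMetric.exists_extends_of_weights hd
      exact ⟨g, DiscreteMetric.isHyperbolicIsometry_of_weights hd hg⟩
    · rintro ⟨g, hg⟩
      obtain ⟨d, hd, -⟩ := hg.exists_weights
      exact ⟨d, hd⟩
  · rintro ⟨g, hg, hF⟩
    obtain ⟨d, hd, hgd⟩ := hg.exists_weights
    rw [DiscreteMetric.eq_scaleHomeo_of_extends hd.1 hgd hF]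
    exact DiscreteMetric.isDiscreteConformalMap_of_weights hd
  · obtain ⟨d, hd, hgd⟩ := hg.exists_weights
    exact ⟨T.scaleHomeo hd.1, ⟨DiscreteMetric.isDiscreteConformalMap_of_weights hd,
      fun x => (hgd x).symm⟩, fun F hF => DiscreteMetric.eq_scaleHomeo_of_extends hd.1 hgd hF.2⟩
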